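/- Let $N\ge 1$, let $\Omega,D\subset\mathbb R^N$ be bounded open sets with $\overline\Omega\subset D$, let $2\le p<\infty$ and $1/p+1/q=1$. Let $W_0^{1,p}(\Omega)$ be the closure of $C_0^\infty(\Omega)$ in the norm $\|y\|=\big(\int_\Omega\sum_{i}|\partial_i y|^p\,dx+\int_\Omega|y|^p\,dx\big)^{1/p}$ and $W^{-1,q}(\Omega)$ its dual; likewise for $D$. Extension by zero embeds $W_0^{1,p}(\Omega)$ in $W_0^{1,p}(D)$. For $\eta\in\mathbb R^N$ put $[\eta^{p-2}]=\mathrm{diag}(|\eta_1|^{p-2},\dots,|\eta_N|^{p-2})$ and $|\eta|_p^p=\sum_k|\eta_k|^p$. *Controls.* Let $0<\alpha\le\beta<\infty$ and let $M_p^{\alpha,\beta}(D)$ be the set of symmetric $\mathcal U=[a_{ij}]\in L^\infty(D;\mathbb R^{N\times N})$ such that, for a.e. $x\in D$, $|a_{ij}(x)|\le\beta$ for all $i,j$, and for all $\zeta,\eta\in\mathbb R^N$ $$\big(\mathcal U(x)([\zeta^{p-2}]\zeta-[\eta^{p-2}]\eta),\zeta-\eta\big)\ge 0,\qquad \big(\mathcal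 U(x)[\zeta^{p-2}]\zeta,\zeta\big)\ge\alpha|\zeta|_p^p .$$ Let $\xi_1,\xi_2\in L^\infty(D)$ with $0\le\xi_1\le\xi_2$ a.e., and let $Q_1,\dots,Q_N$ be nonempty compact convex subsets of $W^{-1,q}(D)$. Let $U_b$ be the set of $\mathcal U\in M_p^{\alpha,\beta}(D)$ with $\xi_1\le a_{ij}\le\xi_2$ a.e. in $D$ for all $i,j$, and $U_{sol}$ the set of $\mathcal U=[u_1,\dots,u_N]\in M_p^{\alpha,\beta}(D)$ (columns $u_i$) with $\mathrm{div}\,u_i\in Q_i$ for all $i$, where $\langle\mathrm{div}\,u,\varphi\rangle=-\int_D(u,\nabla\varphi)\,dx$ for $\varphi\in W_0^{1,p}(D)$. Suppose that $U_{ad}=U_b\cap U_{sol}$ is nonempty. *Operators.* Let $f\in W^{-1,q}(D)$ and $g,z_d\in L^p(D)$, and write $\langle w,z\rangle=\int_\Omega wz\,dx$ for $w\in L^q(\Omega)$, $z\in L^p(\Omega)$. Let $B:L^q(\Omega)\to L^p(\Omega)$ be linear, continuous and positive ($\langle w,Bw\rangle\ge 0$ for all $w$), with a right inverse $B_r^{-1}$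 (that is, $BB_r^{-1}h=h$) defined on a subset of $L^p(\Omega)$ that contains $g|_\Omega$. Let $F:W_0^{1,p}(\Omega)\times L^p(\Omega)\to L^q(\Omega)$ satisfy: 1. (uniformly semi-bounded variation) for every bounded $Y_0\subset W_0^{1,p}(\Omega)$ there are a seminorm $|||\cdot|||$ on $L^p(\Omega)$ for which the unit ball of $L^p(\Omega)$ is totally bounded, and functions $C_y:\mathbb R_+\times\mathbb R_+\to\mathbb R$ ($y\in Y_0$), continuous and with $C_y(r,t)/t\to 0$ as $t\to 0+$ for each $r>0$, such that for all $R>0$, $y\in Y_0$ and $\|z_1\|,\|z_2\|\le R$ $$\langle F(y,z_1)-F(y,z_2),z_1-z_2\rangle\ge-\inf_{y'\in Y_0}C_{y'}(R,|||z_1-z_2|||);$$ 2. (radial continuity) for all $y\in W_0^{1,p}(\Omega)$ and $z_1,z_2\in L^p(\Omega)$ there is $\varepsilon>0$ such that $\tau\mapsto\langle F(y,z_1+\tau z_2),z_2\rangle$ is continuous on $[0,\varepsilon]$; 3. (coercivity) for every bounded $Y_0\subset W_0^{1,p}(\Omega)$ there is $\lambda>0$ such that $\langle F(y,z)-B_r^{-1}(g|_\Omega),z\rangle\ge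 0$ whenever $y\in Y_0$ and $\|z\|_{L^p(\Omega)}>\lambda$; 4. (compactness in $y$) if $y_k\to y_0$ weakly in $W_0^{1,p}(\Omega)$, then $F(y_k,z)\to F(y_0,z)$ strongly in $L^q(\Omega)$ for every $z\in L^p(\Omega)$. Let $\Xi_{sol}$ be the set of all $(\mathcal U,y,z)\in U_{ad}\times W_0^{1,p}(\Omega)\times L^p(\Omega)$ such that $$\int_\Omega\big(\mathcal U[(\nabla y)^{p-2}]\nabla y,\nabla v\big)\,dx+\int_\Omega|y|^{p-2}y\,v\,dx=\langle f,v\rangle\quad\text{for all }v\in W_0^{1,p}(\Omega)$$ and $z+BF(y,z)=g$ in $\Omega$ in the sense of distributions. Then there is $(\mathcal U^{opt},y^{opt},z^{opt})\in\Xi_{sol}$ with $$\int_\Omega|z^{opt}-z_d|^p\,dx=\inf_{(\mathcal U,y,z)\in\Xi_{sol}}\int_\Omega|z-z_d|^p\,dx .$$ -/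

import Mathlib

open MeasureTheory Set Filter Topology
open scoped ENNReal

noncomputable section

namespace HammersteinOCP

/-- The Euclidean space `ℝ^N`. -/
abbrev Space (N : ℕ) := EuclideanSpace ℝ (Fin N)

/-- The Lebesgue space `L^r(Ω)`. -/
abbrev LpOn {N : ℕ} (r : ℝ≥0∞) (Ω : Set (Space N)) := Lp ℝ r (volume.restrict Ω)

/-- The partial derivative `∂φ/∂x_i`. -/
def partialDeriv {N : ℕ} (i : Fin N) (φ : Space N → ℝ) (x : Space N) : ℝ :=
  fderiv ℝ φ x (EuclideanSpace.single i 1)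

/-- `φ ∈ C_0^∞(Ω)`. -/
structure IsTestFunction {N : ℕ} (Ω : Set (Space N)) (φ : Space N → ℝ) : Prop where
  smooth : ContDiff ℝ (⊤ : ℕ∞) φ
  compact : HasCompactSupport φ
  support : tsupport φ ⊆ Ω

/-! ### Sobolev spaces

An element of `W_0^{1,p}(Ω)` is represented by its extension by zero to `ℝ^N`, together with the
extension by zero of its weak gradient: the component `none` is the function, the component
`some i` is its `i`-th weak partial derivative. -/

/-- Tuples `(y, v_1, …, v_N)` in `L^p(ℝ^N)^{N+1}`, normed by
`(‖y‖_p^p + ∑ i, ‖v_i‖_p^p)^{1/p}`. -/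
abbrev JetSpace (N : ℕ) (p : ℝ≥0∞) :=
  PiLp p (fun _ : Option (Fin N) => Lp ℝ p (volume : Measure (Space N)))

/-- The tuples `(φ, ∂_1 φ, …, ∂_N φ)` with `φ ∈ C_0^∞(Ω)`. -/
def testJets {N : ℕ} (p : ℝ≥0∞) [Fact (1 ≤ p)] (Ω : Set (Space N)) :
    Submodule ℝ (JetSpace N p) where
  carrier := {w | ∃ φ : Space N → ℝ, IsTestFunction Ω φ ∧
    (w none : Space N → ℝ) =ᵐ[volume] φ ∧
    ∀ i : Fin N, (w (some i) : Space N → ℝ) =ᵐ[volume] partialDeriv i φ}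
  zero_mem' := by
    refine ⟨0, ⟨contDiff_const, HasCompactSupport.zero, by simp [tsupport]⟩, ?_, fun i => ?_⟩
    · exact Lp.coeFn_zero ℝ p volume
    · refine (Lp.coeFn_zero ℝ p volume).trans (Eventually.of_forall fun x => ?_)
      simp [partialDeriv]
  add_mem' := by
    rintro a b ⟨φ, hφ, h1, h2⟩ ⟨ψ, hψ, h3, h4⟩
    refine ⟨φ + ψ, ⟨hφ.smooth.add hψ.smooth, hφ.compact.add hψ.compact, ?_⟩, ?_, fun i => ?_⟩
    · exact (tsupport_add φ ψ).trans (union_subset hφ.support hψ.support)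
    · exact (Lp.coeFn_add _ _).trans (h1.add h3)
    · refine (Lp.coeFn_add _ _).trans (((h2 i).add (h4 i)).trans (Eventually.of_forall fun x => ?_))
      simp [partialDeriv, fderiv_add (hφ.smooth.differentiable (by simp) x)
        (hψ.smooth.differentiable (by simp) x)]
  smul_mem' := by
    rintro c a ⟨φ, hφ, h1, h2⟩
    refine ⟨c • φ, ⟨hφ.smooth.const_smul c, hφ.compact.smul_left (f := fun _ => c), ?_⟩, ?_,
      fun i => ?_⟩
    · exact (tsupport_smul_subset_right (fun _ => c) φ).trans hφ.support
    · exact (Lp.coeFn_smul _ _).trans (h1.const_smul c)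
    · refine (Lp.coeFn_smul _ _).trans (((h2 i).const_smul c).trans
        (Eventually.of_forall fun x => ?_))
      simp [partialDeriv, fderiv_const_smul (hφ.smooth.differentiable (by simp) x)]

/-- `W_0^{1,p}(Ω)`: the closure of `C_0^∞(Ω)` in the norm
`(∑ i, ∫ |∂y/∂x_i|^p + ∫ |y|^p)^{1/p}`. -/
def W0 {N : ℕ} (p : ℝ≥0∞) [Fact (1 ≤ p)] (Ω : Set (Space N)) : Submodule ℝ (JetSpace N p) :=
  (testJets p Ω).topologicalClosure

/-- The function underlying an element of `W_0^{1,p}(Ω)`. -/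
def stateFun {N : ℕ} {p : ℝ≥0∞} [Fact (1 ≤ p)] {Ω : Set (Space N)} (y : W0 p Ω) : Space N → ℝ :=
  (y : JetSpace N p) none

/-- The `i`-th weak partial derivative of an element of `W_0^{1,p}(Ω)`. -/
def stateGrad {N : ℕ} {p : ℝ≥0∞} [Fact (1 ≤ p)] {Ω : Set (Space N)} (y : W0 p Ω) (i : Fin N) :
    Space N → ℝ :=
  (y : JetSpace N p) (some i)

/-- Extension by zero embeds `W_0^{1,p}(Ω)` into `W_0^{1,p}(D)` when `Ω ⊆ D`. -/
theorem W0_mono {N : ℕ} (p : ℝ≥0∞) [Fact (1 ≤ p)] {Ω D : Set (Space N)} (h : Ω ⊆ D) :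
    W0 p Ω ≤ W0 p D := by
  refine Submodule.topologicalClosure_mono ?_
  rintro w ⟨φ, hφ, h1⟩
  exact ⟨φ, ⟨hφ.smooth, hφ.compact, hφ.support.trans h⟩, h1⟩

/-- The gradient component is the weak gradient of the function component. -/
theorem integral_stateGrad {N : ℕ} {p q : ℝ≥0∞} [Fact (1 ≤ p)] [Fact (1 ≤ q)]
    [p.HolderConjugate q] {Ω : Set (Space N)} (y : W0 p Ω) (i : Fin N) {φ : Space N → ℝ}
    (hφ : IsTestFunction univ φ) :
    ∫ x, stateFun y x * partialDeriv i φ x = - ∫ x, stateGrad y i x * φ x := by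
  have hd : Continuous (partialDeriv i φ) :=
    (hφ.smooth.continuous_fderiv (by simp)).clm_apply continuous_const
  have hdc : HasCompactSupport (partialDeriv i φ) :=
    hφ.compact.fderiv_apply (𝕜 := ℝ) (EuclideanSpace.single i 1)
  have m1 : MemLp φ q (volume : Measure (Space N)) :=
    hφ.smooth.continuous.memLp_of_hasCompactSupport hφ.compact
  have m2 : MemLp (partialDeriv i φ) q (volume : Measure (Space N)) :=
    hd.memLp_of_hasCompactSupport hdc
  have key : ∀ (f : Lp ℝ p (volume : Measure (Space N))) (h : Space N → ℝ) (hh : MemLp h q volume),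
      ∫ x, f x * h x = (ContinuousLinearMap.mul ℝ ℝ).lpPairing volume p q f hh.toLp := by
    intro f h hh
    rw [ContinuousLinearMap.lpPairing_eq_integral]
    refine integral_congr_ae ?_
    filter_upwards [hh.coeFn_toLp] with x hx
    simp [hx]
  suffices H : ∀ w ∈ W0 p Ω, (∫ x, w none x * partialDeriv i φ x) + ∫ x, w (some i) x * φ x = 0 by
    have := H y y.2
    unfold stateFun stateGrad
    linarith
  intro w hw
  have hcl : IsClosed {w : JetSpace N p |
      (∫ x, w none x * partialDeriv i φ x) + ∫ x, w (some i) x * φ x = 0} := by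
    refine isClosed_eq ?_ continuous_const
    simp only [key _ _ m1, key _ _ m2]
    fun_prop
  refine closure_minimal ?_ hcl hw
  rintro w ⟨ψ, hψ, h1, h2⟩
  have e1 : ∫ x, w none x * partialDeriv i φ x = ∫ x, ψ x * partialDeriv i φ x := by
    refine integral_congr_ae ?_
    filter_upwards [h1] with x hx
    rw [hx]
  have e2 : ∫ x, w (some i) x * φ x = ∫ x, partialDeriv i ψ x * φ x := by
    refine integral_congr_ae ?_
    filter_upwards [h2 i] with x hx
    rw [hx]
  have hdψ : Continuous (partialDeriv i ψ) :=
    (hψ.smooth.continuous_fderiv (by simp)).clm_apply continuous_const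
  have := integral_mul_fderiv_eq_neg_fderiv_mul_of_integrable (μ := (volume : Measure (Space N)))
    (f := ψ) (g := φ) (v := EuclideanSpace.single i 1)
    ((hdψ.mul hφ.smooth.continuous).integrable_of_hasCompactSupport hφ.compact.mul_left)
    ((hψ.smooth.continuous.mul hd).integrable_of_hasCompactSupport hdc.mul_left)
    ((hψ.smooth.continuous.mul hφ.smooth.continuous).integrable_of_hasCompactSupport
      hφ.compact.mul_left)
    (fun x _ => hψ.smooth.differentiable (by simp) x) (fun x _ => hφ.smooth.differentiable (by simp) x)
  show _ + _ = (0 : ℝ)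
  rw [e1, e2]
  unfold partialDeriv
  linarith

/-- `W^{-1,q}(Ω)`, the dual space of `W_0^{1,p}(Ω)`. -/
abbrev WDual {N : ℕ} (p : ℝ≥0∞) [Fact (1 ≤ p)] (Ω : Set (Space N)) := StrongDual ℝ (W0 p Ω)

/-- Weak convergence of a sequence in a normed space. -/
def WeaklyConverges {E : Type*} [NormedAddCommGroup E] [NormedSpace ℝ E] (u : ℕ → E) (a : E) :
    Prop :=
  ∀ ℓ : StrongDual ℝ E, Tendsto (fun k => ℓ (u k)) atTop (𝓝 (ℓ a))

/-! ### Admissible controls -/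

/-- `L^∞(D; ℝ^{N×N})`. -/
abbrev Control {N : ℕ} (D : Set (Space N)) := Matrix (Fin N) (Fin N) (LpOn ∞ D)

/-- The scalar function `t ↦ |t|^{p-2} t`. -/
def signedPow (p : ℝ≥0∞) (t : ℝ) : ℝ := |t| ^ (p.toReal - 2) * t

/-- The class `M_p^{α,β}(D)`: symmetric matrices in `L^∞(D; ℝ^{N×N})` with the conditions of growth,
monotonicity and strong coercivity. -/
structure MemM {N : ℕ} (p : ℝ≥0∞) (α β : ℝ) {D : Set (Space N)} (U : Control D) : Prop where
  symm : U.IsSymm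
  growth : ∀ i j, ∀ᵐ x ∂(volume.restrict D), |U i j x| ≤ β
  monotone : ∀ᵐ x ∂(volume.restrict D), ∀ ζ η : Fin N → ℝ,
    0 ≤ ∑ i, ∑ j, U i j x * (signedPow p (ζ j) - signedPow p (η j)) * (ζ i - η i)
  coercive : ∀ᵐ x ∂(volume.restrict D), ∀ ζ : Fin N → ℝ,
    α * ∑ k, |ζ k| ^ p.toReal ≤ ∑ i, ∑ j, U i j x * signedPow p (ζ j) * ζ i

/-- The set `U_b`: matrices in `M_p^{α,β}(D)` with all entries between `ξ₁` and `ξ₂`. -/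
def Ub {N : ℕ} (p : ℝ≥0∞) (α β : ℝ) {D : Set (Space N)} (ξ₁ ξ₂ : LpOn ∞ D) : Set (Control D) :=
  {U | MemM p α β U ∧ ∀ i j, ∀ᵐ x ∂(volume.restrict D), ξ₁ x ≤ U i j x ∧ U i j x ≤ ξ₂ x}

/-- `ℓ ∈ W^{-1,q}(D)` is the divergence of the vector field `u`:
`⟨ℓ, φ⟩ = - ∫_D (u, ∇φ)` for all `φ ∈ W_0^{1,p}(D)`. -/
def IsDivergence {N : ℕ} {p : ℝ≥0∞} [Fact (1 ≤ p)] {D : Set (Space N)} (u : Fin N → LpOn ∞ D)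
    (ℓ : WDual p D) : Prop :=
  ∀ φ : W0 p D, ℓ φ = - ∫ x in D, ∑ k, u k x * stateGrad φ k x

/-- The set `U_sol`: matrices in `M_p^{α,β}(D)` whose `i`-th column has its divergence in `Q i`. -/
def Usol {N : ℕ} (p : ℝ≥0∞) [Fact (1 ≤ p)] (α β : ℝ) {D : Set (Space N)}
    (Q : Fin N → Set (WDual p D)) : Set (Control D) :=
  {U | MemM p α β U ∧ ∀ i, ∃ ℓ ∈ Q i, IsDivergence (fun k => U k i) ℓ}

/-! ### Operators of Hammerstein type -/

/-- The pairing `⟨w, z⟩` of `w ∈ L^q(Ω)` and `z ∈ L^p(Ω)`. -/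
def pairing {N : ℕ} {p q : ℝ≥0∞} {Ω : Set (Space N)} (w : LpOn q Ω) (z : LpOn p Ω) : ℝ :=
  ∫ x in Ω, w x * z x

/-- Radial continuity of `G : L^p(Ω) → L^q(Ω)`. -/
def RadiallyContinuous {N : ℕ} {p q : ℝ≥0∞} {Ω : Set (Space N)} (G : LpOn p Ω → LpOn q Ω) : Prop :=
  ∀ z₁ z₂ : LpOn p Ω, ∃ ε > (0 : ℝ),
    ContinuousOn (fun τ : ℝ => pairing (G (z₁ + τ • z₂)) z₂) (Icc 0 ε)

/-- A seminorm that is compact with respect to the norm: bounded sets are totally bounded for the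
seminorm. -/
def IsCompactSeminorm {Z : Type*} [NormedAddCommGroup Z] [NormedSpace ℝ Z] (s : Seminorm ℝ Z) :
    Prop :=
  ∀ ε > (0 : ℝ), ∃ t : Set Z, t.Finite ∧ ∀ z : Z, ‖z‖ ≤ 1 → ∃ w ∈ t, s (z - w) < ε

/-- Uniformly semi-bounded variation. The bound by `- inf_{y' ∈ Y₀} C_{y'}` is written as a bound by
`- C_{y'}` for every `y' ∈ Y₀`. -/
def HasUSBV {N : ℕ} {p q : ℝ≥0∞} [Fact (1 ≤ p)] {Ω : Set (Space N)}
    (F : W0 p Ω → LpOn p Ω → LpOn q Ω) : Prop :=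
  ∀ Y₀ : Set (W0 p Ω), Bornology.IsBounded Y₀ →
    ∃ (s : Seminorm ℝ (LpOn p Ω)) (C : W0 p Ω → ℝ → ℝ → ℝ),
      IsCompactSeminorm s ∧
      (∀ y ∈ Y₀, ContinuousOn (fun a : ℝ × ℝ => C y a.1 a.2) (Ici 0 ×ˢ Ici 0) ∧
        ∀ r > (0 : ℝ), Tendsto (fun t => C y r t / t) (𝓝[>] 0) (𝓝 0)) ∧
      ∀ R > (0 : ℝ), ∀ z₁ z₂ : LpOn p Ω, ‖z₁‖ ≤ R → ‖z₂‖ ≤ R → ∀ y ∈ Y₀, ∀ y' ∈ Y₀,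
        - C y' R (s (z₁ - z₂)) ≤ pairing (F y z₁ - F y z₂) (z₁ - z₂)

/-- Compactness of `F` in its first argument: weak convergence in `W_0^{1,p}(Ω)` is mapped to strong
convergence in `L^q(Ω)`. -/
def CompactInState {N : ℕ} {p q : ℝ≥0∞} [Fact (1 ≤ p)] [Fact (1 ≤ q)] {Ω : Set (Space N)}
    (F : W0 p Ω → LpOn p Ω → LpOn q Ω) : Prop :=
  ∀ (z : LpOn p Ω) (y : ℕ → W0 p Ω) (y₀ : W0 p Ω), WeaklyConverges y y₀ →
    Tendsto (fun k => F (y k) z) atTop (𝓝 (F y₀ z))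

/-! ### The optimal control problem -/

/-- Restriction `L^p(D) → L^p(Ω)` for `Ω ⊆ D`. -/
def restrictLp {N : ℕ} {p : ℝ≥0∞} {Ω D : Set (Space N)} (h : Ω ⊆ D) (g : LpOn p D) : LpOn p Ω :=
  ((Lp.memLp g).mono_measure (Measure.restrict_mono h le_rfl)).toLp g

/-- `y ∈ W_0^{1,p}(Ω)` is the weak solution of
`-div(U [(∇y)^{p-2}] ∇y) + |y|^{p-2} y = f` in `Ω`, where `f ∈ W^{-1,q}(D)`. -/
def IsWeakSolution {N : ℕ} {p : ℝ≥0∞} [Fact (1 ≤ p)] {Ω D : Set (Space N)} (h : Ω ⊆ D)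
    (f : WDual p D) (U : Control D) (y : W0 p Ω) : Prop :=
  ∀ v : W0 p Ω,
    (∫ x in Ω, ∑ i, ∑ j, U i j x * signedPow p (stateGrad y j x) * stateGrad v i x)
      + ∫ x in Ω, signedPow p (stateFun y x) * stateFun v x = f (Submodule.inclusion (W0_mono p h) v)

/-- `z + B F(y, z) = g` in `Ω`, in the sense of distributions. -/
def SolvesHammerstein {N : ℕ} {p q : ℝ≥0∞} [Fact (1 ≤ p)] [Fact (1 ≤ q)] {Ω D : Set (Space N)}
    (B : LpOn q Ω →L[ℝ] LpOn p Ω) (F : W0 p Ω → LpOn p Ω → LpOn q Ω) (g : LpOn p D)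
    (y : W0 p Ω) (z : LpOn p Ω) : Prop :=
  ∀ φ : Space N → ℝ, IsTestFunction Ω φ →
    (∫ x in Ω, z x * φ x) + ∫ x in Ω, B (F y z) x * φ x = ∫ x in Ω, g x * φ x

/-- The set `Ξ_sol` of admissible triplets `(U, y, z)`, for a set `Uad` of admissible controls. -/
def admissible {N : ℕ} {p q : ℝ≥0∞} [Fact (1 ≤ p)] [Fact (1 ≤ q)] {Ω D : Set (Space N)}
    (h : Ω ⊆ D) (Uad : Set (Control D)) (B : LpOn q Ω →L[ℝ] LpOn p Ω)
    (F : W0 p Ω → LpOn p Ω → LpOn q Ω) (f : WDual p D) (g : LpOn p D) :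
    Set (Control D × W0 p Ω × LpOn p Ω) :=
  {t | t.1 ∈ Uad ∧ IsWeakSolution h f t.1 t.2.1 ∧ SolvesHammerstein B F g t.2.1 t.2.2}

/-- The cost functional `I_Ω(U, y, z) = ∫_Ω |z - z_d|^p dx`. -/
def cost {N : ℕ} {p : ℝ≥0∞} [Fact (1 ≤ p)] {Ω D : Set (Space N)} (zd : LpOn p D)
    (t : Control D × W0 p Ω × LpOn p Ω) : ℝ :=
  ∫ x in Ω, |t.2.2 x - zd x| ^ p.toReal

end HammersteinOCP

end

/-! The proof is the direct method. Along a minimizing sequence `(U_k, y_k, z_k)` the controls are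
bounded in `L^∞` and the divergences of their columns stay in compact sets. The states are bounded
by coercivity of the elliptic operator, uniformly in the control, and the `z_k` are bounded because
the cost controls their norm. Subsequences therefore converge: `U_k` against all `L^q` functions,
the divergences strongly, `y_k` and `z_k` weakly. The norm is weakly lower semicontinuous, so it
remains to show that the limit is admissible and that admissible triplets exist.

In the elliptic equation both `U_k` and `∇y_k` converge only weakly. Minty's trick reduces the
passage to the limit to products of a column of `U_k` with `∇(y_k - v)`, for a fixed `v`. The
div-curl lemma `weaklyConverges_gradAlong` handles these, through integration by parts and Rellich's
theorem.

With `h = B_r^{-1} g` the Hammerstein equation reads `z = -B w`, `w = F(y, z) - h`. The graph of the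
positive linear operator `B` is maximal monotone (`eq_neg_of_forall_nonneg`), while `F(y, ·)` is
monotone up to a term that is continuous for a compact seminorm and of smaller than first order near
zero. Such a term converges under weak convergence and disappears in Minty's argument
(`eq_of_hasSBV`); hence weak limits of solutions are solutions (`eq_neg_of_weaklyConverges`).

Admissible triplets exist by a Galerkin scheme (`exists_forall_apply_nonneg`), which covers both
equations and rests on a Brouwer-type zero theorem proved by a change of variables. Weak compactness
is derived from Clarkson's inequality, valid for `p ≥ 2`, together with the Riesz representation of
the dual of `L^p`, which makes the duals separable. -/

namespace HammersteinOCP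

/-! ### Zeros of continuous vector fields in finite dimension -/

section Brouwer

/-- `det (1 + A)` is a combination of the values `det (1 + t • A)` with small `t`, with coefficients
that do not depend on `A`. -/
theorem exists_det_one_add_eq_sum (n : ℕ) {δ : ℝ} (hδ : 0 < δ) :
    ∃ (t c : ℕ → ℝ), (∀ k, 0 ≤ t k ∧ t k ≤ δ) ∧
      (∑ k ∈ Finset.range (n + 1), c k = 1) ∧
      ∀ A : Space n →L[ℝ] Space n,
        (ContinuousLinearMap.id ℝ (Space n) + A).det =
          ∑ k ∈ Finset.range (n + 1), c k * (ContinuousLinearMap.id ℝ (Space n) + t k • A).det := by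
  -- The determinant of `1 + s A` is a polynomial of degree at most `n` in `s`. Interpolation at `n
  -- + 1` distinct nodes in `[0, δ]` recovers its value at `s = 1`, with weights that depend on the
  -- nodes only.
  let t : ℕ → ℝ := fun k => δ / (k + 1)
  have ht : Function.Injective t := by
    intro a b hab
    have h1 : (0 : ℝ) < a + 1 := by positivity
    have h2 : (0 : ℝ) < b + 1 := by positivity
    simp only [t] at hab
    rw [div_eq_div_iff h1.ne' h2.ne'] at hab
    have := mul_left_cancel₀ hδ.ne' hab
    exact_mod_cast (by linarith : (a : ℝ) = b)
  let c : ℕ → ℝ := fun k => (Lagrange.basis (Finset.range (n + 1)) t k).eval 1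
  have key : ∀ P : Polynomial ℝ, P.natDegree ≤ n →
      P.eval 1 = ∑ k ∈ Finset.range (n + 1), c k * P.eval (t k) := by
    intro P hP
    have hd : P.degree < (Finset.range (n + 1)).card := by
      rw [Finset.card_range]
      exact lt_of_le_of_lt Polynomial.degree_le_natDegree (by exact_mod_cast Nat.lt_succ_of_le hP)
    conv_lhs => rw [Lagrange.eq_interpolate (s := Finset.range (n + 1)) (v := t) ht.injOn hd]
    rw [Lagrange.interpolate_apply, Polynomial.eval_finsetSum]
    refine Finset.sum_congr rfl fun k _ => ?_
    simp [c, mul_comm]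
  refine ⟨t, c, fun k => ⟨by positivity, ?_⟩, ?_, fun A => ?_⟩
  · exact div_le_self hδ.le (by linarith [(Nat.cast_nonneg k : (0 : ℝ) ≤ k)])
  · have := key 1 (by simp)
    simpa using this.symm
  · let b := (EuclideanSpace.basisFun (Fin n) ℝ).toBasis
    let M := LinearMap.toMatrix b b (A : Space n →ₗ[ℝ] Space n)
    let P : Polynomial ℝ := ((Polynomial.X : Polynomial ℝ) • M.map Polynomial.C +
      (1 : Matrix (Fin n) (Fin n) ℝ).map Polynomial.C).det
    have hPd : P.natDegree ≤ n := by
      have := Polynomial.natDegree_det_X_add_C_le M 1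
      rwa [Fintype.card_fin] at this
    have hP : ∀ s : ℝ, P.eval s = (ContinuousLinearMap.id ℝ (Space n) + s • A).det := by
      intro s
      have h1 : (ContinuousLinearMap.id ℝ (Space n) + s • A).det =
          (1 + s • M).det := by
        rw [ContinuousLinearMap.det, ← LinearMap.det_toMatrix b]
        congr 1
        simp [M]
      rw [h1]
      simp only [P]
      rw [← Polynomial.coe_evalRingHom, RingHom.map_det]
      congr 1
      ext i j
      have e : Polynomial.eval s ((Polynomial.X : Polynomial ℝ) * Polynomial.C (M i j)) = s * M i j := by
        simp [mul_comm s]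
      by_cases hij : i = j
      · subst hij
        simpa [add_comm] using e
      · simpa [hij] using e
    have := key P hPd
    simp only [hP, one_smul] at this
    exact this

/-- The integral of the Jacobian determinant of a `C¹` perturbation of the identity with compact
support. -/
theorem integral_det_id_add_fderiv {n : ℕ} {h : Space n → Space n} (hh : ContDiff ℝ 1 h) {r : ℝ}
    (hr : ∀ x, r < ‖x‖ → h x = 0) :
    ∫ x in Metric.closedBall (0 : Space n) r, (ContinuousLinearMap.id ℝ (Space n) + fderiv ℝ h x).det =
      volume.real (Metric.closedBall (0 : Space n) r) := by
  have hcs : HasCompactSupport h :=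
    HasCompactSupport.intro (isCompact_closedBall (0 : Space n) r) fun x hx => hr x (by
      simpa using hx)
  have hd : Differentiable ℝ h := hh.differentiable one_ne_zero
  obtain ⟨C, hC⟩ := ContDiff.lipschitzWith_of_hasCompactSupport hcs hh one_ne_zero
  have hdet : Continuous fun A : Space n →L[ℝ] Space n => A.det :=
    ContinuousLinearMap.continuous_det
  obtain ⟨ε, hε, hpos⟩ : ∃ ε > 0, ∀ A : Space n →L[ℝ] Space n, ‖A‖ < ε →
      0 < (ContinuousLinearMap.id ℝ (Space n) + A).det := by
    have hc : ContinuousAt (fun A : Space n →L[ℝ] Space n =>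
        (ContinuousLinearMap.id ℝ (Space n) + A).det) 0 :=
      (hdet.comp (continuous_const.add continuous_id)).continuousAt
    have : ∀ᶠ A in 𝓝 (0 : Space n →L[ℝ] Space n),
        0 < (ContinuousLinearMap.id ℝ (Space n) + A).det := by
      refine hc.eventually (lt_mem_nhds ?_)
      simp [ContinuousLinearMap.det]
    obtain ⟨ε, hε, H⟩ := Metric.eventually_nhds_iff.1 this
    exact ⟨ε, hε, fun A hA => H (by simpa using hA)⟩
  -- For `s ≤ δ` the Lipschitz constant `s * C` of `s • h` is below `1`, so `id + s • h` is
  -- bijective, and below `ε`, so its Jacobian determinant is positive.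
  let δ : ℝ := min ε 1 / (2 * (C + 1))
  have hC0 : (0 : ℝ) ≤ C := C.2
  have hδ : 0 < δ := by positivity
  have hδC : δ * C < min ε 1 := by
    have : δ * C ≤ min ε 1 / 2 := by
      simp only [δ]
      rw [div_mul_eq_mul_div, div_le_div_iff₀ (by positivity) two_pos]
      nlinarith [lt_min hε one_pos]
    linarith [lt_min hε one_pos]
  obtain ⟨t, c, ht, hc1, hdetsum⟩ := exists_det_one_add_eq_sum n hδ
  set K := Metric.closedBall (0 : Space n) r
  have hK : IsCompact K := isCompact_closedBall _ _
  have small : ∀ s : ℝ, 0 ≤ s → s ≤ δ →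
      ∫ x in K, (ContinuousLinearMap.id ℝ (Space n) + s • fderiv ℝ h x).det = volume.real K := by
    intro s hs0 hs
    have hsC : s * C < min ε 1 := (mul_le_mul_of_nonneg_right hs hC0).trans_lt hδC
    let G : Space n → Space n := fun x => x + s • h x
    have hG' : ∀ x, HasFDerivAt G (ContinuousLinearMap.id ℝ (Space n) + s • fderiv ℝ h x) x :=
      fun x => (hasFDerivAt_id x).add ((hd x).hasFDerivAt.const_smul s)
    have hlip : LipschitzWith (Real.toNNReal s * C) fun x => s • h x := by
      refine LipschitzWith.of_dist_le_mul fun x y => ?_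
      rw [dist_smul₀, NNReal.coe_mul, Real.coe_toNNReal s hs0, Real.norm_of_nonneg hs0, mul_assoc]
      exact mul_le_mul_of_nonneg_left (hC.dist_le_mul x y) hs0
    have hlt : Real.toNNReal s * C < 1 := by
      rw [← NNReal.coe_lt_coe, NNReal.coe_mul, Real.coe_toNNReal s hs0]
      exact hsC.trans_le (min_le_right _ _)
    have hinj : Function.Injective G := by
      intro x y hxy
      have e : x - y = s • h y - s • h x := by
        have : x + s • h x = y + s • h y := hxy
        rw [sub_eq_sub_iff_add_eq_add, this, add_comm]
      have h1 := hlip.dist_le_mul y x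
      rw [dist_eq_norm, ← e, dist_comm, dist_eq_norm] at h1
      have h2 : ((Real.toNNReal s * C : NNReal) : ℝ) < 1 := by exact_mod_cast hlt
      by_contra hne
      have h3 : 0 < ‖x - y‖ := norm_pos_iff.2 (sub_ne_zero.2 hne)
      nlinarith
    have hsurj : Function.Surjective G := by
      intro y
      have hcon : ContractingWith (Real.toNNReal s * C) fun x => y - s • h x := by
        refine ⟨hlt, LipschitzWith.of_dist_le_mul fun a b => ?_⟩
        rw [dist_sub_left]
        exact hlip.dist_le_mul a b
      refine ⟨ContractingWith.fixedPoint _ hcon, ?_⟩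
      have := hcon.fixedPoint_isFixedPt
      simp only [Function.IsFixedPt] at this
      simp only [G]
      exact (sub_eq_iff_eq_add.1 this).symm
    have hout : ∀ x ∉ K, G x = x := fun x hx => by
      simp [G, hr x (by simpa [K] using hx)]
    -- A bijection that is the identity outside `K` maps `K` onto itself, so the change of variables
    -- formula computes the volume of `K`.
    have himg : G '' K = K := by
      apply Subset.antisymm
      · rintro _ ⟨x, hx, rfl⟩
        by_contra hGx
        have := hinj (hout _ hGx)
        rw [this] at hGx
        exact hGx hx
      · intro y hy
        obtain ⟨x, rfl⟩ := hsurj y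
        by_cases hx : x ∈ K
        · exact ⟨x, hx, rfl⟩
        · rw [hout x hx] at hy
          exact absurd hy hx
    have := integral_image_eq_integral_abs_det_fderiv_smul (μ := (volume : Measure (Space n)))
      hK.measurableSet (fun x _ => (hG' x).hasFDerivWithinAt) hinj.injOn (fun _ => (1 : ℝ))
    rw [himg] at this
    simp only [smul_eq_mul, mul_one, integral_const, measureReal_restrict_apply_univ] at this
    rw [this]
    refine integral_congr_ae (Eventually.of_forall fun x => ?_)
    refine (abs_of_pos (hpos _ ?_)).symm
    have h1 : ‖fderiv ℝ h x‖ ≤ C := norm_fderiv_le_of_lipschitz ℝ hC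
    rw [norm_smul, Real.norm_of_nonneg hs0]
    exact ((mul_le_mul_of_nonneg_left h1 hs0).trans_lt hsC).trans_le (min_le_left _ _)
  have hcf : Continuous (fderiv ℝ h) := hh.continuous_fderiv one_ne_zero
  -- The integral for `t = 1` is a combination of the integrals for small `t`, all equal to the
  -- volume of `K`, and the weights sum to `1`.
  rw [funext fun x => hdetsum (fderiv ℝ h x), integral_finsetSum]
  · simp only [integral_const_mul, fun k => small (t k) (ht k).1 (ht k).2]
    rw [← Finset.sum_mul, hc1, one_mul]
  · intro k _
    have : Continuous fun x => (ContinuousLinearMap.id ℝ (Space n) + t k • fderiv ℝ h x).det :=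
      hdet.comp (continuous_const.add (hcf.const_smul (t k)))
    exact ((continuous_const.mul this).continuousOn).integrableOn_compact hK

/-- A `C¹` map of a Euclidean space that is the identity near infinity has a zero. -/
theorem exists_eq_zero_of_eq_id {n : ℕ} {r : Space n → Space n} (hr : ContDiff ℝ 1 r) {R : ℝ}
    (hR : ∀ x, R < ‖x‖ → r x = x) : ∃ x, r x = 0 := by
  by_contra! H
  obtain ⟨M, hM0, hRM, hrM⟩ : ∃ M : ℝ, 0 < M ∧ R < M ∧ ∀ x, ‖x‖ ≤ M → ‖r x‖ ≤ M := by
    obtain ⟨C, hC⟩ := (isCompact_closedBall (0 : Space n) R).exists_bound_of_continuousOn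
      hr.continuous.continuousOn
    refine ⟨max (max (R + 1) 1) C, ?_, ?_, fun x hx => ?_⟩
    · exact lt_max_of_lt_left (lt_max_of_lt_right one_pos)
    · exact lt_max_of_lt_left (lt_max_of_lt_left (by linarith))
    · rcases le_or_gt ‖x‖ R with h | h
      · exact (hC x (by simpa using h)).trans (le_max_right _ _)
      · rw [hR x h]; exact hx
  -- A smooth step in the squared norm: `0` up to radius `M`, `1` from radius `2 * M` on.
  let s : ℝ → ℝ := fun u => Real.smoothTransition ((u - M ^ 2) / (3 * M ^ 2))
  have hs0 : ∀ u, u ≤ M ^ 2 → s u = 0 := fun u hu =>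
    Real.smoothTransition.zero_of_nonpos (div_nonpos_of_nonpos_of_nonneg (by linarith) (by positivity))
  have hs1 : ∀ u, 4 * M ^ 2 ≤ u → s u = 1 := fun u hu =>
    Real.smoothTransition.one_of_one_le (by rw [le_div_iff₀ (by positivity)]; linarith)
  have hspos : ∀ u, M ^ 2 < u → 0 < s u := fun u hu =>
    Real.smoothTransition.pos_of_pos (div_pos (by linarith) (by positivity))
  have hsn : ∀ u, 0 ≤ s u := fun u => Real.smoothTransition.nonneg _
  have hsl : ∀ u, s u ≤ 1 := fun u => Real.smoothTransition.le_one _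
  have hsm : Monotone s := fun a b hab =>
    Real.smoothTransition.monotone (div_le_div_of_nonneg_right (by linarith) (by positivity))
  have hsc : ContDiff ℝ 1 s :=
    Real.smoothTransition.contDiff.comp ((contDiff_id.sub contDiff_const).div_const _)
  -- Rescaling by `ρ` turns the zero-free map `r` into a map `g` that sends the ball of radius `M`
  -- to its sphere, as a retraction would, and is the identity beyond radius `2 * M`.
  let ρ : ℝ → ℝ := fun τ => (1 - s (τ ^ 2)) * (M / τ) + s (τ ^ 2)
  have hρ : ∀ τ, 0 < τ → 0 < ρ τ := by
    intro τ hτ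
    rcases le_or_gt (τ ^ 2) (M ^ 2) with h | h
    · simp only [ρ, hs0 _ h]; simp; positivity
    · exact add_pos_of_nonneg_of_pos (mul_nonneg (by linarith [hsl (τ ^ 2)]) (by positivity))
        (hspos _ h)
  let g : Space n → Space n := fun x => ρ ‖r x‖ • r x
  have hgc : ContDiff ℝ 1 g := by
    have hn : ContDiff ℝ 1 fun x => ‖r x‖ := hr.norm ℝ H
    have h2 : ContDiff ℝ 1 fun x => s (‖r x‖ ^ 2) := hsc.comp (hn.pow 2)
    have h3 : ContDiff ℝ 1 fun x => ρ ‖r x‖ := ((contDiff_const.sub h2).mul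
      (contDiff_const.div hn fun x => norm_ne_zero_iff.2 (H x))).add h2
    exact h3.smul hr
  have hgnorm : ∀ x, ‖g x‖ = M + s (‖r x‖ ^ 2) * (‖r x‖ - M) := by
    intro x
    have hx : 0 < ‖r x‖ := norm_pos_iff.2 (H x)
    simp only [g]
    rw [norm_smul, Real.norm_of_nonneg (hρ _ hx).le]
    simp only [ρ]
    field_simp
    ring
  have hgM : ∀ x, ‖x‖ ≤ M → ‖g x‖ = M := by
    intro x hx
    rw [hgnorm, hs0, zero_mul, add_zero]
    exact pow_le_pow_left₀ (norm_nonneg _) (hrM x hx) 2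
  have hgout : ∀ x, 2 * M < ‖x‖ → g x = x := by
    intro x hx
    have h1 : r x = x := hR x (by linarith)
    have h2 : s (‖x‖ ^ 2) = 1 := hs1 _ (by nlinarith)
    simp [g, ρ, h1, h2]
  let K := Metric.closedBall (0 : Space n) (2 * M)
  have hintg : ∫ x in K, (fderiv ℝ g x).det = volume.real K := by
    have hh : ContDiff ℝ 1 fun x => g x - x := hgc.sub contDiff_id
    have := integral_det_id_add_fderiv hh (r := 2 * M) fun x hx => by
      simp [hgout x hx]
    rw [← this]
    refine integral_congr_ae (Eventually.of_forall fun x => ?_)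
    have : fderiv ℝ (fun x => g x - x) x = fderiv ℝ g x - ContinuousLinearMap.id ℝ (Space n) :=
      ((hgc.differentiable one_ne_zero x).hasFDerivAt.sub (hasFDerivAt_id x)).fderiv
    simp only [this, add_sub_cancel]
  -- Since `‖g‖` is constant near `x`, the range of the derivative is orthogonal to the nonzero
  -- vector `g x`, so the derivative is not surjective.
  have hzero : ∀ x, ‖x‖ < M → (fderiv ℝ g x).det = 0 := by
    intro x hx
    have hev : (fun y => inner ℝ (g y) (g y)) =ᶠ[𝓝 x] fun _ => M ^ 2 := by
      have : ∀ᶠ y in 𝓝 x, ‖y‖ < M := continuous_norm.continuousAt.eventually (gt_mem_nhds hx)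
      filter_upwards [this] with y hy
      rw [real_inner_self_eq_norm_sq, hgM y hy.le]
    have hgd := (hgc.differentiable one_ne_zero x).hasFDerivAt
    have horth : ∀ v, inner ℝ (g x) (fderiv ℝ g x v) = 0 := by
      intro v
      have h1 := hgd.inner ℝ hgd
      have h2 : HasFDerivAt (fun y => inner ℝ (g y) (g y)) (0 : Space n →L[ℝ] ℝ) x :=
        (hasFDerivAt_const (M ^ 2) x).congr_of_eventuallyEq hev
      have h3 := DFunLike.congr_fun (h1.unique h2) v
      simp only [fderivInnerCLM_apply, ContinuousLinearMap.comp_apply,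
        ContinuousLinearMap.prod_apply, zero_apply] at h3
      rw [real_inner_comm (g x)] at h3
      linarith
    by_contra hdet
    have hu : IsUnit (fderiv ℝ g x : Space n →ₗ[ℝ] Space n).det := isUnit_iff_ne_zero.2 hdet
    have hsurj := (LinearMap.equivOfIsUnitDet hu).surjective
    obtain ⟨v, hv⟩ := hsurj (g x)
    have h1 := horth v
    have h2 : fderiv ℝ g x v = g x := (LinearMap.equivOfIsUnitDet_apply hu v).symm.trans hv
    rw [h2, real_inner_self_eq_norm_sq, hgM x hx.le] at h1
    exact (pow_pos hM0 2).ne' h1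
  let S := K \ Metric.ball (0 : Space n) M
  have hKm : MeasurableSet K := Metric.isClosed_closedBall.measurableSet
  have hSm : MeasurableSet S := hKm.diff Metric.isOpen_ball.measurableSet
  have hSr : ∀ x ∈ S, r x = x ∧ M ≤ ‖x‖ := fun x hx => by
    have : M ≤ ‖x‖ := by simpa [S] using hx.2
    exact ⟨hR x (by linarith), this⟩
  have hmono : ∀ a b, M ≤ a → a < b → M + s (a ^ 2) * (a - M) < M + s (b ^ 2) * (b - M) := by
    intro a b ha hab
    have h1 : s (a ^ 2) ≤ s (b ^ 2) := hsm (pow_le_pow_left₀ (by linarith) hab.le 2)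
    have h2 : 0 < s (b ^ 2) := hspos _ (pow_lt_pow_left₀ (by linarith) hM0.le two_ne_zero)
    nlinarith [mul_le_mul_of_nonneg_right h1 (sub_nonneg.2 ha)]
  have hinj : InjOn g S := by
    intro x hx y hy hxy
    obtain ⟨hrx, hx'⟩ := hSr x hx
    obtain ⟨hry, hy'⟩ := hSr y hy
    have hn : ‖g x‖ = ‖g y‖ := by rw [hxy]
    rw [hgnorm, hgnorm, hrx, hry] at hn
    have hxy' : ‖x‖ = ‖y‖ := by
      rcases lt_trichotomy ‖x‖ ‖y‖ with h | h | h
      · exact absurd hn (hmono _ _ hx' h).ne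
      · exact h
      · exact absurd hn (hmono _ _ hy' h).ne'
    simp only [g, hrx, hry, hxy'] at hxy
    exact smul_right_injective _ (hρ ‖y‖ (by linarith)).ne' hxy
  have himg : g '' S ⊆ S := by
    rintro _ ⟨x, hx, rfl⟩
    obtain ⟨hrx, hx'⟩ := hSr x hx
    have hx2 : ‖x‖ ≤ 2 * M := by simpa [S, K] using hx.1
    have h1 := hgnorm x
    rw [hrx] at h1
    have h2 := hsn (‖x‖ ^ 2)
    have h3 := hsl (‖x‖ ^ 2)
    refine ⟨?_, ?_⟩
    · simp only [K, mem_closedBall_zero_iff]; nlinarith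
    · simp only [mem_ball_zero_iff, not_lt]; nlinarith
  have hcf : Continuous fun x => (fderiv ℝ g x).det :=
    ContinuousLinearMap.continuous_det.comp (hgc.continuous_fderiv one_ne_zero)
  have hKc : IsCompact K := isCompact_closedBall _ _
  -- Only the shell `S` contributes to the integral, and `g` maps it injectively into itself. The
  -- volume of `K` would thus be at most that of `S`, although the two differ by the volume of a
  -- ball.
  have h1 : ∫ x in K, (fderiv ℝ g x).det = ∫ x in S, (fderiv ℝ g x).det := by
    refine setIntegral_eq_of_subset_of_forall_sdiff_eq_zero hKm sdiff_subset
      fun x hx => hzero x ?_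
    by_contra hx'
    exact hx.2 ⟨hx.1, by simpa using hx'⟩
  have h2 : ∫ x in S, (fderiv ℝ g x).det ≤ ∫ x in S, |(fderiv ℝ g x).det| := by
    refine integral_mono ?_ ?_ fun x => le_abs_self _
    · exact (hcf.continuousOn.integrableOn_compact hKc).mono_set sdiff_subset
    · exact (hcf.abs.continuousOn.integrableOn_compact hKc).mono_set sdiff_subset
  have h3 : ∫ x in S, |(fderiv ℝ g x).det| = volume.real (g '' S) := by
    have := integral_image_eq_integral_abs_det_fderiv_smul (μ := (volume : Measure (Space n)))
      hSm (fun x _ => ((hgc.differentiable one_ne_zero x).hasFDerivAt).hasFDerivWithinAt) hinj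
      (fun _ => (1 : ℝ))
    simpa using this.symm
  have hSfin : volume S ≠ ∞ := ((measure_mono sdiff_subset).trans_lt hKc.measure_lt_top).ne
  have h4 : volume.real (g '' S) ≤ volume.real S := measureReal_mono himg hSfin
  have h5 : volume.real S = volume.real K - volume.real (Metric.ball (0 : Space n) M) :=
    measureReal_sdiff (Metric.ball_subset_closedBall.trans
      (Metric.closedBall_subset_closedBall (by linarith))) Metric.isOpen_ball.measurableSet hKc.measure_lt_top.ne
  have h6 : 0 < volume.real (Metric.ball (0 : Space n) M) :=
    ENNReal.toReal_pos (Metric.measure_ball_pos _ _ hM0).ne' measure_ball_lt_top.ne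
  linarith

/-- A continuous vector field on a Euclidean space that points outwards near infinity has a zero. -/
theorem exists_eq_zero_of_inner_pos {n : ℕ} {T : Space n → Space n} (hT : Continuous T) {R : ℝ}
    (hR0 : 0 < R) (hR : ∀ x, R ≤ ‖x‖ → 0 < inner ℝ (T x) x) : ∃ x, T x = 0 := by
  by_contra! H
  -- The field is interpolated with the identity between radii `R` and `2 * R`. No zero appears
  -- there, because both fields have positive inner product with `x`.
  let l : ℝ → ℝ := fun t => max 0 (min 1 ((t - R) / R))
  have hl0 : ∀ t, 0 ≤ l t := fun t => le_max_left _ _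
  have hl1 : ∀ t, l t ≤ 1 := fun t => max_le zero_le_one (min_le_left _ _)
  have hlR : ∀ t, t ≤ R → l t = 0 := fun t ht => by
    have : (t - R) / R ≤ 0 := div_nonpos_of_nonpos_of_nonneg (by linarith) hR0.le
    exact max_eq_left ((min_le_right _ _).trans this)
  have hl2 : ∀ t, 2 * R ≤ t → l t = 1 := fun t ht => by
    have : 1 ≤ (t - R) / R := by rw [le_div_iff₀ hR0]; linarith
    simp [l, min_eq_left this]
  have hlc : Continuous l := by fun_prop
  let d : Space n → Space n := fun x => (1 - l ‖x‖) • (T x - x)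
  have hdc : Continuous d := by fun_prop
  have hd0 : ∀ x, 2 * R ≤ ‖x‖ → d x = 0 := fun x hx => by simp [d, hl2 _ hx]
  have hne : ∀ x, x + d x ≠ 0 := by
    intro x hx
    rcases le_or_gt ‖x‖ R with h | h
    · apply H x
      simpa [d, hlR _ h] using hx
    · have h1 : inner ℝ (x + d x) x = 0 := by rw [hx, inner_zero_left]
      have h2 : x + d x = (1 - l ‖x‖) • T x + l ‖x‖ • x := by
        simp only [d]; module
      rw [h2, inner_add_left, real_inner_smul_left, real_inner_smul_left,
        real_inner_self_eq_norm_sq] at h1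
      have h3 := hR x h.le
      have h4 : 0 < ‖x‖ ^ 2 := by have := hR0.trans h; positivity
      rcases (hl1 ‖x‖).lt_or_eq with h5 | h5
      · nlinarith [mul_pos (sub_pos.2 h5) h3, mul_nonneg (hl0 ‖x‖) h4.le]
      · rw [h5] at h1; linarith
  obtain ⟨ε, hε, hεx⟩ : ∃ ε > 0, ∀ x, ε ≤ ‖x + d x‖ := by
    obtain ⟨x0, -, hx0⟩ := (isCompact_closedBall (0 : Space n) (2 * R)).exists_isMinOn
      ⟨0, by simp [hR0.le]⟩ (f := fun x => ‖x + d x‖) (by fun_prop)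
    refine ⟨min ‖x0 + d x0‖ (2 * R), lt_min (norm_pos_iff.2 (hne x0)) (by linarith), fun x => ?_⟩
    rcases le_or_gt ‖x‖ (2 * R) with h | h
    · exact (min_le_left _ _).trans (hx0 (by simpa using h))
    · rw [hd0 x h.le, add_zero]
      exact (min_le_right _ _).trans h.le
  -- The field `x + d x` has norm at least `ε`, so a `C¹` approximation of `d` with error below `ε`
  -- still gives a zero-free field. Its support lies in that of `d`, so the field remains the
  -- identity far away.
  obtain ⟨e, hec, hed, hes⟩ := hdc.exists_contDiff_approx 1 (ε := fun _ => ε) continuous_const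
    fun _ => hε
  obtain ⟨x, hx⟩ := exists_eq_zero_of_eq_id (r := fun x => x + e x) (R := 2 * R)
    (contDiff_id.add hec) fun x hx => by
      have : e x = 0 := by
        by_contra h
        exact hes h (hd0 x hx.le)
      simp [this]
  have h1 := hed x
  have h2 : x + d x = d x - e x := by
    rw [sub_eq_add_neg, add_comm, ← eq_neg_of_add_eq_zero_left hx]
  have h3 := hεx x
  rw [h2, ← dist_eq_norm, dist_comm] at h3
  exact absurd h1 (not_lt.2 h3)

end Brouwer
/-! ### Uniform convexity and weak compactness -/

section WeakCompactness

/-- Clarkson's inequality with exponent `r`. -/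
def ClarksonInequality (X : Type*) [NormedAddCommGroup X] [NormedSpace ℝ X] (r : ℝ) : Prop :=
  ∀ f g : X, ‖(2⁻¹ : ℝ) • (f + g)‖ ^ r + ‖(2⁻¹ : ℝ) • (f - g)‖ ^ r ≤ (‖f‖ ^ r + ‖g‖ ^ r) / 2

variable {X : Type*} [NormedAddCommGroup X] [NormedSpace ℝ X] {r : ℝ}

theorem ClarksonInequality.submodule (h : ClarksonInequality X r) (S : Submodule ℝ X) :
    ClarksonInequality S r := fun f g => h (f : X) (g : X)

/-- Uniform convexity in the form needed for minimizing sequences: almost minimal points whose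
midpoint is not shorter than the minimal length `d` are close to each other. -/
theorem ClarksonInequality.norm_le (hr : 0 < r) (h : ClarksonInequality X r) {f g : X} {d η ε : ℝ}
    (hd : 0 ≤ d) (hε : 0 ≤ ε) (hm : d ≤ ‖(2⁻¹ : ℝ) • (f + g)‖)
    (hf : ‖f‖ ^ r ≤ d ^ r + η) (hg : ‖g‖ ^ r ≤ d ^ r + η) (hη : η ≤ (ε / 2) ^ r) :
    ‖f - g‖ ≤ ε := by
  have h1 := h f g
  have h2 : d ^ r ≤ ‖(2⁻¹ : ℝ) • (f + g)‖ ^ r := Real.rpow_le_rpow hd hm hr.le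
  have h3 : ‖(2⁻¹ : ℝ) • (f - g)‖ ^ r ≤ (ε / 2) ^ r := by linarith
  have h4 := (Real.rpow_le_rpow_iff (norm_nonneg _) (by positivity) hr).1 h3
  rw [norm_smul, Real.norm_of_nonneg (by norm_num)] at h4
  linarith

/-- A decreasing sequence of closed convex sets that meet a fixed ball has a common point, in a
Banach space with Clarkson's inequality. -/
theorem ClarksonInequality.nonempty_iInter [CompleteSpace X] (hr : 0 < r)
    (h : ClarksonInequality X r) {K : ℕ → Set X} (hanti : Antitone K)
    (hclosed : ∀ n, IsClosed (K n)) (hconv : ∀ n, Convex ℝ (K n)) {C : ℝ}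
    (hC : ∀ n, ∃ x ∈ K n, ‖x‖ ≤ C) : (⋂ n, K n).Nonempty := by
  let d : ℕ → ℝ := fun n => Metric.infDist 0 (K n)
  have hne : ∀ n, (K n).Nonempty := fun n => let ⟨x, hx, _⟩ := hC n; ⟨x, hx⟩
  have hd0 : ∀ n, 0 ≤ d n := fun n => Metric.infDist_nonneg
  have hdm : Monotone d := fun m n hmn => Metric.infDist_le_infDist_of_subset (hanti hmn) (hne n)
  have hdle : ∀ n, ∀ x ∈ K n, d n ≤ ‖x‖ := fun n x hx => by
    simpa using Metric.infDist_le_dist_of_mem (x := (0 : X)) hx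
  have hdb : BddAbove (range d) := by
    refine ⟨C, ?_⟩
    rintro _ ⟨n, rfl⟩
    obtain ⟨x, hx, hxC⟩ := hC n
    exact (hdle n x hx).trans hxC
  have hdt : Tendsto d atTop (𝓝 (⨆ n, d n)) := tendsto_atTop_ciSup hdm hdb
  set L := ⨆ n, d n
  have hex : ∀ n : ℕ, ∃ x ∈ K n, ‖x‖ < d n + 1 / ((n : ℝ) + 1) := fun n => by
    obtain ⟨x, hx, hlt⟩ := (Metric.infDist_lt_iff (hne n)).1
      (show Metric.infDist 0 (K n) < d n + 1 / ((n : ℝ) + 1) by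
        have : (0 : ℝ) < 1 / ((n : ℝ) + 1) := by positivity
        simp only [d]; linarith)
    exact ⟨x, hx, by simpa using hlt⟩
  choose u huK hu using hex
  have hut : Tendsto (fun n => ‖u n‖) atTop (𝓝 L) := by
    refine tendsto_of_tendsto_of_tendsto_of_le_of_le hdt (h := fun n => d n + 1 / ((n : ℝ) + 1)) ?_
      (fun n => hdle n _ (huK n)) fun n => (hu n).le
    simpa using hdt.add (tendsto_one_div_add_atTop_nhds_zero_nat (𝕜 := ℝ))
  have hur : Tendsto (fun n => ‖u n‖ ^ r) atTop (𝓝 (L ^ r)) := hut.rpow_const (Or.inr hr.le)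
  have hdr : Tendsto (fun n => d n ^ r) atTop (𝓝 (L ^ r)) := hdt.rpow_const (Or.inr hr.le)
  -- The midpoint of `u n` and `u n0` lies in the convex set `K n0`, so its norm is at least `d n0`,
  -- while both points have norms close to the common limit `L`.
  have hcau : CauchySeq u := by
    refine Metric.cauchySeq_iff'.2 fun ε hε => ?_
    let η := (ε / 2 / 2) ^ r
    have hη : 0 < η := by positivity
    have e1 : ∀ᶠ n in atTop, ‖u n‖ ^ r < L ^ r + η / 2 := hur.eventually (gt_mem_nhds (by linarith))
    have e2 : ∀ᶠ n in atTop, L ^ r - η / 2 < d n ^ r := hdr.eventually (lt_mem_nhds (by linarith))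
    obtain ⟨n0, hn0⟩ := eventually_atTop.1 (e1.and e2)
    refine ⟨n0, fun n hn => ?_⟩
    rw [dist_eq_norm]
    have : ‖u n - u n0‖ ≤ ε / 2 := by
      refine h.norm_le hr (hd0 n0) (by positivity) (η := η) ?_ ?_ ?_ le_rfl
      · refine hdle n0 _ ?_
        rw [smul_add]
        exact hconv n0 (hanti hn (huK n)) (huK n0) (by norm_num) (by norm_num) (by norm_num)
      · linarith [(hn0 n hn).1, (hn0 n0 le_rfl).2]
      · linarith [(hn0 n0 le_rfl).1, (hn0 n0 le_rfl).2]
    linarith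
  obtain ⟨a, ha⟩ := cauchySeq_tendsto_of_complete hcau
  refine ⟨a, mem_iInter.2 fun n => (hclosed n).mem_of_tendsto ha ?_⟩
  filter_upwards [eventually_ge_atTop n] with m hm
  exact hanti hm (huK m)

/-- A bounded sequence of functionals on a separable space has a pointwise convergent
subsequence. -/
theorem exists_tendsto_apply_subseq [TopologicalSpace.SeparableSpace X] {φ : ℕ → StrongDual ℝ X}
    {C : ℝ} (hφ : ∀ n, ‖φ n‖ ≤ C) :
    ∃ (a : StrongDual ℝ X) (k : ℕ → ℕ), StrictMono k ∧
      ∀ x, Tendsto (fun n => φ (k n) x) atTop (𝓝 (a x)) := by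
  obtain ⟨a, -, k, hk, ha⟩ := WeakDual.isSeqCompact_closedBall ℝ X 0 C
    (x := fun n => StrongDual.toWeakDual (φ n)) (fun n => by simpa using hφ n)
  refine ⟨WeakDual.toStrongDual a, k, hk, fun x => ?_⟩
  exact ((WeakDual.eval_continuous x).tendsto a).comp ha

/-- In a Banach space with Clarkson's inequality and separable dual, bounded sequences have weakly
convergent subsequences. -/
theorem ClarksonInequality.exists_weaklyConverges_subseq [CompleteSpace X]
    [TopologicalSpace.SeparableSpace (StrongDual ℝ X)] (hr : 0 < r) (h : ClarksonInequality X r)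
    {x : ℕ → X} {C : ℝ} (hx : ∀ n, ‖x n‖ ≤ C) :
    ∃ (a : X) (k : ℕ → ℕ), StrictMono k ∧ WeaklyConverges (fun n => x (k n)) a := by
  obtain ⟨Λ, k, hk, hΛ⟩ := exists_tendsto_apply_subseq
    (φ := fun n => NormedSpace.inclusionInDoubleDual ℝ X (x n)) (C := C) fun n =>
      (NormedSpace.double_dual_bound ℝ X (x n)).trans (hx n)
  -- The limit functional `Λ` lives only in the bidual. A point common to the closed convex hulls of
  -- all tails represents it, since each functional maps a late tail, hence its hull, into a small
  -- ball around its limit.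
  let K : ℕ → Set X := fun n => closure (convexHull ℝ ((fun m => x (k m)) '' Ici n))
  obtain ⟨a, ha⟩ := h.nonempty_iInter hr (K := K) (C := C)
    (fun m n hmn => closure_mono (convexHull_mono (image_mono (Ici_subset_Ici.2 hmn))))
    (fun n => isClosed_closure) (fun n => (convex_convexHull ℝ _).closure)
    fun n => ⟨x (k n), subset_closure (subset_convexHull ℝ _ ⟨n, self_mem_Ici, rfl⟩), hx _⟩
  rw [mem_iInter] at ha
  refine ⟨a, k, hk, fun ℓ => ?_⟩
  have hℓ : Tendsto (fun n => ℓ (x (k n))) atTop (𝓝 (Λ ℓ)) := hΛ ℓ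
  suffices ℓ a = Λ ℓ by rw [this]; exact hℓ
  refine eq_of_forall_dist_le fun ε hε => ?_
  obtain ⟨n, hn⟩ := eventually_atTop.1 (hℓ.eventually (Metric.closedBall_mem_nhds (Λ ℓ) hε))
  have hsub : K n ⊆ ℓ ⁻¹' Metric.closedBall (Λ ℓ) ε := by
    refine closure_minimal (convexHull_min ?_ ?_) (Metric.isClosed_closedBall.preimage ℓ.continuous)
    · rintro _ ⟨m, hm, rfl⟩
      exact hn m hm
    · exact (convex_closedBall (Λ ℓ) ε).linear_preimage ℓ.toLinearMap
  exact hsub (ha n)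

theorem WeaklyConverges.comp_strictMono {u : ℕ → X} {a : X} (h : WeaklyConverges u a) {k : ℕ → ℕ}
    (hk : StrictMono k) : WeaklyConverges (fun n => u (k n)) a :=
  fun ℓ => (h ℓ).comp hk.tendsto_atTop

theorem WeaklyConverges.map {Y : Type*} [NormedAddCommGroup Y] [NormedSpace ℝ Y] {u : ℕ → X} {a : X}
    (h : WeaklyConverges u a) (L : X →L[ℝ] Y) : WeaklyConverges (fun n => L (u n)) (L a) :=
  fun ℓ => h (ℓ.comp L)

theorem _root_.Filter.Tendsto.weaklyConverges {u : ℕ → X} {a : X} (h : Tendsto u atTop (𝓝 a)) :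
    WeaklyConverges u a := fun ℓ => (ℓ.continuous.tendsto a).comp h

/-- Weak lower semicontinuity of the norm, by testing with a norming functional of the limit. -/
theorem WeaklyConverges.norm_le_of_tendsto {u : ℕ → X} {a : X} (h : WeaklyConverges u a) {b : ℕ → ℝ}
    {c : ℝ} (hb : ∀ n, ‖u n‖ ≤ b n) (hc : Tendsto b atTop (𝓝 c)) : ‖a‖ ≤ c := by
  obtain ⟨ℓ, hℓ, hℓa⟩ := exists_dual_vector'' ℝ a
  have h1 : ℓ a = ‖a‖ := by simpa using hℓa
  rw [← h1]
  refine le_of_tendsto_of_tendsto' (h ℓ) hc fun n => ?_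
  calc ℓ (u n) ≤ ‖ℓ (u n)‖ := le_abs_self _
    _ ≤ ‖ℓ‖ * ‖u n‖ := ℓ.le_opNorm _
    _ ≤ 1 * ‖u n‖ := by gcongr
    _ ≤ b n := by rw [one_mul]; exact hb n

/-- A weakly convergent sequence is bounded. -/
theorem WeaklyConverges.exists_norm_le {u : ℕ → X} {a : X} (h : WeaklyConverges u a) :
    ∃ C, 0 < C ∧ ∀ n, ‖u n‖ ≤ C := by
  obtain ⟨C, hC⟩ := banach_steinhaus (g := fun n => NormedSpace.inclusionInDoubleDual ℝ X (u n))
    fun ℓ => by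
      obtain ⟨M, hM⟩ := (Metric.isBounded_range_of_tendsto _ (h ℓ)).exists_norm_le
      exact ⟨M, fun n => hM _ ⟨n, rfl⟩⟩
  refine ⟨max C 1, lt_max_of_lt_right one_pos, fun n => ?_⟩
  have := hC n
  rw [show ‖NormedSpace.inclusionInDoubleDual ℝ X (u n)‖ = ‖u n‖ from
    (NormedSpace.inclusionInDoubleDualLi ℝ).norm_map (u n)] at this
  exact this.trans (le_max_left _ _)

/-- If every subsequence has a weakly convergent subsequence with limit `a`, the sequence converges
weakly to `a`. -/
theorem weaklyConverges_of_subseq {u : ℕ → X} {a : X}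
    (h : ∀ k : ℕ → ℕ, StrictMono k → ∃ m : ℕ → ℕ, StrictMono m ∧
      WeaklyConverges (fun n => u (k (m n))) a) : WeaklyConverges u a := by
  intro ℓ
  by_contra hnot
  rw [tendsto_atTop' ] at hnot
  push Not at hnot
  obtain ⟨s, hs, H⟩ := hnot
  have hfreq : ∃ᶠ n in atTop, ℓ (u n) ∉ s := by
    rw [frequently_atTop]
    intro n
    obtain ⟨m, hm, hms⟩ := H n
    exact ⟨m, hm, hms⟩
  obtain ⟨k, hk, hks⟩ := extraction_of_frequently_atTop hfreq
  obtain ⟨m, hm, hw⟩ := h k hk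
  obtain ⟨n, hn⟩ := ((hw ℓ).eventually hs).exists
  exact hks (m n) hn

end WeakCompactness

/-! ### The function `t ↦ |t|^{p-2} t` -/

section SignedPow

variable {p q : ℝ≥0∞}

theorem two_le_toReal (hp2 : 2 ≤ p) (hp : p ≠ ∞) : 2 ≤ p.toReal := by
  simpa using ENNReal.toReal_mono hp hp2

theorem continuous_signedPow (hp2 : 2 ≤ p) (hp : p ≠ ∞) : Continuous (signedPow p) := by
  have := two_le_toReal hp2 hp
  exact (continuous_abs.rpow_const fun _ => Or.inr (by linarith)).mul continuous_id

theorem abs_signedPow (hp2 : 2 ≤ p) (hp : p ≠ ∞) (t : ℝ) :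
    |signedPow p t| = |t| ^ (p.toReal - 1) := by
  have := two_le_toReal hp2 hp
  rw [signedPow, abs_mul, abs_of_nonneg (by positivity)]
  rcases eq_or_ne t 0 with rfl | ht
  · rw [abs_zero, mul_zero, Real.zero_rpow (by linarith)]
  · rw [← Real.rpow_add_one (abs_ne_zero.2 ht)]
    congr 1; ring

theorem signedPow_mul_self (hp2 : 2 ≤ p) (hp : p ≠ ∞) (t : ℝ) :
    signedPow p t * t = |t| ^ p.toReal := by
  have := two_le_toReal hp2 hp
  rcases eq_or_ne t 0 with rfl | ht
  · rw [abs_zero, mul_zero, Real.zero_rpow (by linarith)]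
  · have h1 : |t| ^ p.toReal = |t| ^ (p.toReal - 2) * |t| ^ (2 : ℝ) := by
      rw [← Real.rpow_add (abs_pos.2 ht)]; congr 1; ring
    rw [h1, signedPow, mul_assoc, Real.rpow_two, sq_abs, sq]

theorem holderConjugate_toReal [p.HolderConjugate q] (hp2 : 2 ≤ p) (hp : p ≠ ∞) :
    p.toReal.HolderConjugate q.toReal := by
  have h2 := two_le_toReal hp2 hp
  have hq : q ≠ ∞ := by
    rw [Ne, ENNReal.HolderConjugate.eq_top_iff_eq_one q p]
    rintro rfl
    exact absurd hp2 (by norm_num)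
  have hq0 : q ≠ 0 := ENNReal.HolderConjugate.ne_zero q p
  refine Real.holderConjugate_iff.2 ⟨by linarith, ?_⟩
  have := ENNReal.HolderConjugate.inv_add_inv_eq_one p q
  rw [← ENNReal.toReal_inv, ← ENNReal.toReal_inv, ← ENNReal.toReal_add, this, ENNReal.toReal_one]
  · simpa using ENNReal.HolderConjugate.ne_zero p q
  · simpa using hq0

theorem conjExponent_ne_top [p.HolderConjugate q] (hp2 : 2 ≤ p) : q ≠ ∞ := by
  rw [Ne, ENNReal.HolderConjugate.eq_top_iff_eq_one q p]
  rintro rfl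
  exact absurd hp2 (by norm_num)

/-- Convexity of `t ↦ |t|^p`. -/
theorem abs_rpow_add_signedPow_mul_le (hp2 : 2 ≤ p) (hp : p ≠ ∞) (a b : ℝ) :
    |b| ^ p.toReal + p.toReal * (signedPow p b * (a - b)) ≤ |a| ^ p.toReal := by
  have h2 := two_le_toReal hp2 hp
  set r := p.toReal
  have hc : r.HolderConjugate (Real.conjExponent r) := .conjExponent (by linarith)
  have h1 : |a| * |b| ^ (r - 1) ≤ |a| ^ r / r + (|b| ^ (r - 1)) ^ (Real.conjExponent r) /
      Real.conjExponent r :=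
    -- The tangent inequality is Young's inequality for `|a|` and `|b| ^ (r - 1)`, since `r - 1`
    -- times the conjugate exponent equals `r`.
    Real.young_inequality_of_nonneg (abs_nonneg _) (by positivity) hc
  have h3 : (|b| ^ (r - 1)) ^ (Real.conjExponent r) = |b| ^ r := by
    rw [← Real.rpow_mul (abs_nonneg _), hc.sub_one_mul_conj]
  rw [h3] at h1
  have h4 : signedPow p b * a ≤ |a| * |b| ^ (r - 1) := by
    rw [← abs_signedPow hp2 hp b, mul_comm, ← abs_mul]
    exact le_abs_self _
  have h5 := signedPow_mul_self hp2 hp b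
  have h6 : r * (|a| ^ r / r + |b| ^ r / Real.conjExponent r) = |a| ^ r + (r - 1) * |b| ^ r := by
    have e := hc.inv_add_inv_eq_one
    have hr0 : r ≠ 0 := by linarith
    have : |b| ^ r / Real.conjExponent r = |b| ^ r * (1 - r⁻¹) := by
      rw [div_eq_mul_inv]; congr 1; linarith
    rw [this]; field_simp
  have h7 : r * (signedPow p b * a) ≤ |a| ^ r + (r - 1) * |b| ^ r := by
    rw [← h6]; exact mul_le_mul_of_nonneg_left (h4.trans h1) (by linarith)
  have h8 : r * (signedPow p b * (a - b)) = r * (signedPow p b * a) - r * |b| ^ r := by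
    rw [mul_sub (signedPow p b), h5, mul_sub]
  linarith

theorem signedPow_monotone (hp2 : 2 ≤ p) (hp : p ≠ ∞) (a b : ℝ) :
    0 ≤ (signedPow p a - signedPow p b) * (a - b) := by
  have h1 := abs_rpow_add_signedPow_mul_le hp2 hp a b
  have h2 := abs_rpow_add_signedPow_mul_le hp2 hp b a
  have h3 := two_le_toReal hp2 hp
  have h4 : 0 ≤ p.toReal * ((signedPow p a - signedPow p b) * (a - b)) := by nlinarith
  exact nonneg_of_mul_nonneg_right h4 (by linarith)

/-- With `r / 2 ≥ 1`, this follows from superadditivity of `t ↦ t ^ (r / 2)`, the parallelogram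
identity, and convexity of the same function. -/
theorem clarkson_real {r : ℝ} (hr : 2 ≤ r) (a b : ℝ) :
    |2⁻¹ * (a + b)| ^ r + |2⁻¹ * (a - b)| ^ r ≤ (|a| ^ r + |b| ^ r) / 2 := by
  have hsq : ∀ t : ℝ, |t| ^ r = (t ^ 2) ^ (r / 2) := fun t => by
    rw [← sq_abs, ← Real.rpow_two, ← Real.rpow_mul (abs_nonneg _)]; congr 1; ring
  simp only [hsq]
  have h1 : ((2⁻¹ * (a + b)) ^ 2) ^ (r / 2) + ((2⁻¹ * (a - b)) ^ 2) ^ (r / 2) ≤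
      ((2⁻¹ * (a + b)) ^ 2 + (2⁻¹ * (a - b)) ^ 2) ^ (r / 2) := by
    have := NNReal.add_rpow_le_rpow_add (p := r / 2) ⟨(2⁻¹ * (a + b)) ^ 2, by positivity⟩
      ⟨(2⁻¹ * (a - b)) ^ 2, by positivity⟩ (by linarith)
    exact_mod_cast this
  have h2 : (2⁻¹ * (a + b)) ^ 2 + (2⁻¹ * (a - b)) ^ 2 = (1 / 2 : ℝ) * a ^ 2 + (1 / 2) * b ^ 2 := by
    ring
  rw [h2] at h1
  have h3 := (convexOn_rpow (p := r / 2) (by linarith)).2 (mem_Ici.2 (sq_nonneg a))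
    (mem_Ici.2 (sq_nonneg b)) (show (0 : ℝ) ≤ 1 / 2 by norm_num) (show (0 : ℝ) ≤ 1 / 2 by norm_num)
    (by norm_num)
  simp only [smul_eq_mul] at h3
  linarith

end SignedPow

/-! ### The spaces `L^p` with `p ≥ 2` -/

section LpSpaces

variable {α : Type*} [MeasurableSpace α] {μ : Measure α} {p q : ℝ≥0∞}

theorem norm_rpow_eq_integral [Fact (1 ≤ p)] (hp : p ≠ ∞) (f : Lp ℝ p μ) :
    ‖f‖ ^ p.toReal = ∫ x, |f x| ^ p.toReal ∂μ := by
  have hp0 : p ≠ 0 := (zero_lt_one.trans_le (Fact.out : 1 ≤ p)).ne'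
  have hpr : 0 < p.toReal := ENNReal.toReal_pos hp0 hp
  have hi : 0 ≤ ∫ x, |f x| ^ p.toReal ∂μ := integral_nonneg fun x => by positivity
  rw [Lp.norm_def, (Lp.memLp f).eLpNorm_eq_integral_rpow_norm hp0 hp]
  simp only [Real.norm_eq_abs]
  rw [ENNReal.toReal_ofReal (Real.rpow_nonneg hi _), ← Real.rpow_mul hi, inv_mul_cancel₀ hpr.ne',
    Real.rpow_one]

theorem MemLp.integrable_abs_rpow (hp0 : p ≠ 0) (hp : p ≠ ∞) {f : α → ℝ} (hf : MemLp f p μ) :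
    Integrable (fun x => |f x| ^ p.toReal) μ := by
  simpa using hf.integrable_norm_rpow hp0 hp

theorem clarksonInequality_Lp [Fact (1 ≤ p)] (hp2 : 2 ≤ p) (hp : p ≠ ∞) :
    ClarksonInequality (Lp ℝ p μ) p.toReal := by
  intro f g
  have hp0 : p ≠ 0 := (zero_lt_one.trans_le (Fact.out : 1 ≤ p)).ne'
  have hi : ∀ f : Lp ℝ p μ, Integrable (fun x => |f x| ^ p.toReal) μ := fun f =>
    MemLp.integrable_abs_rpow hp0 hp (Lp.memLp f)
  simp only [norm_rpow_eq_integral hp]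
  rw [← integral_add (hi _) (hi _), ← integral_add (hi _) (hi _), ← integral_div]
  refine integral_mono_ae ((hi _).add (hi _)) (((hi _).add (hi _)).div_const _) ?_
  filter_upwards [Lp.coeFn_smul (2⁻¹ : ℝ) (f + g), Lp.coeFn_smul (2⁻¹ : ℝ) (f - g),
    Lp.coeFn_add f g, Lp.coeFn_sub f g] with x h1 h2 h3 h4
  rw [h1, h2]
  simp only [Pi.smul_apply, h3, h4, Pi.add_apply, Pi.sub_apply, smul_eq_mul]
  exact clarkson_real (two_le_toReal hp2 hp) _ _

theorem clarksonInequality_piLp {ι : Type*} [Fintype ι] [Fact (1 ≤ p)] (hp2 : 2 ≤ p) (hp : p ≠ ∞)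
    {X : Type*} [NormedAddCommGroup X] [NormedSpace ℝ X] (hX : ClarksonInequality X p.toReal) :
    ClarksonInequality (PiLp p fun _ : ι => X) p.toReal := by
  have h2 := two_le_toReal hp2 hp
  have hn : ∀ f : PiLp p fun _ : ι => X, ‖f‖ ^ p.toReal = ∑ i, ‖f i‖ ^ p.toReal := fun f => by
    have hs : 0 ≤ ∑ i, ‖f i‖ ^ p.toReal := Finset.sum_nonneg fun i _ => by positivity
    rw [PiLp.norm_eq_sum (by linarith), ← Real.rpow_mul hs, one_div, inv_mul_cancel₀ (by linarith),
      Real.rpow_one]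
  intro f g
  simp only [hn]
  rw [← Finset.sum_add_distrib, ← Finset.sum_add_distrib, Finset.sum_div]
  exact Finset.sum_le_sum fun i _ => hX (f i) (g i)

/-- The modulus is `|f| ^ (p - 1)`, which lies in `L^{p/(p-1)}`, and `p / (p - 1) = q`. -/
theorem MemLp.signedPow [p.HolderConjugate q] (hp2 : 2 ≤ p) (hp : p ≠ ∞) {f : α → ℝ}
    (hf : MemLp f p μ) : MemLp (fun x => signedPow p (f x)) q μ := by
  have h2 := two_le_toReal hp2 hp
  have hc := holderConjugate_toReal (q := q) hp2 hp
  have hp1 : 1 ≤ p := le_trans (by norm_num) hp2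
  have h := hf.norm_rpow_div (p - 1)
  have e1 : p / (p - 1) = q := by
    have hq := conjExponent_ne_top (q := q) hp2
    have hm1 : p - 1 ≠ 0 := by
      rw [Ne, tsub_eq_zero_iff_le, not_le]
      exact lt_of_lt_of_le (by norm_num) hp2
    have hm2 : p - 1 ≠ ∞ := ENNReal.sub_ne_top hp
    rw [← ENNReal.toReal_eq_toReal_iff' (ENNReal.div_ne_top hp hm1) hq, ENNReal.toReal_div,
      ENNReal.toReal_sub_of_le hp1 hp, ENNReal.toReal_one, hc.conjugate_eq]
  have e2 : (p - 1).toReal = p.toReal - 1 := by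
    rw [ENNReal.toReal_sub_of_le hp1 hp, ENNReal.toReal_one]
  rw [e1, e2] at h
  refine h.mono ((continuous_signedPow hp2 hp).comp_aestronglyMeasurable hf.1)
    (Eventually.of_forall fun x => ?_)
  rw [Real.norm_eq_abs, abs_signedPow hp2 hp, Real.norm_eq_abs, Real.norm_eq_abs]
  exact le_abs_self _

/-- Continuity of the Nemytskii operator of `signedPow` along lines. -/
theorem continuous_integral_signedPow (hp2 : 2 ≤ p) (hp : p ≠ ∞) [p.HolderConjugate q]
    {f v w : α → ℝ} (hf : MemLp f p μ) (hv : MemLp v p μ) (hw : MemLp w p μ) :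
    Continuous fun t : ℝ => ∫ x, signedPow p (f x + t * v x) * w x ∂μ := by
  have hsc := continuous_signedPow hp2 hp
  rw [continuous_iff_continuousAt]
  intro t₀
  let T := |t₀| + 1
  have hT : ∀ᶠ t in 𝓝 t₀, |t| ≤ T := by
    have : ∀ᶠ t in 𝓝 t₀, |t| < T := continuous_abs.continuousAt.eventually
      (gt_mem_nhds (by simp only [T]; linarith))
    exact this.mono fun t ht => ht.le
  -- Monotonicity of `t ↦ t ^ (p - 1)` on nonnegative numbers makes this function dominate all `f +
  -- t v` with `|t| ≤ T`.
  have hb : MemLp (fun x => |f x| + T * |v x|) p μ := hf.abs.add (hv.abs.const_mul T)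
  have hbi : Integrable (fun x => signedPow p (|f x| + T * |v x|) * w x) μ :=
    (MemLp.signedPow (q := q) hp2 hp hb).integrable_mul hw
  refine continuousAt_of_dominated (bound := fun x => ‖signedPow p (|f x| + T * |v x|) * w x‖)
    (Eventually.of_forall fun t => ?_) (hT.mono fun t ht => Eventually.of_forall fun x => ?_)
    hbi.norm (Eventually.of_forall fun x => ?_)
  · exact (hsc.comp_aestronglyMeasurable (hf.1.add (hv.1.const_mul t))).mul hw.1
  · have h2 := two_le_toReal hp2 hp
    rw [norm_mul, norm_mul]
    refine mul_le_mul_of_nonneg_right ?_ (norm_nonneg _)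
    have hT0 : 0 ≤ T := by positivity
    rw [Real.norm_eq_abs, Real.norm_eq_abs, abs_signedPow hp2 hp, abs_signedPow hp2 hp]
    refine Real.rpow_le_rpow (abs_nonneg _) ?_ (by linarith)
    rw [abs_of_nonneg (by positivity : 0 ≤ |f x| + T * |v x|)]
    refine (abs_add_le _ _).trans ?_
    rw [abs_mul]
    gcongr
  · exact ((hsc.comp (continuous_const.add (continuous_id.mul continuous_const))).mul
      continuous_const).continuousAt

variable [Fact (1 ≤ p)] [Fact (1 ≤ q)] [p.HolderConjugate q]

/-- The pairing of `L^q` with `L^p` as a map into the dual space of `L^p`. -/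
noncomputable def toDualLp (μ : Measure α) (p q : ℝ≥0∞) [Fact (1 ≤ p)] [Fact (1 ≤ q)]
    [p.HolderConjugate q] : Lp ℝ q μ →L[ℝ] StrongDual ℝ (Lp ℝ p μ) :=
  (ContinuousLinearMap.mul ℝ ℝ).lpPairing μ q p

theorem toDualLp_apply (w : Lp ℝ q μ) (z : Lp ℝ p μ) :
    toDualLp μ p q w z = ∫ x, w x * z x ∂μ :=
  ContinuousLinearMap.lpPairing_eq_integral _ w z

/-- The Riesz representation theorem for `L^p`, `2 ≤ p < ∞`. -/
theorem toDualLp_surjective (hp2 : 2 ≤ p) (hp : p ≠ ∞) :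
    Function.Surjective (toDualLp μ p q) := by
  intro ℓ
  have hp0 : p ≠ 0 := (zero_lt_one.trans_le (Fact.out : 1 ≤ p)).ne'
  have h2 := two_le_toReal hp2 hp
  set r := p.toReal with hr
  have hr0 : 0 < r := by linarith
  -- Young's inequality bounds `J` from below, and Clarkson's inequality makes its minimizing
  -- sequences Cauchy. The Euler equation of the minimizer represents `ℓ`.
  let J : Lp ℝ p μ → ℝ := fun f => ‖f‖ ^ r - r * ℓ f
  have hJc : Continuous J :=
    (continuous_norm.rpow_const fun _ => Or.inr hr0.le).sub (ℓ.continuous.const_mul r)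
  have hJb : BddBelow (range J) := by
    have hc : r.HolderConjugate (Real.conjExponent r) := .conjExponent (by linarith)
    refine ⟨-(r * (‖ℓ‖ ^ Real.conjExponent r / Real.conjExponent r)), ?_⟩
    rintro _ ⟨f, rfl⟩
    have h1 := Real.young_inequality_of_nonneg (norm_nonneg f) (norm_nonneg ℓ) hc
    have h3 : ℓ f ≤ ‖f‖ * ‖ℓ‖ := (le_abs_self _).trans ((ℓ.le_opNorm f).trans (mul_comm _ _).le)
    have h4 := mul_le_mul_of_nonneg_left (h3.trans h1) hr0.le
    have h5 : r * (‖f‖ ^ r / r + ‖ℓ‖ ^ Real.conjExponent r / Real.conjExponent r) =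
        ‖f‖ ^ r + r * (‖ℓ‖ ^ Real.conjExponent r / Real.conjExponent r) := by
      rw [mul_add, mul_div_cancel₀ _ hr0.ne']
    simp only [J]
    linarith
  obtain ⟨f, hf⟩ : ∃ f, ∀ g, J f ≤ J g := by
    set m := ⨅ g, J g
    have hm : ∀ g, m ≤ J g := fun g => ciInf_le hJb g
    have hex : ∀ n : ℕ, ∃ f, J f < m + 1 / ((n : ℝ) + 1) := fun n =>
      exists_lt_of_ciInf_lt (by have : (0 : ℝ) < 1 / ((n : ℝ) + 1) := by positivity
                                simp only [m] at *; linarith)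
    choose u hu using hex
    have hut : Tendsto (fun n => J (u n)) atTop (𝓝 m) := by
      refine tendsto_of_tendsto_of_tendsto_of_le_of_le tendsto_const_nhds
        (h := fun n : ℕ => m + 1 / ((n : ℝ) + 1)) ?_ (fun n => hm _) fun n => (hu n).le
      simpa using tendsto_const_nhds.add (tendsto_one_div_add_atTop_nhds_zero_nat (𝕜 := ℝ))
    have hcau : CauchySeq u := by
      refine Metric.cauchySeq_iff'.2 fun ε hε => ?_
      have hη : 0 < (ε / 2) ^ r := by positivity
      obtain ⟨n0, hn0⟩ := eventually_atTop.1 (hut.eventually (gt_mem_nhds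
        (show m < m + (ε / 2) ^ r by linarith)))
      refine ⟨n0, fun n hn => ?_⟩
      have h1 := clarksonInequality_Lp hp2 hp (u n) (u n0)
      have h3 := hm ((2⁻¹ : ℝ) • (u n + u n0))
      have h4 := hn0 n hn
      have h5 := hn0 n0 le_rfl
      have h6 : ℓ ((2⁻¹ : ℝ) • (u n + u n0)) = 2⁻¹ * (ℓ (u n) + ℓ (u n0)) := by simp [mul_add]
      simp only [J] at h3 h4 h5
      rw [h6] at h3
      rw [← hr] at h1
      have h7 : ‖(2⁻¹ : ℝ) • (u n - u n0)‖ ^ r < (ε / 2) ^ r := by linarith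
      have h8 := (Real.rpow_lt_rpow_iff (norm_nonneg _) (by positivity) hr0).1 h7
      rw [norm_smul, Real.norm_of_nonneg (by norm_num)] at h8
      rw [dist_eq_norm]; linarith
    obtain ⟨f, hf⟩ := cauchySeq_tendsto_of_complete hcau
    refine ⟨f, fun g => ?_⟩
    rw [tendsto_nhds_unique ((hJc.tendsto f).comp hf) hut]
    exact hm g
  let w : Lp ℝ q μ := (MemLp.signedPow (q := q) hp2 hp (Lp.memLp f)).toLp _
  have hle : ∀ v, ℓ v ≤ toDualLp μ p q w v := by
    intro v
    have hcont := continuous_integral_signedPow (q := q) hp2 hp (Lp.memLp f) (Lp.memLp v)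
      (Lp.memLp v)
    have hlim := (hcont.tendsto 0).mono_left (nhdsWithin_le_nhds (s := Ioi 0))
    have e0 : ∫ x, signedPow p (f x + 0 * v x) * v x ∂μ = toDualLp μ p q w v := by
      rw [toDualLp_apply]
      refine integral_congr_ae ?_
      filter_upwards [(MemLp.signedPow (q := q) hp2 hp (Lp.memLp f)).coeFn_toLp] with x hx
      simp only [w, hx, zero_mul, add_zero]
    rw [e0] at hlim
    refine ge_of_tendsto hlim ?_
    filter_upwards [self_mem_nhdsWithin] with t (ht : 0 < t)
    have h1 := hf (f + t • v)
    simp only [J, map_add, map_smul, smul_eq_mul, norm_rpow_eq_integral hp, hr] at h1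
    have hi : ∀ f : Lp ℝ p μ, Integrable (fun x => |f x| ^ p.toReal) μ := fun f =>
      MemLp.integrable_abs_rpow hp0 hp (Lp.memLp f)
    have hsi : Integrable (fun x => signedPow p (f x + t * v x) * v x) μ :=
      (MemLp.signedPow (q := q) hp2 hp
        ((Lp.memLp f).add ((Lp.memLp v).const_mul t))).integrable_mul (Lp.memLp v)
    -- The tangent inequality is taken at `f + t v` rather than at `f`. Minimality then bounds `ℓ v`
    -- by an integral that is continuous in `t`, and no derivative of the norm is needed.
    have h3 : ∫ x, |(f + t • v : Lp ℝ p μ) x| ^ p.toReal ∂μ +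
        p.toReal * (-t * ∫ x, signedPow p (f x + t * v x) * v x ∂μ) ≤ ∫ x, |f x| ^ p.toReal ∂μ := by
      rw [← integral_const_mul, ← integral_const_mul, ← integral_add (hi _)
        ((hsi.const_mul _).const_mul _)]
      refine integral_mono_ae ((hi _).add ((hsi.const_mul _).const_mul _)) (hi _) ?_
      filter_upwards [Lp.coeFn_add f (t • v), Lp.coeFn_smul t v] with x hx1 hx2
      rw [hx1, Pi.add_apply, hx2, Pi.smul_apply, smul_eq_mul]
      have := abs_rpow_add_signedPow_mul_le hp2 hp (f x) (f x + t * v x)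
      refine le_trans (le_of_eq ?_) this
      ring
    have h4 : p.toReal * (t * ℓ v) ≤
        p.toReal * (t * ∫ x, signedPow p (f x + t * v x) * v x ∂μ) := by
      nlinarith
    exact le_of_mul_le_mul_left (le_of_mul_le_mul_left h4 hr0) ht
  refine ⟨w, ContinuousLinearMap.ext fun v => le_antisymm ?_ (hle v)⟩
  -- A one-sided inequality between linear functionals, applied to `v` and `-v`, is an equality.
  have := hle (-v)
  simp only [map_neg] at this
  linarith

/-- The dual space of `L^p` is separable. -/
theorem separableSpace_dual_Lp (hp2 : 2 ≤ p) (hp : p ≠ ∞) [SecondCountableTopology (Lp ℝ q μ)] :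
    TopologicalSpace.SeparableSpace (StrongDual ℝ (Lp ℝ p μ)) :=
  (toDualLp_surjective (q := q) hp2 hp).denseRange.separableSpace (toDualLp μ p q).continuous

theorem exists_weaklyConverges_subseq_Lp (hp2 : 2 ≤ p) (hp : p ≠ ∞)
    [SecondCountableTopology (Lp ℝ q μ)] {z : ℕ → Lp ℝ p μ} {C : ℝ} (hz : ∀ n, ‖z n‖ ≤ C) :
    ∃ (a : Lp ℝ p μ) (k : ℕ → ℕ), StrictMono k ∧ WeaklyConverges (fun n => z (k n)) a := by
  have := separableSpace_dual_Lp (μ := μ) (q := q) hp2 hp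
  have h2 := two_le_toReal hp2 hp
  exact (clarksonInequality_Lp hp2 hp).exists_weaklyConverges_subseq (by linarith) hz

end LpSpaces

/-! ### Operators of semi-bounded variation -/

section SemiBoundedVariation

variable {X : Type*} [NormedAddCommGroup X] [NormedSpace ℝ X]

/-- The functions `c` allowed in the definition of semi-bounded variation. -/
def IsModulus (c : ℝ → ℝ → ℝ) : Prop :=
  ∀ R > 0, ContinuousOn (c R) (Ici 0) ∧ Tendsto (fun t => c R t / t) (𝓝[>] 0) (𝓝 0)

/-- Semi-bounded variation with respect to a seminorm `s` and a modulus `c`. -/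
def HasSBV (s : Seminorm ℝ X) (c : ℝ → ℝ → ℝ) (Φ : X → StrongDual ℝ X) : Prop :=
  ∀ R > 0, ∀ z₁ z₂ : X, ‖z₁‖ ≤ R → ‖z₂‖ ≤ R → -c R (s (z₁ - z₂)) ≤ (Φ z₁ - Φ z₂) (z₁ - z₂)

/-- Radial continuity of a map into the dual space. -/
def IsRadiallyContinuous (Φ : X → StrongDual ℝ X) : Prop :=
  ∀ z₁ z₂ : X, ∃ ε > (0 : ℝ), ContinuousOn (fun τ : ℝ => Φ (z₁ + τ • z₂) z₂) (Icc 0 ε)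

/-- By continuity at zero, `c R 0` is the limit of `(c R t / t) * t`. -/
theorem IsModulus.apply_zero {c : ℝ → ℝ → ℝ} (hc : IsModulus c) {R : ℝ} (hR : 0 < R) :
    c R 0 = 0 := by
  obtain ⟨h1, h2⟩ := hc R hR
  have h3 : Tendsto (c R) (𝓝[>] 0) (𝓝 (c R 0)) :=
    (h1 0 self_mem_Ici).mono_left (nhdsWithin_mono _ Ioi_subset_Ici_self)
  have h4 : Tendsto (fun t => c R t / t * t) (𝓝[>] 0) (𝓝 (0 * 0)) :=
    h2.mul (tendsto_nhdsWithin_of_tendsto_nhds tendsto_id)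
  rw [mul_zero] at h4
  refine tendsto_nhds_unique h3 (h4.congr' ?_)
  filter_upwards [self_mem_nhdsWithin] with t (ht : 0 < t)
  field_simp

/-- In Minty's argument the increment is `τ • u` and the inequality is divided by `τ`; this removes
the modulus in the limit. The case `a = 0` needs `c R 0 = 0`. -/
theorem IsModulus.tendsto_zero {c : ℝ → ℝ → ℝ} (hc : IsModulus c) {R a : ℝ} (hR : 0 < R)
    (ha : 0 ≤ a) : Tendsto (fun τ => c R (τ * a) / τ) (𝓝[>] 0) (𝓝 0) := by
  rcases ha.eq_or_lt with rfl | ha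
  · simp [hc.apply_zero hR]
  · have h1 : Tendsto (fun τ : ℝ => τ * a) (𝓝[>] 0) (𝓝[>] 0) := by
      refine tendsto_nhdsWithin_iff.2 ⟨?_, ?_⟩
      · have : Tendsto (fun τ : ℝ => τ * a) (𝓝 0) (𝓝 (0 * a)) := tendsto_id.mul_const a
        rw [zero_mul] at this
        exact this.mono_left nhdsWithin_le_nhds
      · filter_upwards [self_mem_nhdsWithin] with τ (hτ : 0 < τ)
        exact mul_pos hτ ha
    have h2 := ((hc R hR).2.comp h1).mul_const a
    rw [zero_mul] at h2
    refine h2.congr' ?_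
    filter_upwards [self_mem_nhdsWithin] with τ (hτ : 0 < τ)
    simp only [Function.comp_apply]
    field_simp

/-- A unit ball that is totally bounded for `s` is bounded for `s`; homogeneity does the rest. -/
theorem IsCompactSeminorm.exists_le {s : Seminorm ℝ X} (hs : IsCompactSeminorm s) :
    ∃ K, 0 ≤ K ∧ ∀ z, s z ≤ K * ‖z‖ := by
  obtain ⟨t, ht, H⟩ := hs 1 one_pos
  obtain ⟨K, hK⟩ := (ht.image s).bddAbove
  have hb : ∀ z : X, ‖z‖ ≤ 1 → s z ≤ 1 + max K 0 := fun z hz => by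
    obtain ⟨w, hw, hzw⟩ := H z hz
    have h1 : s z ≤ s (z - w) + s w := by
      simpa using map_add_le_add s (z - w) w
    linarith [hK (mem_image_of_mem s hw), le_max_left K 0]
  refine ⟨1 + max K 0, by positivity, fun z => ?_⟩
  rcases eq_or_ne z 0 with rfl | hz
  · simp
  · have hz' : 0 < ‖z‖ := norm_pos_iff.2 hz
    have h1 := hb (‖z‖⁻¹ • z) (by rw [norm_smul, norm_inv, norm_norm, inv_mul_cancel₀ hz'.ne'])
    rw [map_smul_eq_mul, norm_inv, norm_norm, inv_mul_le_iff₀ hz'] at h1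
    linarith

/-- Hahn–Banach on the line through `w`, with `s` as the dominating function; the bound by `K` makes
the extension continuous. These functionals let weak convergence control `s`. -/
theorem exists_dual_le_seminorm {s : Seminorm ℝ X} {K : ℝ} (hK : ∀ z, s z ≤ K * ‖z‖) (w : X) :
    ∃ ℓ : StrongDual ℝ X, ℓ w = s w ∧ ∀ z, ℓ z ≤ s z := by
  rcases eq_or_ne w 0 with rfl | hw
  · exact ⟨0, by simp, fun z => by simp⟩
  · obtain ⟨g, hg1, hg2⟩ := exists_extension_of_le_sublinear
      (LinearPMap.mkSpanSingleton (K := ℝ) w (s w) hw) s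
      (fun c hc x => by rw [map_smul_eq_mul, Real.norm_of_nonneg hc.le]) (map_add_le_add s) (by
        rintro ⟨x, hx⟩
        obtain ⟨a, rfl⟩ := Submodule.mem_span_singleton.1 hx
        simp only [LinearPMap.mkSpanSingleton]
        rw [LinearPMap.mkSpanSingleton'_apply, map_smul_eq_mul, smul_eq_mul]
        exact mul_le_mul_of_nonneg_right (le_abs_self a) (apply_nonneg s w))
    refine ⟨g.mkContinuous K fun z => ?_, ?_, hg2⟩
    · rw [Real.norm_eq_abs]
      refine abs_le.2 ⟨?_, (hg2 z).trans (hK z)⟩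
      have := (hg2 (-z)).trans (hK (-z))
      rw [map_neg, norm_neg] at this
      linarith
    · have := hg1 ⟨w, Submodule.mem_span_singleton_self w⟩
      rw [LinearPMap.mkSpanSingleton_apply] at this
      exact this

/-- Weak convergence implies convergence in a compact seminorm. -/
theorem IsCompactSeminorm.tendsto_zero {s : Seminorm ℝ X} (hs : IsCompactSeminorm s) {u : ℕ → X}
    {a : X} (h : WeaklyConverges u a) : Tendsto (fun n => s (u n - a)) atTop (𝓝 0) := by
  obtain ⟨K, hK0, hK⟩ := hs.exists_le
  obtain ⟨C₀, hC₀, hu⟩ := h.exists_norm_le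
  let C := C₀ + ‖a‖
  have hC : 0 < C := by positivity
  have hun : ∀ n, ‖C⁻¹ • (u n - a)‖ ≤ 1 := fun n => by
    rw [norm_smul, norm_inv, Real.norm_of_nonneg hC.le, inv_mul_le_iff₀ hC, mul_one]
    exact (norm_sub_le _ _).trans (by simp only [C]; linarith [hu n])
  choose ℓ hℓ1 hℓ2 using exists_dual_le_seminorm hK
  rw [Metric.tendsto_atTop']
  intro ε hε
  -- For `w` in a finite `δ`-net with norming functional `ℓ w`, one has `s z ≤ 2 * s (z - w) + ℓ w
  -- z`. Both contributions are small, for a total below `3 * δ`, once the finitely many values `ℓ w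
  -- z` are below `δ`.
  let δ := ε / (3 * C)
  have hδ : 0 < δ := by positivity
  obtain ⟨t, ht, H⟩ := hs δ hδ
  have hev : ∀ᶠ n in atTop, ∀ w ∈ t, ℓ w (C⁻¹ • (u n - a)) < δ := by
    rw [ht.eventually_all]
    intro w _
    have h1 : Tendsto (fun n => ℓ w (C⁻¹ • (u n - a))) atTop (𝓝 0) := by
      have := ((h (ℓ w)).sub_const (ℓ w a)).const_mul C⁻¹
      simpa using this
    exact h1.eventually (gt_mem_nhds hδ)
  obtain ⟨N, hN⟩ := eventually_atTop.1 hev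
  refine ⟨N, fun n hn => ?_⟩
  obtain ⟨w, hw, hzw⟩ := H _ (hun n)
  have h1 := hN n hn.le w hw
  set z := C⁻¹ • (u n - a) with hz
  have h2 : s z ≤ s (z - w) + s w := by simpa using map_add_le_add s (z - w) w
  have h3 : ℓ w w = ℓ w z + ℓ w (w - z) := by rw [← map_add]; simp
  have h4 := hℓ2 w (w - z)
  rw [map_sub_rev s] at h4
  have h5 : s z < 3 * δ := by linarith [hℓ1 w]
  have h6 : s z = C⁻¹ * s (u n - a) := by
    rw [hz, map_smul_eq_mul, norm_inv, Real.norm_of_nonneg hC.le]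
  rw [dist_zero_right, Real.norm_of_nonneg (apply_nonneg s _)]
  rw [h6, inv_mul_lt_iff₀ hC] at h5
  refine h5.trans_eq ?_
  simp only [δ]; field_simp

/-- The error term of semi-bounded variation is thus continuous along weakly convergent sequences,
which lets Minty's argument tolerate it. -/
theorem IsCompactSeminorm.tendsto_modulus {s : Seminorm ℝ X} (hs : IsCompactSeminorm s)
    {c : ℝ → ℝ → ℝ} (hc : IsModulus c) {R : ℝ} (hR : 0 < R) {u : ℕ → X} {a : X}
    (h : WeaklyConverges u a) (v : X) :
    Tendsto (fun n => c R (s (u n - v))) atTop (𝓝 (c R (s (a - v)))) := by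
  have h1 : Tendsto (fun n => s (u n - v)) atTop (𝓝 (s (a - v))) := by
    rw [tendsto_iff_dist_tendsto_zero]
    refine squeeze_zero (fun n => dist_nonneg) (fun n => ?_) (hs.tendsto_zero h)
    rw [Real.dist_eq]
    simpa using abs_sub_map_le_sub s (u n - v) (a - v)
  refine Tendsto.comp ((hc R hR).1 _ (apply_nonneg s _)) (tendsto_nhdsWithin_iff.2 ⟨h1, ?_⟩)
  exact Eventually.of_forall fun n => apply_nonneg s _

theorem tendsto_apply_of_weaklyConverges {φ : ℕ → StrongDual ℝ X} {a : StrongDual ℝ X} {u : ℕ → X}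
    {x : X} (hφ : Tendsto φ atTop (𝓝 a)) (hu : WeaklyConverges u x) :
    Tendsto (fun n => φ n (u n)) atTop (𝓝 (a x)) := by
  obtain ⟨C, hC, hb⟩ := hu.exists_norm_le
  have h1 : Tendsto (fun n => (φ n - a) (u n)) atTop (𝓝 0) := by
    have h2 : Tendsto (fun n => ‖φ n - a‖ * C) atTop (𝓝 0) := by
      have := (tendsto_iff_norm_sub_tendsto_zero.1 hφ).mul_const C
      simpa using this
    refine squeeze_zero_norm (fun n => ?_) h2
    exact ((φ n - a).le_opNorm _).trans (mul_le_mul_of_nonneg_left (hb n) (norm_nonneg _))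
  have := h1.add (hu a)
  simpa using this

/-- Bounds for the values of operators of semi-bounded variation. -/
theorem exists_norm_le_of_hasSBV [CompleteSpace X] {s : Seminorm ℝ X} (hs : IsCompactSeminorm s)
    {c : ℝ → ℝ → ℝ} (hc : IsModulus c) {Φ : ℕ → X → StrongDual ℝ X} (hΦ : ∀ k, HasSBV s c (Φ k))
    (hb : ∀ v, ∃ M, ∀ k, ‖Φ k v‖ ≤ M) {z : ℕ → X} {C : ℝ} (hz : ∀ k, ‖z k‖ ≤ C) (x : X)
    {a : ℕ → ℝ} (ha : ∀ k, 1 ≤ a k) (hza : ∀ k, Φ k (z k) (z k - x) ≤ a k) :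
    ∃ K, ∀ k, ‖Φ k (z k)‖ ≤ K * a k := by
  obtain ⟨K, hK0, hK⟩ := hs.exists_le
  have hC : 0 ≤ C := (norm_nonneg _).trans (hz 0)
  -- Semi-bounded variation between `z k` and the fixed point `x + v` bounds `Φ k (z k) v` from
  -- above by `Φ k (z k) (z k - x)` plus bounded terms. The uniform boundedness principle then
  -- applies to the functionals divided by `a k`.
  have key : ∀ v, ∃ M, ∀ k, Φ k (z k) v ≤ M * a k := by
    intro v
    let R := C + ‖x + v‖ + 1
    have hR : 0 < R := by positivity
    obtain ⟨M, hM⟩ := hb (x + v)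
    obtain ⟨B, hB⟩ := (isCompact_Icc (a := (0 : ℝ)) (b := K * (2 * R))).exists_bound_of_continuousOn
      ((hc R hR).1.mono fun t ht => ht.1)
    have hM0 : 0 ≤ M := (norm_nonneg _).trans (hM 0)
    have hB0 : 0 ≤ B := (norm_nonneg _).trans (hB 0 ⟨le_rfl, by positivity⟩)
    refine ⟨1 + M * (2 * R) + B, fun k => ?_⟩
    have h1 := hΦ k R hR (z k) (x + v) (by simp only [R]; linarith [hz k, norm_nonneg (x + v)])
      (by simp only [R]; linarith)
    have h2 : ‖z k - (x + v)‖ ≤ 2 * R :=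
      (norm_sub_le _ _).trans (by simp only [R]; linarith [hz k, norm_nonneg (x + v)])
    have h3 : |c R (s (z k - (x + v)))| ≤ B := hB _ ⟨apply_nonneg s _, (hK _).trans (by gcongr)⟩
    have h4 : |Φ k (x + v) (z k - (x + v))| ≤ M * (2 * R) :=
      ((Φ k (x + v)).le_opNorm _).trans (mul_le_mul (hM k) h2 (norm_nonneg _) hM0)
    have h5 : Φ k (z k) (z k - (x + v)) = Φ k (z k) (z k - x) - Φ k (z k) v := by
      rw [← map_sub]; congr 1; abel
    rw [sub_apply, h5] at h1
    have h6 := abs_le.1 h3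
    have h7 := abs_le.1 h4
    have h8 : Φ k (z k) v ≤ a k + M * (2 * R) + B := by linarith [hza k]
    have h9 : M * (2 * R) + B ≤ (M * (2 * R) + B) * a k :=
      le_mul_of_one_le_right (by positivity) (ha k)
    nlinarith
  obtain ⟨K', hK'⟩ := banach_steinhaus (g := fun k => (a k)⁻¹ • Φ k (z k)) fun v => by
    obtain ⟨M, hM⟩ := key v
    obtain ⟨M', hM'⟩ := key (-v)
    refine ⟨max M M', fun k => ?_⟩
    have hak : 0 < a k := zero_lt_one.trans_le (ha k)
    rw [smul_apply, norm_smul, norm_inv, Real.norm_of_nonneg hak.le, inv_mul_le_iff₀ hak,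
      Real.norm_eq_abs, mul_comm]
    refine abs_le.2 ⟨?_, (hM k).trans (mul_le_mul_of_nonneg_right (le_max_left _ _) hak.le)⟩
    have := (hM' k).trans (mul_le_mul_of_nonneg_right (le_max_right M M') hak.le)
    rw [map_neg] at this
    linarith
  refine ⟨K', fun k => ?_⟩
  have hak : 0 < a k := zero_lt_one.trans_le (ha k)
  have := hK' k
  rwa [norm_smul, norm_inv, Real.norm_of_nonneg hak.le, inv_mul_le_iff₀ hak, mul_comm] at this

/-- Minty's argument for a sequence of operators of semi-bounded variation. -/
theorem eq_of_hasSBV {s : Seminorm ℝ X} (hs : IsCompactSeminorm s) {c : ℝ → ℝ → ℝ}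
    (hc : IsModulus c) {Φ : ℕ → X → StrongDual ℝ X} (hΦ : ∀ k, HasSBV s c (Φ k))
    {Φ₀ : X → StrongDual ℝ X} (hrad : IsRadiallyContinuous Φ₀)
    (hconv : ∀ v, Tendsto (fun k => Φ k v) atTop (𝓝 (Φ₀ v))) {z : ℕ → X} {z₀ : X}
    (hz : WeaklyConverges z z₀) {φ : StrongDual ℝ X}
    (hφ : ∀ x, Tendsto (fun k => Φ k (z k) x) atTop (𝓝 (φ x)))
    (hlim : ∀ ε > 0, ∀ᶠ k in atTop, Φ k (z k) (z k) ≤ φ z₀ + ε) : φ = Φ₀ z₀ := by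
  obtain ⟨C, hC, hzC⟩ := hz.exists_norm_le
  -- The defining inequality passes to the limit: `hlim` takes care of the only product of two
  -- weakly convergent factors, `Φ k (z k) (z k)`.
  have key : ∀ v R, C ≤ R → ‖v‖ ≤ R → -c R (s (z₀ - v)) ≤ (φ - Φ₀ v) (z₀ - v) := by
    intro v R hCR hvR
    have hR : 0 < R := hC.trans_le hCR
    refine le_of_forall_pos_le_add fun ε hε => ?_
    have h1 : Tendsto (fun k => -c R (s (z k - v))) atTop (𝓝 (-c R (s (z₀ - v)))) :=
      (hs.tendsto_modulus hc hR hz v).neg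
    have h2 : Tendsto (fun k => φ z₀ + ε - Φ k (z k) v - (Φ k v (z k) - Φ k v v)) atTop
        (𝓝 (φ z₀ + ε - φ v - (Φ₀ v z₀ - Φ₀ v v))) := by
      refine ((hφ v).const_sub _).sub ((tendsto_apply_of_weaklyConverges (hconv v) hz).sub ?_)
      exact ((ContinuousLinearMap.apply ℝ ℝ v).continuous.tendsto _).comp (hconv v)
    have h3 := le_of_tendsto_of_tendsto h1 h2 (by
      filter_upwards [hlim ε hε] with k hk
      have := hΦ k R hR (z k) v ((hzC k).trans hCR) hvR
      simp only [sub_apply, map_sub] at this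
      linarith)
    simp only [sub_apply, map_sub]
    linarith
  have hle : ∀ u, φ u ≤ Φ₀ z₀ u := by
    intro u
    obtain ⟨ε, hε, hcont⟩ := hrad z₀ u
    -- This radius serves all `z₀ + τ • u` with `τ ≤ 1`, so the modulus `c R` stays the same as `τ`
    -- tends to zero.
    let R := C + ‖z₀‖ + ‖u‖
    have hR : 0 < R := by positivity
    have h1 : Tendsto (fun τ : ℝ => Φ₀ (z₀ + τ • u) u) (𝓝[>] 0) (𝓝 (Φ₀ z₀ u)) := by
      have := hcont 0 ⟨le_rfl, hε.le⟩
      simp only [ContinuousWithinAt, zero_smul, add_zero] at this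
      exact this.mono_left (nhdsWithin_le_of_mem (Icc_mem_nhdsGT hε))
    have h2 := h1.add (hc.tendsto_zero hR (apply_nonneg s u))
    rw [add_zero] at h2
    refine ge_of_tendsto h2 ?_
    filter_upwards [Ioc_mem_nhdsGT one_pos] with τ hτ
    have h3 := key (z₀ + τ • u) R (by simp only [R]; linarith [norm_nonneg z₀, norm_nonneg u]) (by
      refine (norm_add_le _ _).trans ?_
      rw [norm_smul, Real.norm_of_nonneg hτ.1.le]
      simp only [R]
      nlinarith [norm_nonneg u, hτ.2])
    have h4 : z₀ - (z₀ + τ • u) = -(τ • u) := by abel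
    rw [h4, map_neg_eq_map, map_smul_eq_mul, Real.norm_of_nonneg hτ.1.le] at h3
    simp only [sub_apply, map_neg, map_smul, smul_eq_mul] at h3
    have h5 : φ u - Φ₀ (z₀ + τ • u) u ≤ c R (τ * s u) / τ := by
      rw [le_div_iff₀ hτ.1]; linarith
    linarith
  refine ContinuousLinearMap.ext fun u => le_antisymm (hle u) ?_
  have := hle (-u)
  simp only [map_neg] at this
  linarith

/-- Semi-bounded variation between `z k` and `z₀` itself: the error `c R (s (z k - z₀))` tends to `c
R 0 = 0`. It is the lower counterpart of the hypothesis `hlim` in `eq_of_hasSBV`. -/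
theorem eventually_le_apply_of_hasSBV {s : Seminorm ℝ X} (hs : IsCompactSeminorm s)
    {c : ℝ → ℝ → ℝ} (hc : IsModulus c) {Φ : ℕ → X → StrongDual ℝ X}
    (hΦ : ∀ k, HasSBV s c (Φ k)) {z : ℕ → X} {z₀ : X} (hz : WeaklyConverges z z₀)
    {φ ψ : StrongDual ℝ X} (hψ : Tendsto (fun k => Φ k z₀) atTop (𝓝 ψ))
    (hφ : Tendsto (fun k => Φ k (z k) z₀) atTop (𝓝 (φ z₀))) {ε : ℝ} (hε : 0 < ε) :
    ∀ᶠ k in atTop, φ z₀ - ε ≤ Φ k (z k) (z k) := by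
  obtain ⟨C, hC, hzC⟩ := hz.exists_norm_le
  let R := C + ‖z₀‖
  have hR : 0 < R := by positivity
  have h1 : Tendsto (fun k => Φ k (z k) z₀ + (Φ k z₀ (z k) - Φ k z₀ z₀) - c R (s (z k - z₀)))
      atTop (𝓝 (φ z₀ + (ψ z₀ - ψ z₀) - c R (s (z₀ - z₀)))) :=
    (hφ.add ((tendsto_apply_of_weaklyConverges hψ hz).sub (tendsto_apply_of_weaklyConverges hψ
      tendsto_const_nhds.weaklyConverges))).sub (hs.tendsto_modulus hc hR hz z₀)
  rw [sub_self, sub_self, map_zero, hc.apply_zero hR, add_zero, sub_zero] at h1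
  filter_upwards [h1.eventually (lt_mem_nhds (show φ z₀ - ε < φ z₀ by linarith))] with k hk
  have h2 := hΦ k R hR (z k) z₀ (by simp only [R]; linarith [hzC k, norm_nonneg z₀])
    (by simp only [R]; linarith)
  simp only [sub_apply, map_sub] at h2
  linarith

/-- Demicontinuity of radially continuous operators of semi-bounded variation. -/
theorem continuous_apply_of_hasSBV [CompleteSpace X] [TopologicalSpace.SeparableSpace X]
    {s : Seminorm ℝ X} (hs : IsCompactSeminorm s) {c : ℝ → ℝ → ℝ} (hc : IsModulus c)
    {Φ : X → StrongDual ℝ X} (hΦ : HasSBV s c Φ) (hrad : IsRadiallyContinuous Φ) (v : X) :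
    Continuous fun z => Φ z v := by
  refine continuous_iff_seqContinuous.2 fun z z₀ hz => ?_
  refine tendsto_of_subseq_tendsto fun ns hns => ?_
  have hw : Tendsto (fun k => z (ns k)) atTop (𝓝 z₀) := hz.comp hns
  set w := fun k => z (ns k) with hwdef
  obtain ⟨C, hC, hwC⟩ := hw.weaklyConverges.exists_norm_le
  -- The unknown norms are allowed in the weight `a k`. Once `K * ‖w k - z₀‖ < 1 / 2`, the term
  -- containing them is absorbed on the left, leaving the bound `2 * K`.
  obtain ⟨K, hK⟩ := exists_norm_le_of_hasSBV hs hc (Φ := fun _ => Φ) (fun _ => hΦ)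
    (fun v => ⟨‖Φ v‖, fun _ => le_rfl⟩) hwC z₀ (a := fun k => 1 + ‖Φ (w k)‖ * ‖w k - z₀‖)
    (fun k => le_add_of_nonneg_right (by positivity)) fun k =>
      ((le_abs_self _).trans ((Φ (w k)).le_opNorm _)).trans (by linarith)
  have hdist : Tendsto (fun k => K * ‖w k - z₀‖) atTop (𝓝 0) := by
    simpa using (tendsto_iff_norm_sub_tendsto_zero.1 hw).const_mul K
  obtain ⟨n0, hn0⟩ := eventually_atTop.1 (hdist.eventually (gt_mem_nhds (by norm_num : (0:ℝ) < 1 / 2)))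
  have hbd : ∀ k, ‖Φ (w (k + n0))‖ ≤ 2 * K := fun k => by
    have h1 := hK (k + n0)
    have h2 := hn0 (k + n0) (Nat.le_add_left _ _)
    nlinarith [norm_nonneg (Φ (w (k + n0)))]
  obtain ⟨φ, m, hm, hφ⟩ := exists_tendsto_apply_subseq hbd
  have hm' : Tendsto (fun k => m k + n0) atTop atTop :=
    tendsto_atTop_mono (fun k => Nat.le_add_right _ _) hm.tendsto_atTop
  have hwm : Tendsto (fun k => w (m k + n0)) atTop (𝓝 z₀) := hw.comp hm'
  have heq : φ = Φ z₀ := by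
    refine eq_of_hasSBV hs hc (Φ := fun _ => Φ) (fun _ => hΦ) hrad (fun v => tendsto_const_nhds)
      hwm.weaklyConverges hφ fun ε hε => ?_
    have h1 : Tendsto (fun k => Φ (w (m k + n0)) z₀ + 2 * K * ‖w (m k + n0) - z₀‖) atTop
        (𝓝 (φ z₀ + 2 * K * 0)) :=
      (hφ z₀).add ((tendsto_iff_norm_sub_tendsto_zero.1 hwm).const_mul _)
    rw [mul_zero, add_zero] at h1
    filter_upwards [h1.eventually (gt_mem_nhds (show φ z₀ < φ z₀ + ε by linarith))] with k hk
    have h2 : Φ (w (m k + n0)) (w (m k + n0) - z₀) ≤ 2 * K * ‖w (m k + n0) - z₀‖ :=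
      ((le_abs_self _).trans ((Φ (w (m k + n0))).le_opNorm _)).trans
        (mul_le_mul_of_nonneg_right (hbd (m k)) (norm_nonneg _))
    rw [map_sub] at h2
    linarith
  exact ⟨fun k => m k + n0, heq ▸ hφ v⟩

end SemiBoundedVariation

/-! ### Existence by the Galerkin method -/

section Galerkin

variable {X E : Type*} [NormedAddCommGroup X] [NormedSpace ℝ X] [NormedAddCommGroup E]
  [NormedSpace ℝ E]

/-- Outside the ball of radius `lam` coercivity suffices; inside it, semi-bounded variation between
`z` and `0` does. The bound makes the finite-dimensional fields point outwards. -/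
theorem exists_neg_le_apply_self {s : Seminorm ℝ X} (hs : IsCompactSeminorm s) {c : ℝ → ℝ → ℝ}
    (hc : IsModulus c) {Φ : X → StrongDual ℝ X} (hΦ : HasSBV s c Φ) {lam : ℝ} (hlam : 0 < lam)
    (hcoer : ∀ z, lam < ‖z‖ → 0 ≤ Φ z z) : ∃ M, 0 ≤ M ∧ ∀ z, -M ≤ Φ z z := by
  obtain ⟨K, hK0, hK⟩ := hs.exists_le
  obtain ⟨B, hB⟩ := (isCompact_Icc (a := (0 : ℝ)) (b := K * lam)).exists_bound_of_continuousOn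
    ((hc lam hlam).1.mono fun t ht => ht.1)
  have hB0 : 0 ≤ B := (norm_nonneg _).trans (hB 0 ⟨le_rfl, by positivity⟩)
  refine ⟨B + ‖Φ 0‖ * lam, by positivity, fun z => ?_⟩
  rcases le_or_gt ‖z‖ lam with h | h
  · have h1 := hΦ lam hlam z 0 h (by simpa using hlam.le)
    rw [sub_zero, sub_apply] at h1
    have h2 := abs_le.1 (hB (s z) ⟨apply_nonneg s _, (hK z).trans (by gcongr)⟩)
    have h3 := abs_le.1 (((Φ 0).le_opNorm z).trans
      (mul_le_mul_of_nonneg_left h (norm_nonneg (Φ 0))))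
    linarith [h2.1, h2.2, h3.1, h3.2]
  · have : 0 ≤ B + ‖Φ 0‖ * lam := by positivity
    linarith [hcoer z h]

/-- Approximate solutions in the span of finitely many vectors. -/
theorem exists_galerkin_solution {Φ : X → StrongDual ℝ X} (hcont : ∀ v, Continuous fun z => Φ z v)
    {lam M : ℝ} (hlam : 0 < lam) (hcoer : ∀ z, lam < ‖z‖ → 0 ≤ Φ z z) (hM0 : 0 ≤ M)
    (hM : ∀ z, -M ≤ Φ z z) (P : E →L[ℝ] X) (A : E →L[ℝ] StrongDual ℝ X)
    (hPA : ∀ ω, 0 ≤ A ω (P ω)) {n : ℕ} (w : Fin n → E) {ε : ℝ} (hε : 0 < ε) :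
    ∃ z, ‖z‖ ≤ lam ∧ Φ z z ≤ 0 ∧ ∀ j, -ε ≤ (A (w j) + Φ z) (P (w j) - z) := by
  let L : Space n →L[ℝ] E := ∑ i, (EuclideanSpace.proj i : Space n →L[ℝ] ℝ).smulRight (w i)
  have hL : ∀ a : Space n, L a = ∑ i, a i • w i := fun a => by
    simp [L, sum_apply]
  -- The term `ε * a i` makes the field point outwards even if the vectors `P (w i)` are linearly
  -- dependent: the inner product with `a` is at least `ε * ‖a‖ ^ 2 - M`.
  let T : Space n → Space n := fun a =>
    WithLp.toLp 2 fun i => (A (L a) + Φ (P (L a))) (P (w i)) + ε * a i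
  have hT : Continuous T := by
    refine (PiLp.continuous_toLp 2 _).comp (continuous_pi fun i => ?_)
    have h1 : Continuous fun a : Space n => A (L a) (P (w i)) :=
      ((ContinuousLinearMap.apply ℝ ℝ (P (w i))).comp (A.comp L)).continuous
    have h2 : Continuous fun a : Space n => Φ (P (L a)) (P (w i)) :=
      (hcont _).comp (P.comp L).continuous
    have h3 : Continuous fun a : Space n => ε * a i :=
      continuous_const.mul (EuclideanSpace.proj (𝕜 := ℝ) i).continuous
    exact (h1.add h2).add h3
  have hTin : ∀ a b : Space n,
      inner ℝ (T a) b = (A (L a) + Φ (P (L a))) (P (L b)) + ε * inner ℝ a b := by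
    intro a b
    simp only [T, PiLp.inner_apply, RCLike.inner_apply, conj_trivial]
    rw [hL b, map_sum, map_sum, Finset.mul_sum, ← Finset.sum_add_distrib]
    refine Finset.sum_congr rfl fun i _ => ?_
    rw [map_smul, map_smul, smul_eq_mul]
    ring
  have hpos : ∀ a : Space n, Real.sqrt ((M + 1) / ε) ≤ ‖a‖ → 0 < inner ℝ (T a) a := by
    intro a ha
    rw [hTin, real_inner_self_eq_norm_sq, add_apply]
    have h1 := hPA (L a)
    have h2 := hM (P (L a))
    have h3 : (M + 1) / ε ≤ ‖a‖ ^ 2 := (Real.sqrt_le_left (norm_nonneg _)).1 ha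
    rw [div_le_iff₀ hε] at h3
    nlinarith
  obtain ⟨a, ha⟩ := exists_eq_zero_of_inner_pos hT (R := Real.sqrt ((M + 1) / ε))
    (Real.sqrt_pos.2 (by positivity)) hpos
  have h0 : ∀ b : Space n, (A (L a) + Φ (P (L a))) (P (L b)) + ε * inner ℝ a b = 0 := fun b => by
    rw [← hTin, ha, inner_zero_left]
  have haa := h0 a
  rw [add_apply, real_inner_self_eq_norm_sq] at haa
  have hA := hPA (L a)
  refine ⟨P (L a), ?_, ?_, fun j => ?_⟩
  -- If `z` were outside the ball, coercivity would force `ε * ‖a‖ ^ 2 ≤ 0`, hence `a = 0` and `z =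
  -- 0`.
  · by_contra! h
    have h1 := hcoer _ h
    have h2 : ε * ‖a‖ ^ 2 ≤ 0 := by linarith
    have h3 : a = 0 := by
      by_contra hne
      have : 0 < ‖a‖ := norm_pos_iff.2 hne
      have : 0 < ε * ‖a‖ ^ 2 := by positivity
      linarith
    rw [h3, map_zero, map_zero, norm_zero] at h
    linarith
  · have : 0 ≤ ε * ‖a‖ ^ 2 := by positivity
    linarith
  -- Testing with `e - a` and adding the positivity of `A` at `w j - L a` gives the inequality; the
  -- regularization costs at most `ε`, because `⟨a, e⟩ - ‖a‖ ^ 2 ≤ 1`.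
  · let e : Space n := EuclideanSpace.single j 1
    have hLe : L e = w j := by
      rw [hL]
      simp [e]
    have h1 := h0 (e - a)
    rw [inner_sub_right, real_inner_self_eq_norm_sq, map_sub, hLe] at h1
    have h2 := hPA (w j - L a)
    have h3 : (A (w j) + Φ (P (L a))) (P (w j) - P (L a)) =
        A (w j - L a) (P (w j - L a)) + (A (L a) + Φ (P (L a))) (P (w j - L a)) := by
      simp only [add_apply, map_sub, sub_apply]
      ring
    rw [h3]
    have he : ‖e‖ = 1 := by simp [e]
    have h4 : inner ℝ a e ≤ ‖a‖ := by
      have := real_inner_le_norm a e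
      rwa [he, mul_one] at this
    have h5 : inner ℝ a e - ‖a‖ ^ 2 ≤ 1 := by nlinarith [sq_nonneg (‖a‖ - 1), norm_nonneg a]
    nlinarith

/-- Existence for the sum of a maximal monotone linear relation `{(P ω, A ω)}` and a coercive
operator of semi-bounded variation. -/
theorem exists_forall_apply_nonneg [CompleteSpace X] [TopologicalSpace.SeparableSpace X]
    [TopologicalSpace.SeparableSpace E]
    (hX : ∀ (x : ℕ → X) (C : ℝ), (∀ n, ‖x n‖ ≤ C) →
      ∃ (a : X) (k : ℕ → ℕ), StrictMono k ∧ WeaklyConverges (fun n => x (k n)) a)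
    {s : Seminorm ℝ X} (hs : IsCompactSeminorm s) {c : ℝ → ℝ → ℝ} (hc : IsModulus c)
    {Φ : X → StrongDual ℝ X} (hΦ : HasSBV s c Φ) (hrad : IsRadiallyContinuous Φ)
    {lam : ℝ} (hlam : 0 < lam) (hcoer : ∀ z, lam < ‖z‖ → 0 ≤ Φ z z)
    (P : E →L[ℝ] X) (A : E →L[ℝ] StrongDual ℝ X) (hPA : ∀ ω, 0 ≤ A ω (P ω))
    (hmax : ∀ (z : X) (φ : StrongDual ℝ X), ∃ ω, (A ω + φ) (P ω - z) ≤ 0) :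
    ∃ z, ∀ ω, 0 ≤ (A ω + Φ z) (P ω - z) := by
  obtain ⟨M, hM0, hM⟩ := exists_neg_le_apply_self hs hc hΦ hlam hcoer
  let w : ℕ → E := TopologicalSpace.denseSeq E
  have hw : DenseRange w := TopologicalSpace.denseRange_denseSeq E
  have hgal := fun n : ℕ => exists_galerkin_solution (continuous_apply_of_hasSBV hs hc hΦ hrad) hlam
    hcoer hM0 hM P A hPA (fun j : Fin n => w j) (ε := 1 / ((n : ℝ) + 1)) (by positivity)
  choose z hzl hz0 hzw using hgal
  obtain ⟨K, hK⟩ := exists_norm_le_of_hasSBV hs hc (Φ := fun _ => Φ) (fun _ => hΦ)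
    (fun v => ⟨‖Φ v‖, fun _ => le_rfl⟩) hzl 0 (a := fun _ => 1) (fun _ => le_rfl)
    fun k => by rw [sub_zero]; linarith [hz0 k]
  obtain ⟨z₀, k₁, hk₁, hz₁⟩ := hX z lam hzl
  obtain ⟨φ, k₂, hk₂, hφ⟩ := exists_tendsto_apply_subseq (φ := fun n => Φ (z (k₁ n))) fun n =>
    hK (k₁ n)
  let k := fun n => k₁ (k₂ n)
  have hk : StrictMono k := hk₁.comp hk₂
  have hzk : WeaklyConverges (fun n => z (k n)) z₀ := hz₁.comp_strictMono hk₂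
  have hεk : Tendsto (fun n => 1 / ((k n : ℝ) + 1)) atTop (𝓝 0) :=
    tendsto_one_div_add_atTop_nhds_zero_nat.comp hk.tendsto_atTop
  have hup : ∀ j, ∀ᶠ n in atTop, Φ (z (k n)) (z (k n)) ≤
      A (w j) (P (w j)) - A (w j) (z (k n)) + Φ (z (k n)) (P (w j)) + 1 / ((k n : ℝ) + 1) := by
    intro j
    filter_upwards [hk.tendsto_atTop.eventually_gt_atTop j] with n hn
    have := hzw (k n) ⟨j, hn⟩
    simp only [add_apply, map_sub] at this
    linarith
  have hlim : ∀ j, Tendsto (fun n => A (w j) (P (w j)) - A (w j) (z (k n)) +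
      Φ (z (k n)) (P (w j)) + 1 / ((k n : ℝ) + 1)) atTop
      (𝓝 (A (w j) (P (w j)) - A (w j) z₀ + φ (P (w j)) + 0)) := fun j =>
    (((hzk (A (w j))).const_sub _).add (hφ _)).add hεk
  -- The limit functional `φ` inherits the inequality, first on the dense sequence, using the lower
  -- bound for `Φ (z (k n)) (z (k n))`, and then everywhere by continuity.
  have hnn : ∀ ω, 0 ≤ (A ω + φ) (P ω - z₀) := by
    have hcl : IsClosed {ω | 0 ≤ (A ω + φ) (P ω - z₀)} :=
      isClosed_le continuous_const
        ((A.continuous.add continuous_const).clm_apply (P.continuous.sub continuous_const))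
    intro ω
    refine closure_minimal ?_ hcl (hw ω)
    rintro _ ⟨j, rfl⟩
    change 0 ≤ (A (w j) + φ) (P (w j) - z₀)
    refine le_of_forall_pos_le_add fun ε hε => ?_
    have h1 : φ z₀ - ε ≤ A (w j) (P (w j)) - A (w j) z₀ + φ (P (w j)) + 0 := by
      refine ge_of_tendsto (hlim j) ?_
      filter_upwards [hup j, eventually_le_apply_of_hasSBV hs hc (Φ := fun _ => Φ) (fun _ => hΦ)
        hzk tendsto_const_nhds (hφ z₀) hε] with n h1 h2
      linarith
    simp only [add_apply, map_sub]
    linarith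
  have heq : φ = Φ z₀ := by
    refine eq_of_hasSBV hs hc (Φ := fun _ => Φ) (fun _ => hΦ) hrad (fun v => tendsto_const_nhds)
      hzk hφ fun ε hε => ?_
    -- Maximality yields an `ω`, replaced by a nearby member of the dense sequence, for which the
    -- Galerkin inequality bounds `Φ (z (k n)) (z (k n))` from above by nearly `φ z₀`, as Minty's
    -- argument requires.
    obtain ⟨ω, hω⟩ := hmax z₀ φ
    have hop : IsOpen {ω | (A ω + φ) (P ω - z₀) < ε} :=
      isOpen_lt ((A.continuous.add continuous_const).clm_apply (P.continuous.sub continuous_const))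
        continuous_const
    obtain ⟨j, hj⟩ := hw.exists_mem_open hop ⟨ω, hω.trans_lt hε⟩
    have hj' : A (w j) (P (w j)) - A (w j) z₀ + φ (P (w j)) + 0 < φ z₀ + ε := by
      simp only [mem_ofPred_eq, add_apply, map_sub] at hj
      linarith
    filter_upwards [hup j, (hlim j).eventually (gt_mem_nhds hj')] with n h1 h2
    linarith
  exact ⟨z₀, heq ▸ hnn⟩

/-- The Browder–Minty theorem. -/
theorem exists_apply_eq_of_monotone [CompleteSpace X] [TopologicalSpace.SeparableSpace X]
    (hX : ∀ (x : ℕ → X) (C : ℝ), (∀ n, ‖x n‖ ≤ C) →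
      ∃ (a : X) (k : ℕ → ℕ), StrictMono k ∧ WeaklyConverges (fun n => x (k n)) a)
    {Φ : X → StrongDual ℝ X} (hmono : ∀ y z, 0 ≤ (Φ y - Φ z) (y - z))
    (hrad : IsRadiallyContinuous Φ) {lam : ℝ} (hlam : 0 < lam)
    (hcoer : ∀ z, lam < ‖z‖ → 0 ≤ Φ z z) : ∃ z, Φ z = 0 := by
  have hs : IsCompactSeminorm (0 : Seminorm ℝ X) := fun ε hε =>
    ⟨{0}, finite_singleton _, fun z _ => ⟨0, rfl, by simpa using hε⟩⟩
  have hc : IsModulus fun _ _ => 0 := fun R _ => ⟨continuousOn_const, by simp⟩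
  -- Here the linear relation is trivial, `P = id` and `A = 0`, and the seminorm and modulus vanish.
  -- The resulting inequality, tested at `z + u` and `z - u`, gives `Φ z = 0`.
  obtain ⟨z, hz⟩ := exists_forall_apply_nonneg hX hs hc (Φ := Φ)
    (fun R _ z₁ z₂ _ _ => by simpa using hmono z₁ z₂) hrad hlam hcoer
    (ContinuousLinearMap.id ℝ X) 0 (fun ω => by simp) fun z φ => ⟨z, by simp⟩
  refine ⟨z, ContinuousLinearMap.ext fun u => ?_⟩
  have h1 := hz (z + u)
  have h2 := hz (z - u)
  simp at h1 h2
  simp only [zero_apply]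
  linarith

end Galerkin

/-! ### Functional analysis of `W_0^{1,p}` -/

section Sobolev

variable {N : ℕ} {p q : ℝ≥0∞} [Fact (1 ≤ p)] {Ω D : Set (Space N)}

theorem secondCountableTopology_Lp {α : Type*} [MeasurableSpace α]
    [MeasurableSpace.CountablyGenerated α] (μ : Measure α) [SFinite μ] (hp : p ≠ ∞) :
    SecondCountableTopology (Lp ℝ p μ) := by
  have : Fact (p ≠ ∞) := ⟨hp⟩
  infer_instance

instance completeSpace_W0 : CompleteSpace (W0 p Ω) :=
  (Submodule.isClosed_topologicalClosure (testJets p Ω)).completeSpace_coe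

theorem separableSpace_W0 (hp : p ≠ ∞) : TopologicalSpace.SeparableSpace (W0 p Ω) := by
  have := secondCountableTopology_Lp (volume : Measure (Space N)) hp
  have : SecondCountableTopology (JetSpace N p) :=
    (PiLp.continuousLinearEquiv p ℝ
      (fun _ : Option (Fin N) => Lp ℝ p (volume : Measure (Space N)))).toHomeomorph.secondCountableTopology
  have : SecondCountableTopology (W0 p Ω) := TopologicalSpace.Subtype.secondCountableTopology _
  infer_instance

/-- A component of the jet of an element of `W_0^{1,p}(Ω)`. -/
noncomputable def jetL (Ω : Set (Space N)) (o : Option (Fin N)) :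
    W0 p Ω →L[ℝ] Lp ℝ p (volume : Measure (Space N)) :=
  (PiLp.proj p (fun _ : Option (Fin N) => Lp ℝ p (volume : Measure (Space N))) o).comp
    (W0 p Ω).subtypeL

theorem jetL_none (y : W0 p Ω) : (jetL Ω none y : Space N → ℝ) = stateFun y := rfl

theorem jetL_some (y : W0 p Ω) (i : Fin N) :
    (jetL Ω (some i) y : Space N → ℝ) = stateGrad y i := rfl

/-- Every functional on `W_0^{1,p}(Ω)` is given by functions in `L^q`. -/
theorem exists_eq_sum_toDualLp [Fact (1 ≤ q)] [p.HolderConjugate q] (hp2 : 2 ≤ p) (hp : p ≠ ∞)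
    (ℓ : WDual p Ω) : ∃ w : Option (Fin N) → Lp ℝ q (volume : Measure (Space N)),
      ℓ = ∑ o, (toDualLp volume p q (w o)).comp (jetL Ω o) := by
  -- Hahn–Banach extends the functional to the whole product of `L^p` spaces, where the Riesz
  -- theorem applies to each component.
  obtain ⟨g, hg, -⟩ := exists_extension_norm_eq (W0 p Ω) ℓ
  let e := PiLp.continuousLinearEquiv p ℝ
    (fun _ : Option (Fin N) => Lp ℝ p (volume : Measure (Space N)))
  have hcomp : ∀ o, ∃ w : Lp ℝ q (volume : Measure (Space N)), toDualLp volume p q w =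
      (g.comp e.symm.toContinuousLinearMap).comp
        (ContinuousLinearMap.single ℝ
          (fun _ : Option (Fin N) => Lp ℝ p (volume : Measure (Space N))) o) :=
    fun o => toDualLp_surjective hp2 hp _
  choose w hw using hcomp
  refine ⟨w, ContinuousLinearMap.ext fun y => ?_⟩
  rw [← hg y, sum_apply]
  simp only [hw, ContinuousLinearMap.comp_apply, ContinuousLinearMap.single_apply]
  rw [← map_sum, ContinuousLinearEquiv.coe_coe, ← map_sum]
  congr 1
  rw [← e.symm_apply_apply (y : JetSpace N p)]
  congr 1
  ext1 o
  simp only [Finset.sum_apply, Finset.sum_pi_single, Finset.mem_univ, if_true]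
  rfl

theorem separableSpace_WDual [Fact (1 ≤ q)] [p.HolderConjugate q] (hp2 : 2 ≤ p) (hp : p ≠ ∞) :
    TopologicalSpace.SeparableSpace (WDual p Ω) := by
  have := secondCountableTopology_Lp (volume : Measure (Space N)) (conjExponent_ne_top (q := q) hp2)
  have hc : Continuous fun w : Option (Fin N) → Lp ℝ q (volume : Measure (Space N)) =>
      ∑ o, (toDualLp volume p q (w o)).comp (jetL Ω o) :=
    continuous_finsetSum _ fun o _ =>
      ((toDualLp volume p q).continuous.comp (continuous_apply o)).clm_comp continuous_const
  refine Function.Surjective.denseRange (fun ℓ => ?_) |>.separableSpace hc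
  obtain ⟨w, hw⟩ := exists_eq_sum_toDualLp (q := q) hp2 hp ℓ
  exact ⟨w, hw.symm⟩

theorem exists_weaklyConverges_subseq_W0 [Fact (1 ≤ q)] [p.HolderConjugate q] (hp2 : 2 ≤ p)
    (hp : p ≠ ∞) (y : ℕ → W0 p Ω) (C : ℝ) (hy : ∀ n, ‖y n‖ ≤ C) :
    ∃ (a : W0 p Ω) (k : ℕ → ℕ), StrictMono k ∧ WeaklyConverges (fun n => y (k n)) a := by
  have := separableSpace_WDual (Ω := Ω) (q := q) hp2 hp
  have h2 := two_le_toReal hp2 hp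
  exact ((clarksonInequality_piLp hp2 hp (clarksonInequality_Lp hp2 hp)).submodule
    (W0 p Ω)).exists_weaklyConverges_subseq (by linarith) hy

theorem partialDeriv_eq_zero {φ : Space N → ℝ} {x : Space N} (hx : x ∉ tsupport φ) (i : Fin N) :
    partialDeriv i φ x = 0 := by
  have : fderiv ℝ φ x = 0 := by
    by_contra h
    exact hx (support_fderiv_subset ℝ h)
  simp [partialDeriv, this]

/-- The jet of an element of `W_0^{1,p}(Ω)` vanishes outside of `Ω`. -/
theorem jetL_ae_eq_zero (hΩ : MeasurableSet Ω) (y : W0 p Ω) (o : Option (Fin N)) :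
    ∀ᵐ x, x ∉ Ω → jetL Ω o y x = 0 := by
  let L : JetSpace N p →L[ℝ] Lp ℝ p (volume.restrict Ωᶜ) :=
    (LpToLpRestrictCLM (Space N) ℝ ℝ volume p Ωᶜ).comp
      (PiLp.proj p (fun _ : Option (Fin N) => Lp ℝ p (volume : Measure (Space N))) o)
  have hL : ∀ w ∈ W0 p Ω, L w = 0 := by
    intro w hw
    refine closure_minimal (s := (testJets p Ω : Set (JetSpace N p))) ?_
      (isClosed_singleton.preimage L.continuous (t := {0})) hw
    rintro w ⟨φ, hφ, h1, h2⟩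
    change L w = 0
    rw [Lp.eq_zero_iff_ae_eq_zero]
    refine (LpToLpRestrictCLM_coeFn ℝ Ωᶜ (w o)).trans ?_
    cases o with
    | none =>
      filter_upwards [ae_restrict_mem hΩ.compl, ae_restrict_of_ae h1] with x hx hx1
      rw [hx1]
      exact image_eq_zero_of_notMem_tsupport fun h => hx (hφ.support h)
    | some i =>
      filter_upwards [ae_restrict_mem hΩ.compl, ae_restrict_of_ae (h2 i)] with x hx hx1
      rw [hx1]
      exact partialDeriv_eq_zero (fun h => hx (hφ.support h)) i
  have h1 : (jetL Ω o y : Space N → ℝ) =ᵐ[volume.restrict Ωᶜ] 0 := by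
    have h2 := (Lp.eq_zero_iff_ae_eq_zero).1 (hL y y.2)
    exact (LpToLpRestrictCLM_coeFn ℝ Ωᶜ _).symm.trans h2
  exact (ae_restrict_iff' hΩ.compl).1 h1

/-- A component of the jet of an element of `W_0^{1,p}(Ω)`, restricted to a set `S`. -/
noncomputable def jetOn (Ω S : Set (Space N)) (o : Option (Fin N)) : W0 p Ω →L[ℝ] LpOn p S :=
  (LpToLpRestrictCLM (Space N) ℝ ℝ volume p S).comp (jetL Ω o)

theorem jetOn_coeFn (S : Set (Space N)) (o : Option (Fin N)) (y : W0 p Ω) :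
    (jetOn Ω S o y : Space N → ℝ) =ᵐ[volume.restrict S] jetL Ω o y :=
  LpToLpRestrictCLM_coeFn ℝ S _

/-- Jets vanish almost everywhere outside `Ω`, so the norm over the whole space can be compared with
the integrals over `Ω` in the equation. -/
theorem norm_rpow_W0 (hp : p ≠ ∞) (hΩ : MeasurableSet Ω) (y : W0 p Ω) :
    ‖y‖ ^ p.toReal = ∑ o, ‖jetOn Ω Ω o y‖ ^ p.toReal := by
  have hp0 : p ≠ 0 := (zero_lt_one.trans_le (Fact.out : 1 ≤ p)).ne'
  have hr : 0 < p.toReal := ENNReal.toReal_pos hp0 hp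
  have hs : 0 ≤ ∑ o, ‖(y : JetSpace N p) o‖ ^ p.toReal :=
    Finset.sum_nonneg fun i _ => by positivity
  rw [show ‖y‖ = ‖(y : JetSpace N p)‖ from rfl, PiLp.norm_eq_sum hr, ← Real.rpow_mul hs, one_div,
    inv_mul_cancel₀ hr.ne', Real.rpow_one]
  refine Finset.sum_congr rfl fun o _ => ?_
  rw [norm_rpow_eq_integral hp, norm_rpow_eq_integral hp]
  rw [← setIntegral_eq_integral_of_ae_compl_eq_zero (s := Ω)
    (f := fun x => |(y : JetSpace N p) o x| ^ p.toReal)]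
  · refine integral_congr_ae ?_
    filter_upwards [jetOn_coeFn Ω o y] with x hx
    rw [hx]; rfl
  · filter_upwards [jetL_ae_eq_zero hΩ y o] with x hx hxΩ
    have : (y : JetSpace N p) o x = 0 := hx hxΩ
    rw [this, abs_zero, Real.zero_rpow hr.ne']

/-- Multiplication by a bounded function on `L^p`. -/
noncomputable def mulLp {α : Type*} [MeasurableSpace α] {μ : Measure α} (a : Lp ℝ ∞ μ) :
    Lp ℝ p μ →L[ℝ] Lp ℝ p μ :=
  (ContinuousLinearMap.mul ℝ ℝ).holderL μ ∞ p p a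

theorem mulLp_coeFn {α : Type*} [MeasurableSpace α] {μ : Measure α} (a : Lp ℝ ∞ μ) (f : Lp ℝ p μ) :
    (mulLp a f : α → ℝ) =ᵐ[μ] fun x => a x * f x :=
  ContinuousLinearMap.coeFn_holder (r := p) (ContinuousLinearMap.mul ℝ ℝ) a f

theorem IsTestFunction.memLp {S : Set (Space N)} {φ : Space N → ℝ} (hφ : IsTestFunction S φ)
    (r : ℝ≥0∞) : MemLp φ r (volume : Measure (Space N)) :=
  hφ.smooth.continuous.memLp_of_hasCompactSupport hφ.compact

theorem IsTestFunction.continuous_partialDeriv {S : Set (Space N)} {φ : Space N → ℝ}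
    (hφ : IsTestFunction S φ) (i : Fin N) : Continuous (partialDeriv i φ) :=
  (hφ.smooth.continuous_fderiv (by simp)).clm_apply continuous_const

theorem IsTestFunction.memLp_partialDeriv {S : Set (Space N)} {φ : Space N → ℝ}
    (hφ : IsTestFunction S φ) (i : Fin N) (r : ℝ≥0∞) :
    MemLp (partialDeriv i φ) r (volume : Measure (Space N)) :=
  (hφ.continuous_partialDeriv i).memLp_of_hasCompactSupport
    (hφ.compact.fderiv_apply (𝕜 := ℝ) (EuclideanSpace.single i 1))

/-- Multiplication of jets by a test function. -/
noncomputable def mulJet {S : Set (Space N)} {φ : Space N → ℝ} (hφ : IsTestFunction S φ) :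
    JetSpace N p →L[ℝ] JetSpace N p :=
  (PiLp.continuousLinearEquiv p ℝ
    (fun _ : Option (Fin N) => Lp ℝ p (volume : Measure (Space N)))).symm.toContinuousLinearMap.comp
    (ContinuousLinearMap.pi fun o =>
      (mulLp (hφ.memLp ∞).toLp).comp (PiLp.proj p (fun _ => Lp ℝ p (volume : Measure (Space N))) o) +
      o.elim 0 fun i => (mulLp (hφ.memLp_partialDeriv i ∞).toLp).comp
        (PiLp.proj p (fun _ => Lp ℝ p (volume : Measure (Space N))) none))

theorem mulJet_none {S : Set (Space N)} {φ : Space N → ℝ} (hφ : IsTestFunction S φ)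
    (w : JetSpace N p) : (mulJet hφ w none : Space N → ℝ) =ᵐ[volume] fun x => φ x * w none x := by
  have : mulJet hφ w none = mulLp (hφ.memLp ∞).toLp (w none) := by simp [mulJet]
  rw [this]
  filter_upwards [mulLp_coeFn (hφ.memLp ∞).toLp (w none), (hφ.memLp ∞).coeFn_toLp] with x h1 h2
  rw [h1, h2]

theorem mulJet_some {S : Set (Space N)} {φ : Space N → ℝ} (hφ : IsTestFunction S φ)
    (w : JetSpace N p) (i : Fin N) : (mulJet hφ w (some i) : Space N → ℝ) =ᵐ[volume]
      fun x => φ x * w (some i) x + partialDeriv i φ x * w none x := by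
  have : mulJet hφ w (some i) = mulLp (hφ.memLp ∞).toLp (w (some i)) +
      mulLp (hφ.memLp_partialDeriv i ∞).toLp (w none) := by simp [mulJet]
  rw [this]
  filter_upwards [Lp.coeFn_add (mulLp (hφ.memLp ∞).toLp (w (some i)))
      (mulLp (hφ.memLp_partialDeriv i ∞).toLp (w none)),
    mulLp_coeFn (hφ.memLp ∞).toLp (w (some i)), (hφ.memLp ∞).coeFn_toLp,
    mulLp_coeFn (hφ.memLp_partialDeriv i ∞).toLp (w none),
    (hφ.memLp_partialDeriv i ∞).coeFn_toLp] with x h0 h1 h2 h3 h4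
  rw [h0, Pi.add_apply, h1, h2, h3, h4]

/-- For test functions this is the product rule; continuity of the multiplication extends it to the
closure. Membership over `D` makes `φ y` an admissible argument for the divergences. -/
theorem mulJet_mem {S : Set (Space N)} {φ : Space N → ℝ} (hφ : IsTestFunction S φ) (hΩD : Ω ⊆ D)
    {w : JetSpace N p} (hw : w ∈ W0 p Ω) : mulJet hφ w ∈ W0 p D := by
  refine W0_mono p hΩD (map_mem_closure (mulJet hφ).continuous hw ?_)
  rintro w ⟨ψ, hψ, h1, h2⟩
  refine ⟨fun x => φ x * ψ x, ⟨hφ.smooth.mul hψ.smooth, hψ.compact.mul_left,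
    (tsupport_mul_subset_right (f := φ) (g := ψ)).trans hψ.support⟩, ?_, fun i => ?_⟩
  · filter_upwards [mulJet_none hφ w, h1] with x h3 h4
    rw [h3, h4]
  · filter_upwards [mulJet_some hφ w i, h1, h2 i] with x h3 h4 h5
    rw [h3, h4, h5]
    have hd := fderiv_mul (hφ.smooth.differentiable (by simp) x)
      (hψ.smooth.differentiable (by simp) x)
    simp only [partialDeriv]
    rw [show (fun x => φ x * ψ x) = φ * ψ from rfl, hd]
    simp [mul_comm]

/-- Multiplication by a test function, from `W_0^{1,p}(Ω)` to `W_0^{1,p}(D)`. -/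
noncomputable def mulTest {S : Set (Space N)} {φ : Space N → ℝ} (hφ : IsTestFunction S φ)
    (hΩD : Ω ⊆ D) : W0 p Ω →L[ℝ] W0 p D :=
  ((mulJet hφ).comp (W0 p Ω).subtypeL).codRestrict (W0 p D) fun y => mulJet_mem hφ hΩD y.2

theorem stateGrad_mulTest {S : Set (Space N)} {φ : Space N → ℝ} (hφ : IsTestFunction S φ)
    (hΩD : Ω ⊆ D) (y : W0 p Ω) (i : Fin N) : stateGrad (mulTest hφ hΩD y) i =ᵐ[volume]
      fun x => φ x * stateGrad y i x + partialDeriv i φ x * stateFun y x :=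
  mulJet_some hφ (y : JetSpace N p) i

end Sobolev

/-! ### Compactness of the embedding of `W_0^{1,p}` into `L^1` -/

section Rellich

variable {N : ℕ}

theorem enorm_fderiv_apply_le (φ : Space N → ℝ) (x t : Space N) :
    ‖fderiv ℝ φ x t‖ₑ ≤ ‖t‖ₑ * ∑ i, ‖partialDeriv i φ x‖ₑ := by
  have h1 : t = ∑ i, t i • EuclideanSpace.single i (1 : ℝ) := by
    conv_lhs => rw [← (EuclideanSpace.basisFun (Fin N) ℝ).sum_repr t]
    simp
  have h2 : fderiv ℝ φ x t = ∑ i, t i * partialDeriv i φ x := by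
    conv_lhs => rw [h1]
    simp [partialDeriv]
  rw [h2, Finset.mul_sum]
  refine (enorm_sum_le _ _).trans (Finset.sum_le_sum fun i _ => ?_)
  rw [enorm_mul]
  gcongr
  rw [enorm_le_iff_norm_le]
  exact PiLp.norm_apply_le t i

/-- The fundamental theorem of calculus along the segment from `x` to `x + t`, then Tonelli and
translation invariance. -/
theorem lintegral_enorm_translate_sub_le {φ : Space N → ℝ} (hφ : ContDiff ℝ 1 φ) (t : Space N) :
    ∫⁻ x, ‖φ (x + t) - φ x‖ₑ ≤ ‖t‖ₑ * ∫⁻ x, ∑ i, ‖partialDeriv i φ x‖ₑ := by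
  have hcd : Continuous (fderiv ℝ φ) := hφ.continuous_fderiv one_ne_zero
  have hcp : ∀ i, Continuous (partialDeriv i φ) := fun i => hcd.clm_apply continuous_const
  have hpt : ∀ x, ‖φ (x + t) - φ x‖ₑ ≤
      ∫⁻ s in Ioc (0 : ℝ) 1, ‖t‖ₑ * ∑ i, ‖partialDeriv i φ (x + s • t)‖ₑ := by
    intro x
    have hder : ∀ s : ℝ, HasDerivAt (fun s : ℝ => φ (x + s • t)) (fderiv ℝ φ (x + s • t) t) s := by
      intro s
      have h1 : HasDerivAt (fun s : ℝ => x + s • t) t s := by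
        simpa using ((hasDerivAt_id s).smul_const t).const_add x
      exact (hφ.differentiable one_ne_zero _).hasFDerivAt.comp_hasDerivAt s h1
    have hc : Continuous fun s : ℝ => fderiv ℝ φ (x + s • t) t :=
      (hcd.comp (continuous_const.add (continuous_id.smul continuous_const))).clm_apply
        continuous_const
    have h2 := intervalIntegral.integral_eq_sub_of_hasDerivAt (fun s _ => hder s)
      (hc.intervalIntegrable 0 1)
    rw [intervalIntegral.integral_of_le zero_le_one] at h2
    simp only [one_smul, zero_smul, add_zero] at h2
    rw [← h2]
    exact (enorm_integral_le_lintegral_enorm _).trans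
      (lintegral_mono fun s => enorm_fderiv_apply_le φ _ t)
  have hmeas : Measurable fun z : Space N × ℝ =>
      ‖t‖ₑ * ∑ i, ‖partialDeriv i φ (z.1 + z.2 • t)‖ₑ := by
    refine Measurable.const_mul (Finset.measurable_fun_sum _ fun i _ => ?_) _
    exact ((hcp i).comp (continuous_fst.add (continuous_snd.smul continuous_const))).enorm.measurable
  calc ∫⁻ x, ‖φ (x + t) - φ x‖ₑ
      ≤ ∫⁻ x, ∫⁻ s in Ioc (0 : ℝ) 1, ‖t‖ₑ * ∑ i, ‖partialDeriv i φ (x + s • t)‖ₑ :=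
        lintegral_mono hpt
    _ = ∫⁻ s in Ioc (0 : ℝ) 1, ∫⁻ x, ‖t‖ₑ * ∑ i, ‖partialDeriv i φ (x + s • t)‖ₑ :=
        lintegral_lintegral_swap hmeas.aemeasurable
    _ = ∫⁻ s in Ioc (0 : ℝ) 1, ‖t‖ₑ * ∫⁻ x, ∑ i, ‖partialDeriv i φ x‖ₑ := by
        refine lintegral_congr fun s => ?_
        rw [lintegral_add_right_eq_self (μ := (volume : Measure (Space N)))
          (fun x => ‖t‖ₑ * ∑ i, ‖partialDeriv i φ x‖ₑ) (s • t), lintegral_const_mul]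
        exact Finset.measurable_fun_sum _ fun i _ => (hcp i).enorm.measurable
    _ = ‖t‖ₑ * ∫⁻ x, ∑ i, ‖partialDeriv i φ x‖ₑ := by simp

/-- The distance in `L^1` of a function to its means over balls of radius `δ`. -/
theorem measure_ball_mul_lintegral_le {φ : Space N → ℝ} (hφ : ContDiff ℝ 1 φ)
    (hc : HasCompactSupport φ) {δ : ℝ} :
    volume (Metric.ball (0 : Space N) δ) * ∫⁻ x, ‖φ x‖ₑ ≤
      volume (Metric.ball (0 : Space N) δ) *
        (ENNReal.ofReal δ * ∫⁻ x, ∑ i, ‖partialDeriv i φ x‖ₑ) +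
      ∫⁻ x, ‖∫ t in Metric.ball (0 : Space N) δ, φ (x + t)‖ₑ := by
  set B := Metric.ball (0 : Space N) δ
  have hBfin : volume B ≠ ∞ := measure_ball_lt_top.ne
  have hφc : Continuous φ := hφ.continuous
  have hintg : Integrable φ (volume : Measure (Space N)) := hφc.integrable_of_hasCompactSupport hc
  -- The constant `φ x`, integrated over the ball, is split into the integral of translates and that
  -- of the differences; keeping the factor `volume B` avoids a division.
  have hpt : ∀ x, volume B * ‖φ x‖ₑ ≤
      (∫⁻ t in B, ‖φ (x + t) - φ x‖ₑ) + ‖∫ t in B, φ (x + t)‖ₑ := by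
    intro x
    have hi1 : IntegrableOn (fun t => φ (x + t)) B :=
      (hintg.comp_add_left x).integrableOn
    have hi2 : IntegrableOn (fun _ : Space N => φ x) B := integrableOn_const hBfin
    have h1 : ∫ t in B, φ x = (∫ t in B, φ (x + t)) - ∫ t in B, (φ (x + t) - φ x) := by
      rw [integral_sub hi1 hi2]; ring
    have h2 : ‖∫ t in B, φ x‖ₑ = volume B * ‖φ x‖ₑ := by
      rw [setIntegral_const, enorm_smul]
      congr 1
      rw [measureReal_def, Real.enorm_eq_ofReal ENNReal.toReal_nonneg, ENNReal.ofReal_toReal hBfin]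
    rw [← h2, h1, add_comm]
    exact enorm_sub_le.trans (by gcongr; exact enorm_integral_le_lintegral_enorm _)
  have hm : Measurable fun z : Space N × Space N => ‖φ (z.1 + z.2) - φ z.1‖ₑ :=
    ((hφc.comp (continuous_fst.add continuous_snd)).sub (hφc.comp continuous_fst)).enorm.measurable
  rw [← lintegral_const_mul _ hφc.enorm.measurable]
  refine (lintegral_mono hpt).trans ?_
  rw [lintegral_add_left hm.lintegral_prod_right']
  refine add_le_add ?_ le_rfl
  rw [lintegral_lintegral_swap hm.aemeasurable]
  calc ∫⁻ t in B, ∫⁻ x, ‖φ (x + t) - φ x‖ₑ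
      ≤ ∫⁻ t in B, ENNReal.ofReal δ * ∫⁻ x, ∑ i, ‖partialDeriv i φ x‖ₑ := by
        refine setLIntegral_mono' Metric.isOpen_ball.measurableSet fun t ht => ?_
        refine (lintegral_enorm_translate_sub_le hφ t).trans ?_
        gcongr
        rw [← ofReal_norm]
        exact ENNReal.ofReal_le_ofReal (mem_ball_zero_iff.1 ht).le
    _ = _ := by rw [setLIntegral_const, mul_comm]

/-- Rellich's theorem for test functions. -/
theorem tendsto_lintegral_of_isTestFunction {Ω : Set (Space N)} (hΩ : Bornology.IsBounded Ω)
    {φ : ℕ → Space N → ℝ} (hφ : ∀ k, IsTestFunction Ω (φ k)) {C G : ℝ≥0∞} (hC : C ≠ ∞) (hG : G ≠ ∞)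
    (hφC : ∀ k, ∫⁻ x, ‖φ k x‖ₑ ≤ C) (hφG : ∀ k, ∫⁻ x, ∑ i, ‖partialDeriv i (φ k) x‖ₑ ≤ G)
    (hball : ∀ x δ, Tendsto (fun k => ∫ t in Metric.ball x δ, φ k t) atTop (𝓝 0)) :
    Tendsto (fun k => ∫⁻ x, ‖φ k x‖ₑ) atTop (𝓝 0) := by
  rw [ENNReal.tendsto_nhds_zero]
  intro ε hε
  -- The radius is fixed first, to make the gradient term at most `ε / 2` for all `k` at once.
  obtain ⟨δ, hδ, hδG⟩ : ∃ δ : ℝ, 0 < δ ∧ ENNReal.ofReal δ * G ≤ ε / 2 := by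
    have h1 : Tendsto (fun δ : ℝ => ENNReal.ofReal δ * G) (𝓝[>] 0) (𝓝 0) := by
      have : Tendsto (fun δ : ℝ => ENNReal.ofReal δ * G) (𝓝 0) (𝓝 (ENNReal.ofReal 0 * G)) :=
        ENNReal.Tendsto.mul_const (ENNReal.continuous_ofReal.tendsto 0) (Or.inr hG)
      rw [ENNReal.ofReal_zero, zero_mul] at this
      exact this.mono_left nhdsWithin_le_nhds
    have h2 := (ENNReal.tendsto_nhds_zero.1 h1) (ε / 2) (ENNReal.half_pos hε.ne')
    obtain ⟨δ, h3, h4⟩ := (h2.and self_mem_nhdsWithin).exists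
    exact ⟨δ, h4, h3⟩
  set B := Metric.ball (0 : Space N) δ
  have hB0 : volume B ≠ 0 := (Metric.measure_ball_pos _ _ hδ).ne'
  have hBfin : volume B ≠ ∞ := measure_ball_lt_top.ne
  have hmean : ∀ k x, ∫ t in B, φ k (x + t) = ∫ t in Metric.ball x δ, φ k t := by
    intro k x
    have h := (measurePreserving_add_left (volume : Measure (Space N)) x).setIntegral_preimage_emb
      (MeasurableEquiv.addLeft x).measurableEmbedding (φ k) (Metric.ball x δ)
    rw [← h]
    have : (fun t => x + t) ⁻¹' Metric.ball x δ = B := by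
      ext t; simp [B]
    rw [this]
  let S := Metric.thickening δ Ω
  have hSb : Bornology.IsBounded S := hΩ.thickening
  have hSfin : volume S ≠ ∞ := hSb.measure_lt_top.ne
  -- The integrals over balls tend to zero pointwise, are bounded by `C`, and vanish outside the
  -- `δ`-neighbourhood of `Ω`, which has finite volume.
  have hA : Tendsto (fun k => ∫⁻ x, ‖∫ t in B, φ k (x + t)‖ₑ) atTop (𝓝 0) := by
    have hdom := tendsto_lintegral_of_dominated_convergence
      (μ := (volume : Measure (Space N))) (F := fun k x => ‖∫ t in B, φ k (x + t)‖ₑ) (f := fun _ => 0)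
      (S.indicator fun _ => C) (fun k => ?_) (fun k => Eventually.of_forall fun x => ?_) ?_
      (Eventually.of_forall fun x => ?_)
    · simpa using hdom
    · have hc : Continuous fun z : Space N × Space N => φ k (z.1 + z.2) :=
        (hφ k).smooth.continuous.comp (continuous_fst.add continuous_snd)
      exact (hc.stronglyMeasurable.integral_prod_right' (ν := volume.restrict B)).enorm
    · dsimp only
      rw [hmean]
      by_cases hx : x ∈ S
      · rw [indicator_of_mem hx]
        exact (enorm_integral_le_lintegral_enorm _).trans ((setLIntegral_le_lintegral _ _).trans
          (hφC k))
      · rw [indicator_of_notMem hx, setIntegral_eq_zero_of_forall_eq_zero, enorm_zero]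
        intro t ht
        refine image_eq_zero_of_notMem_tsupport fun h => hx ?_
        exact Metric.mem_thickening_iff.2 ⟨t, (hφ k).support h, by
          rw [dist_comm]; exact ht⟩
    · rw [lintegral_indicator Metric.isOpen_thickening.measurableSet, setLIntegral_const]
      exact ENNReal.mul_ne_top hC hSfin
    · simp only [hmean]
      have := (hball x δ).enorm
      rwa [enorm_zero] at this
  have hη : 0 < volume B * (ε / 2) := ENNReal.mul_pos hB0 (ENNReal.half_pos hε.ne').ne'
  filter_upwards [(ENNReal.tendsto_nhds_zero.1 hA) _ hη] with k hk
  have h1 := measure_ball_mul_lintegral_le ((hφ k).smooth.of_le (by exact_mod_cast le_top))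
    (hφ k).compact (δ := δ)
  have h2 : volume B * ∫⁻ x, ‖φ k x‖ₑ ≤ volume B * ε := by
    refine h1.trans ?_
    calc _ ≤ volume B * (ε / 2) + volume B * (ε / 2) := by
          refine add_le_add ?_ hk
          gcongr
          exact (mul_le_mul_right (hφG k) _).trans hδG
      _ = volume B * ε := by rw [← mul_add, ENNReal.add_halves]
  exact (ENNReal.mul_le_mul_iff_right hB0 hBfin).1 h2

variable {p q : ℝ≥0∞} [Fact (1 ≤ p)] {Ω : Set (Space N)}

/-- Hölder's inequality on the bounded set `Ω`, outside of which the jet vanishes. -/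
theorem exists_lintegral_enorm_jetL_le (hΩ : MeasurableSet Ω) (hΩb : Bornology.IsBounded Ω) :
    ∃ V : ℝ≥0∞, V ≠ ∞ ∧ ∀ (y : W0 p Ω) (o : Option (Fin N)),
      ∫⁻ x, ‖jetL Ω o y x‖ₑ ≤ ‖y‖ₑ * V := by
  refine ⟨volume Ω ^ (1 / (1 : ℝ≥0∞).toReal - 1 / p.toReal), ?_, fun y o => ?_⟩
  · refine ENNReal.rpow_ne_top_of_nonneg ?_ hΩb.measure_lt_top.ne
    rw [ENNReal.toReal_one, div_one, sub_nonneg]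
    rcases eq_or_ne p ∞ with rfl | hp
    · simp
    · have : 1 ≤ p.toReal := by simpa using ENNReal.toReal_mono hp (Fact.out : 1 ≤ p)
      exact (div_le_one (by linarith)).2 this
  · have h1 : ∫⁻ x, ‖jetL Ω o y x‖ₑ = ∫⁻ x in Ω, ‖jetL Ω o y x‖ₑ := by
      rw [← lintegral_indicator hΩ]
      refine lintegral_congr_ae ?_
      filter_upwards [jetL_ae_eq_zero hΩ y o] with x hx
      by_cases hxΩ : x ∈ Ω
      · rw [indicator_of_mem hxΩ]
      · rw [indicator_of_notMem hxΩ, hx hxΩ, enorm_zero]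
    have h2 := eLpNorm_le_eLpNorm_mul_rpow_measure_univ (μ := volume.restrict Ω) (p := 1) (q := p)
      (f := jetL Ω o y) Fact.out (Lp.aestronglyMeasurable (jetL Ω o y)).restrict
    rw [eLpNorm_one_eq_lintegral_enorm, Measure.restrict_apply_univ] at h2
    rw [h1]
    refine h2.trans ?_
    gcongr
    refine (eLpNorm_mono_measure _ Measure.restrict_le_self).trans ?_
    rw [← Lp.enorm_def, enorm_le_iff_norm_le]
    exact PiLp.norm_apply_le (y : JetSpace N p) o

/-- Rellich's theorem: weak convergence in `W_0^{1,p}(Ω)` implies convergence in `L^1`. -/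
theorem tendsto_lintegral_of_weaklyConverges [Fact (1 ≤ q)] [p.HolderConjugate q]
    (hΩ : MeasurableSet Ω) (hΩb : Bornology.IsBounded Ω)
    {y : ℕ → W0 p Ω} {y₀ : W0 p Ω} (hy : WeaklyConverges y y₀) :
    Tendsto (fun k => ∫⁻ x, ‖stateFun (y k) x - stateFun y₀ x‖ₑ) atTop (𝓝 0) := by
  obtain ⟨V, hV, hVy⟩ := exists_lintegral_enorm_jetL_le (p := p) hΩ hΩb
  -- The differences `y k - y₀` are replaced by test functions at distance below `1 / (k + 1)`.
  -- These still converge weakly to zero, and integration over a ball is a continuous functional, so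
  -- their ball integrals tend to zero.
  have hex : ∀ k : ℕ, ∃ w ∈ testJets p Ω,
      dist ((y k - y₀ : W0 p Ω) : JetSpace N p) w < 1 / ((k : ℝ) + 1) := fun k =>
    Metric.mem_closure_iff.1 (y k - y₀).2 _ (by positivity)
  choose w hw hwd using hex
  let ψ : ℕ → W0 p Ω := fun k => ⟨w k, subset_closure (hw k)⟩
  have hψd : Tendsto (fun k => y k - y₀ - ψ k) atTop (𝓝 0) := by
    rw [tendsto_zero_iff_norm_tendsto_zero]
    refine squeeze_zero (fun _ => norm_nonneg _) (fun k => ?_)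
      (tendsto_one_div_add_atTop_nhds_zero_nat (𝕜 := ℝ))
    have := (hwd k).le
    rwa [dist_eq_norm] at this
  have hψ : WeaklyConverges ψ 0 := by
    intro ℓ
    have h1 := ((hy ℓ).sub_const (ℓ y₀)).sub (hψd.weaklyConverges ℓ)
    simpa using h1
  obtain ⟨C₀, hC₀, hψC⟩ := hψ.exists_norm_le
  have hw' := hw
  choose φ hφ hφ0 hφi using hw'
  have e0 : ∀ k, (jetL Ω none (ψ k) : Space N → ℝ) =ᵐ[volume] φ k := hφ0
  have ei : ∀ k i, (jetL Ω (some i) (ψ k) : Space N → ℝ) =ᵐ[volume] partialDeriv i (φ k) := hφi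
  let C : ℝ≥0∞ := ENNReal.ofReal C₀ * V
  have hC : C ≠ ∞ := ENNReal.mul_ne_top ENNReal.ofReal_ne_top hV
  have hle : ∀ k o, ∫⁻ x, ‖jetL Ω o (ψ k) x‖ₑ ≤ C := fun k o => by
    refine (hVy (ψ k) o).trans ?_
    simp only [C]
    gcongr
    rw [← ofReal_norm]
    exact ENNReal.ofReal_le_ofReal (hψC k)
  have hlim : Tendsto (fun k => ∫⁻ x, ‖φ k x‖ₑ) atTop (𝓝 0) := by
    refine tendsto_lintegral_of_isTestFunction hΩb hφ (C := C) (G := ∑ _i : Fin N, C) hC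
      (by simp [ENNReal.mul_eq_top, hC]) (fun k => ?_) (fun k => ?_) fun x δ => ?_
    · refine le_trans (le_of_eq ?_) (hle k none)
      refine lintegral_congr_ae ?_
      filter_upwards [e0 k] with x hx
      rw [hx]
    · rw [lintegral_finsetSum _ fun i _ => ((hφ k).continuous_partialDeriv i).enorm.measurable]
      refine Finset.sum_le_sum fun i _ => le_trans (le_of_eq ?_) (hle k (some i))
      refine lintegral_congr_ae ?_
      filter_upwards [ei k i] with x hx
      rw [hx]
    · have hmem : MemLp ((Metric.ball x δ).indicator fun _ => (1 : ℝ)) q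
          (volume : Measure (Space N)) :=
        memLp_indicator_const q Metric.isOpen_ball.measurableSet 1 (Or.inr measure_ball_lt_top.ne)
      have h1 := hψ ((toDualLp volume p q hmem.toLp).comp (jetL Ω none))
      rw [map_zero] at h1
      refine h1.congr fun k => ?_
      rw [ContinuousLinearMap.comp_apply, toDualLp_apply,
        ← integral_indicator Metric.isOpen_ball.measurableSet]
      refine integral_congr_ae ?_
      filter_upwards [hmem.coeFn_toLp, e0 k] with t h2 h3
      rw [h2, h3]
      by_cases ht : t ∈ Metric.ball x δ
      · rw [indicator_of_mem ht, indicator_of_mem ht, one_mul]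
      · rw [indicator_of_notMem ht, indicator_of_notMem ht, zero_mul]
  have hrem : Tendsto (fun k => ‖y k - y₀ - ψ k‖ₑ * V) atTop (𝓝 0) := by
    have h1 : Tendsto (fun k => ‖y k - y₀ - ψ k‖ₑ) atTop (𝓝 0) := by
      have h2 := (ENNReal.continuous_ofReal.tendsto 0).comp
        (tendsto_zero_iff_norm_tendsto_zero.1 hψd)
      rw [ENNReal.ofReal_zero] at h2
      exact h2.congr fun k => ofReal_norm _
    simpa using ENNReal.Tendsto.mul_const h1 (Or.inr hV)
  have hsum := hrem.add hlim
  rw [add_zero] at hsum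
  refine tendsto_of_tendsto_of_tendsto_of_le_of_le tendsto_const_nhds hsum (fun _ => zero_le)
    fun k => ?_
  refine le_trans ?_ (add_le_add_left (hVy (y k - y₀ - ψ k) none) _)
  rw [← lintegral_add_right _ (hφ k).smooth.continuous.enorm.measurable]
  refine lintegral_mono_ae ?_
  have h3 : (jetL Ω none (y k - y₀ - ψ k) : Space N → ℝ) =ᵐ[volume]
      fun x => stateFun (y k) x - stateFun y₀ x - jetL Ω none (ψ k) x := by
    rw [map_sub, map_sub]
    filter_upwards [Lp.coeFn_sub (jetL Ω none (y k) - jetL Ω none y₀) (jetL Ω none (ψ k)),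
      Lp.coeFn_sub (jetL Ω none (y k)) (jetL Ω none y₀)] with x h4 h5
    rw [h4, Pi.sub_apply, h5]
    rfl
  filter_upwards [h3, e0 k] with x h4 h5
  rw [h4, h5]
  have : stateFun (y k) x - stateFun y₀ x =
    (stateFun (y k) x - stateFun y₀ x - φ k x) + φ k x := by ring
  conv_lhs => rw [this]
  exact enorm_add_le _ _

end Rellich

/-! ### Compactness of the set of admissible controls -/

section Controls

/-- Simultaneous extraction of subsequences for finitely many properties. -/
theorem exists_strictMono_forall_mem {ι : Type*} (s : Finset ι) (R : ι → (ℕ → ℕ) → Prop)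
    (hmono : ∀ i (k m : ℕ → ℕ), R i k → StrictMono m → R i (k ∘ m))
    (hex : ∀ i (k : ℕ → ℕ), StrictMono k → ∃ m : ℕ → ℕ, StrictMono m ∧ R i (k ∘ m)) :
    ∃ k : ℕ → ℕ, StrictMono k ∧ ∀ i ∈ s, R i k := by
  classical
  induction s using Finset.induction_on with
  | empty => exact ⟨id, strictMono_id, by simp⟩
  | insert a s ha ih =>
    obtain ⟨k, hk, hks⟩ := ih
    obtain ⟨m, hm, hma⟩ := hex a k hk
    refine ⟨k ∘ m, hk.comp hm, fun i hi => ?_⟩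
    rcases Finset.mem_insert.1 hi with rfl | hi
    · exact hma
    · exact hmono i k m (hks i hi) hm

/-- Convergence of the integrals against all functions in `L^q`. -/
def ConvergesAgainst {α : Type*} [MeasurableSpace α] (μ : Measure α) (q : ℝ≥0∞) (u : ℕ → α → ℝ)
    (v : α → ℝ) : Prop :=
  ∀ w : α → ℝ, MemLp w q μ →
    Tendsto (fun k => ∫ x, u k x * w x ∂μ) atTop (𝓝 (∫ x, v x * w x ∂μ))

/-- Linear constraints survive weak limits: the inequality is integrated over an arbitrary
measurable set, whose indicator is an allowed test function. -/
theorem ae_le_sum_of_convergesAgainst {α ι : Type*} [MeasurableSpace α] {μ : Measure α}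
    [IsFiniteMeasure μ] [Fintype ι] {q : ℝ≥0∞} {u : ι → ℕ → α → ℝ} {v : ι → α → ℝ}
    (hu : ∀ a k, Integrable (u a k) μ) (hv : ∀ a, Integrable (v a) μ)
    (hconv : ∀ a, ConvergesAgainst μ q (u a) (v a)) (c : ι → ℝ) {h : α → ℝ} (hh : Integrable h μ)
    (hle : ∀ k, ∀ᵐ x ∂μ, h x ≤ ∑ a, c a * u a k x) : ∀ᵐ x ∂μ, h x ≤ ∑ a, c a * v a x := by
  have hsum : ∀ f : ι → α → ℝ, (∀ a, Integrable (f a) μ) →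
      Integrable (fun x => ∑ a, c a * f a x) μ := fun f hf =>
    integrable_finsetSum _ fun a _ => (hf a).const_mul _
  have hkey : 0 ≤ᵐ[μ] fun x => ∑ a, c a * v a x - h x := by
    refine ae_nonneg_of_forall_setIntegral_nonneg ((hsum v hv).sub hh) fun s hs _ => ?_
    have hintg : ∀ f : ι → α → ℝ, (∀ a, Integrable (f a) μ) →
        ∫ x in s, (∑ a, c a * f a x - h x) ∂μ =
          ∑ a, c a * ∫ x, f a x * s.indicator (fun _ => (1 : ℝ)) x ∂μ - ∫ x in s, h x ∂μ := by
      intro f hf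
      rw [integral_sub (hsum f hf).integrableOn hh.integrableOn,
        integral_finsetSum _ fun a _ => ((hf a).const_mul _).integrableOn]
      congr 1
      refine Finset.sum_congr rfl fun a _ => ?_
      rw [integral_const_mul, ← integral_indicator hs]
      congr 2
      ext x
      by_cases hx : x ∈ s <;> simp [hx]
    rw [hintg v hv]
    have hlim : Tendsto (fun k => ∑ a, c a * ∫ x, u a k x * s.indicator (fun _ => (1 : ℝ)) x ∂μ -
        ∫ x in s, h x ∂μ) atTop (𝓝 (∑ a, c a * ∫ x, v a x * s.indicator (fun _ => (1 : ℝ)) x ∂μ -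
        ∫ x in s, h x ∂μ)) := by
      refine (tendsto_finsetSum _ fun a _ => ((hconv a _ ?_).const_mul _)).sub_const _
      exact memLp_indicator_const q hs 1 (Or.inr (measure_ne_top μ s))
    refine ge_of_tendsto' hlim fun k => ?_
    rw [← hintg (fun a => u a k) fun a => hu a k]
    refine setIntegral_nonneg_of_ae ?_
    filter_upwards [hle k] with x hx
    exact sub_nonneg.2 hx
  filter_upwards [hkey] with x hx
  exact sub_nonneg.1 hx

theorem conjExponent_le {p q : ℝ≥0∞} [p.HolderConjugate q] (hp2 : 2 ≤ p) : q ≤ p := by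
  have h1 : q ≤ 2 := by
    have h2 := ENNReal.HolderConjugate.inv_add_inv_eq_one p q
    by_contra! h
    have h3 : q⁻¹ < 2⁻¹ := ENNReal.inv_lt_inv.2 h
    have h4 : p⁻¹ ≤ 2⁻¹ := ENNReal.inv_le_inv.2 hp2
    have h5 : p⁻¹ + q⁻¹ < 2⁻¹ + 2⁻¹ := ENNReal.add_lt_add_of_le_of_lt (by simp; exact (by
      intro h0; simp [h0] at hp2)) h4 h3
    rw [h2, ENNReal.inv_two_add_inv_two] at h5
    exact lt_irrefl _ h5
  exact h1.trans hp2

/-- A weak limit satisfies the inequality almost everywhere for each fixed pair of vectors, with an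
exceptional set depending on the pair. A countable dense family and continuity produce one
exceptional set for all pairs. -/
theorem monotone_condition_of_dense {N : ℕ} {p : ℝ≥0∞} (hp2 : 2 ≤ p) (hp : p ≠ ∞)
    (A : Fin N → Fin N → ℝ) {d : ℕ → (Fin N → ℝ) × (Fin N → ℝ)} (hd : DenseRange d)
    (hA : ∀ n, 0 ≤ ∑ i, ∑ j, ((signedPow p ((d n).1 j) - signedPow p ((d n).2 j)) *
      ((d n).1 i - (d n).2 i)) * A i j) (ζ η : Fin N → ℝ) :
    0 ≤ ∑ i, ∑ j, A i j * (signedPow p (ζ j) - signedPow p (η j)) * (ζ i - η i) := by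
  have hsc := continuous_signedPow hp2 hp
  have hc : Continuous fun e : (Fin N → ℝ) × (Fin N → ℝ) => ∑ i, ∑ j, A i j *
      (signedPow p (e.1 j) - signedPow p (e.2 j)) * (e.1 i - e.2 i) := ?_
  · refine hd.induction_on (p := fun e : (Fin N → ℝ) × (Fin N → ℝ) => 0 ≤ ∑ i, ∑ j, A i j *
      (signedPow p (e.1 j) - signedPow p (e.2 j)) * (e.1 i - e.2 i)) (ζ, η)
      (isClosed_le continuous_const hc) fun n => (hA n).trans_eq ?_
    exact Finset.sum_congr rfl fun i _ => Finset.sum_congr rfl fun j _ => by ring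
  refine continuous_finsetSum _ fun i _ => continuous_finsetSum _ fun j _ => ?_
  have h1 : ∀ i, Continuous fun e : (Fin N → ℝ) × (Fin N → ℝ) => e.1 i := fun i =>
    (continuous_apply i).comp continuous_fst
  have h2 : ∀ i, Continuous fun e : (Fin N → ℝ) × (Fin N → ℝ) => e.2 i := fun i =>
    (continuous_apply i).comp continuous_snd
  exact (continuous_const.mul ((hsc.comp (h1 j)).sub (hsc.comp (h2 j)))).mul ((h1 i).sub (h2 i))

theorem coercive_condition_of_dense {N : ℕ} {p : ℝ≥0∞} (hp2 : 2 ≤ p) (hp : p ≠ ∞) (α : ℝ)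
    (A : Fin N → Fin N → ℝ) {d : ℕ → Fin N → ℝ} (hd : DenseRange d)
    (hA : ∀ n, α * ∑ k, |d n k| ^ p.toReal ≤ ∑ i, ∑ j, (signedPow p (d n j) * d n i) * A i j)
    (ζ : Fin N → ℝ) :
    α * ∑ k, |ζ k| ^ p.toReal ≤ ∑ i, ∑ j, A i j * signedPow p (ζ j) * ζ i := by
  have hsc := continuous_signedPow hp2 hp
  have h2 := two_le_toReal hp2 hp
  refine hd.induction_on (p := fun e : Fin N → ℝ => α * ∑ k, |e k| ^ p.toReal ≤
    ∑ i, ∑ j, A i j * signedPow p (e j) * e i) ζ (isClosed_le ?_ (continuous_finsetSum _ fun i _ =>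
      continuous_finsetSum _ fun j _ => ?_)) fun n => (hA n).trans_eq
    (Finset.sum_congr rfl fun i _ => Finset.sum_congr rfl fun j _ => by ring)
  · exact continuous_const.mul (continuous_finsetSum _ fun k _ =>
      ((continuous_apply k).abs.rpow_const fun _ => Or.inr (by linarith)))
  · exact (continuous_const.mul (hsc.comp (continuous_apply j))).mul (continuous_apply i)

variable {N : ℕ} {p q : ℝ≥0∞} {D : Set (Space N)}

/-- Bounded sequences in `L^∞` have subsequences that converge against all functions in `L^q`. -/
theorem exists_convergesAgainst_subseq [Fact (1 ≤ p)] [Fact (1 ≤ q)] [p.HolderConjugate q]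
    {α : Type*} [MeasurableSpace α] [MeasurableSpace.CountablyGenerated α] {μ : Measure α} [IsFiniteMeasure μ]
    (hp2 : 2 ≤ p) (hp : p ≠ ∞) {u : ℕ → Lp ℝ ∞ μ} {β : ℝ} (hu : ∀ k, ∀ᵐ x ∂μ, |u k x| ≤ β) :
    ∃ (v : Lp ℝ ∞ μ) (k : ℕ → ℕ), StrictMono k ∧
      ConvergesAgainst μ q (fun n => u (k n)) v := by
  have := secondCountableTopology_Lp μ (conjExponent_ne_top (p := p) (q := q) hp2)
  -- On a finite measure space the sequence is bounded in `L^p`, where weak compactness is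
  -- available. The pointwise bound passes to the limit and puts it back into `L^∞`.
  have hmem : ∀ k, MemLp (u k) p μ := fun k => (Lp.memLp (u k)).mono_exponent le_top
  obtain ⟨a, k, hk, ha⟩ := exists_weaklyConverges_subseq_Lp (q := q) hp2 hp
    (z := fun n => (hmem n).toLp) (C := (μ univ).toReal ^ p.toReal⁻¹ * max β 0) fun n => by
      have h1 : ∀ᵐ x ∂μ, ‖(hmem n).toLp (u n) x‖ ≤ max β 0 := by
        filter_upwards [hu n, (hmem n).coeFn_toLp] with x h1 h2
        rw [h2]
        exact h1.trans (le_max_left _ _)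
      have h2 := Lp.norm_le_of_ae_bound (le_max_right β 0) h1
      exact h2
  have hconv : ConvergesAgainst μ q (fun n => u (k n)) a := by
    intro w hw
    have h1 := ha (toDualLp μ p q hw.toLp)
    have e : ∀ (g : α → ℝ) (f : Lp ℝ p μ), f =ᵐ[μ] g →
        toDualLp μ p q hw.toLp f = ∫ x, g x * w x ∂μ := by
      intro g f hfg
      rw [toDualLp_apply]
      refine integral_congr_ae ?_
      filter_upwards [hw.coeFn_toLp, hfg] with x h2 h3
      rw [h2, h3, mul_comm]
    rw [e a a (ae_eq_refl _)] at h1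
    exact h1.congr fun n => e _ _ (hmem (k n)).coeFn_toLp
  have hb : ∀ c : ℝ, |c| = 1 → ∀ᵐ x ∂μ, -β ≤ c * a x := by
    intro c hc
    have := ae_le_sum_of_convergesAgainst (ι := Unit) (u := fun _ n => u (k n)) (v := fun _ => a)
      (q := q)
      (fun _ n => (hmem (k n)).integrable (Fact.out)) (fun _ => (Lp.memLp a).integrable (Fact.out))
      (fun _ => hconv) (fun _ => c) (integrable_const (-β)) fun n => by
        filter_upwards [hu (k n)] with x hx
        have : |c * u (k n) x| ≤ β := by rw [abs_mul, hc, one_mul]; exact hx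
        simpa using (abs_le.1 this).1
    simpa using this
  have hab : ∀ᵐ x ∂μ, ‖a x‖ ≤ β := by
    filter_upwards [hb 1 (by simp), hb (-1) (by simp)] with x h1 h2
    exact abs_le.2 ⟨by linarith, by linarith⟩
  have hainf : MemLp a ∞ μ := memLp_top_of_bound (Lp.aestronglyMeasurable a) β hab
  refine ⟨hainf.toLp, k, hk, fun w hw => ?_⟩
  have e : ∫ x, hainf.toLp a x * w x ∂μ = ∫ x, a x * w x ∂μ := by
    refine integral_congr_ae ?_
    filter_upwards [hainf.coeFn_toLp] with x hx
    rw [hx]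
  rw [e]
  exact hconv w hw

/-- The conditions that define `M_p^{α,β}(D)` and `U_b` are preserved under weak limits. -/
theorem mem_Ub_of_convergesAgainst (hp2 : 2 ≤ p) (hp : p ≠ ∞) (hD : volume D ≠ ∞) {α β : ℝ}
    {ξ₁ ξ₂ : LpOn ∞ D} {U : ℕ → Control D} {V : Control D} (hU : ∀ k, U k ∈ Ub p α β ξ₁ ξ₂)
    (hconv : ∀ i j, ConvergesAgainst (volume.restrict D) q (fun k => U k i j) (V i j)) :
    V ∈ Ub p α β ξ₁ ξ₂ := by
  have : IsFiniteMeasure (volume.restrict D) := isFiniteMeasure_restrict.2 hD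
  have hintg : ∀ f : LpOn ∞ D, Integrable f (volume.restrict D) := fun f =>
    (Lp.memLp f).integrable le_top
  have key : ∀ (c : Fin N → Fin N → ℝ) (h : Space N → ℝ), Integrable h (volume.restrict D) →
      (∀ k, ∀ᵐ x ∂(volume.restrict D), h x ≤ ∑ i, ∑ j, c i j * U k i j x) →
      ∀ᵐ x ∂(volume.restrict D), h x ≤ ∑ i, ∑ j, c i j * V i j x := by
    intro c h hh hle
    have := ae_le_sum_of_convergesAgainst (ι := Fin N × Fin N) (q := q)
      (u := fun a k => U k a.1 a.2) (v := fun a => V a.1 a.2) (fun a k => hintg _) (fun a => hintg _)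
      (fun a => hconv a.1 a.2) (fun a => c a.1 a.2) hh fun k => by
        filter_upwards [hle k] with x hx
        rwa [Fintype.sum_prod_type]
    filter_upwards [this] with x hx
    rwa [Fintype.sum_prod_type] at hx
  have key1 : ∀ (i j : Fin N) (c : ℝ) (h : Space N → ℝ), Integrable h (volume.restrict D) →
      (∀ k, ∀ᵐ x ∂(volume.restrict D), h x ≤ c * U k i j x) →
      ∀ᵐ x ∂(volume.restrict D), h x ≤ c * V i j x := by
    intro i j c h hh hle
    have := ae_le_sum_of_convergesAgainst (ι := Unit) (q := q)
      (u := fun _ k => U k i j) (v := fun _ => V i j) (fun a k => hintg _) (fun a => hintg _)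
      (fun a => hconv i j) (fun _ => c) hh (by simpa using hle)
    simpa using this
  refine ⟨⟨?_, ?_, ?_, ?_⟩, ?_⟩
  · ext1 i j
    rw [Matrix.transpose_apply]
    refine Lp.ext ?_
    have hs : ∀ (i j : Fin N), ∀ᵐ x ∂(volume.restrict D), V i j x ≤ V j i x := by
      intro i j
      -- By symmetry the same sequence converges to both `V i j` and `V j i`, so the constraint that
      -- the difference of the two sequences is nonnegative passes to the limit.
      have hcd : ConvergesAgainst (volume.restrict D) q (fun k => U k j i) (V i j) := by
        have : (fun k => (U k j i : Space N → ℝ)) = fun k => (U k i j : Space N → ℝ) := by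
          funext k
          rw [(hU k).1.symm.apply]
        rw [this]
        exact hconv i j
      have h0 := ae_le_sum_of_convergesAgainst (ι := Bool) (q := q)
        (u := fun b k => U k j i) (v := fun b => if b then V j i else V i j)
        (fun b k => hintg _) (fun b => by cases b <;> exact hintg _)
        (fun b => by cases b; exacts [hcd, hconv j i]) (fun b => if b then 1 else -1)
        (integrable_const 0) (fun k => by simp)
      filter_upwards [h0] with x hx
      simp at hx
      linarith
    filter_upwards [hs i j, hs j i] with x h1 h2
    exact le_antisymm h2 h1
  · intro i j
    have h1 := key1 i j 1 (fun _ => -β) (integrable_const _) fun k => by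
      filter_upwards [(hU k).1.growth i j] with x hx
      linarith [(abs_le.1 hx).1]
    have h2 := key1 i j (-1) (fun _ => -β) (integrable_const _) fun k => by
      filter_upwards [(hU k).1.growth i j] with x hx
      linarith [(abs_le.1 hx).2]
    filter_upwards [h1, h2] with x h3 h4
    exact abs_le.2 ⟨by linarith, by linarith⟩
  · let d := TopologicalSpace.denseSeq ((Fin N → ℝ) × (Fin N → ℝ))
    have h1 : ∀ n, ∀ᵐ x ∂(volume.restrict D), 0 ≤ ∑ i, ∑ j, ((signedPow p ((d n).1 j) -
        signedPow p ((d n).2 j)) * ((d n).1 i - (d n).2 i)) * V i j x := by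
      intro n
      refine key _ (fun _ => 0) (integrable_const _) fun k => ?_
      filter_upwards [(hU k).1.monotone] with x hx
      refine (hx (d n).1 (d n).2).trans_eq ?_
      exact Finset.sum_congr rfl fun i _ => Finset.sum_congr rfl fun j _ => by ring
    filter_upwards [ae_all_iff.2 h1] with x hx ζ η
    exact monotone_condition_of_dense hp2 hp (fun i j => V i j x)
      (TopologicalSpace.denseRange_denseSeq _) hx ζ η
  · let d := TopologicalSpace.denseSeq (Fin N → ℝ)
    have h1 : ∀ n, ∀ᵐ x ∂(volume.restrict D), α * ∑ k, |d n k| ^ p.toReal ≤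
        ∑ i, ∑ j, (signedPow p (d n j) * d n i) * V i j x := by
      intro n
      refine key _ (fun _ => α * ∑ k, |d n k| ^ p.toReal) (integrable_const _) fun k => ?_
      filter_upwards [(hU k).1.coercive] with x hx
      refine (hx (d n)).trans_eq ?_
      exact Finset.sum_congr rfl fun i _ => Finset.sum_congr rfl fun j _ => by ring
    filter_upwards [ae_all_iff.2 h1] with x hx ζ
    exact coercive_condition_of_dense hp2 hp α (fun i j => V i j x)
      (TopologicalSpace.denseRange_denseSeq _) hx ζ
  · intro i j
    have h1 := key1 i j 1 ξ₁ (hintg _) fun k => by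
      filter_upwards [(hU k).2 i j] with x hx
      linarith [hx.1]
    have h2 := key1 i j (-1) (fun x => -ξ₂ x) (hintg _).neg fun k => by
      filter_upwards [(hU k).2 i j] with x hx
      linarith [hx.2]
    filter_upwards [h1, h2] with x h3 h4
    exact ⟨by linarith, by linarith⟩

/-- Weak convergence of vector fields and strong convergence of their divergences. -/
theorem isDivergence_of_convergesAgainst [Fact (1 ≤ p)] [p.HolderConjugate q] (hp2 : 2 ≤ p)
    (hD : volume D ≠ ∞)
    {u : ℕ → Fin N → LpOn ∞ D} {v : Fin N → LpOn ∞ D} {ℓ : ℕ → WDual p D} {ℓ₀ : WDual p D}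
    (hconv : ∀ i, ConvergesAgainst (volume.restrict D) q (fun k => u k i) (v i))
    (hu : ∀ k, IsDivergence (u k) (ℓ k)) (hℓ : Tendsto ℓ atTop (𝓝 ℓ₀)) : IsDivergence v ℓ₀ := by
  have : IsFiniteMeasure (volume.restrict D) := isFiniteMeasure_restrict.2 hD
  intro φ
  -- Gradients lie in `L^p`, hence in `L^q`, since `q ≤ p` and `D` has finite measure; they are
  -- therefore test functions for the weak convergence.
  have hgrad : ∀ i, MemLp (stateGrad φ i) q (volume.restrict D) := fun i =>
    ((Lp.memLp (jetL D (some i) φ)).restrict D).mono_exponent (conjExponent_le hp2)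
  have hsum : ∀ w : Fin N → LpOn ∞ D, ∫ x in D, ∑ k, w k x * stateGrad φ k x =
      ∑ k, ∫ x in D, w k x * stateGrad φ k x := fun w =>
    integral_finsetSum _ fun k _ =>
      ((Lp.memLp (w k)).mono_exponent (p := p) le_top).integrable_mul (hgrad k)
  have h1 : Tendsto (fun k => ℓ k φ) atTop (𝓝 (ℓ₀ φ)) :=
    ((ContinuousLinearMap.apply ℝ ℝ φ).continuous.tendsto _).comp hℓ
  refine tendsto_nhds_unique h1 ?_
  rw [hsum]
  refine (tendsto_finsetSum _ fun i _ => hconv i _ (hgrad i)).neg.congr fun k => ?_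
  rw [hu k φ, hsum]

theorem exists_tendsto_subseq_of_isCompact {X : Type*} [SeminormedAddCommGroup X] {K : Set X}
    (hK : IsCompact K) {x : ℕ → X} (hx : ∀ n, x n ∈ K) :
    ∃ a ∈ K, ∃ k : ℕ → ℕ, StrictMono k ∧ Tendsto (x ∘ k) atTop (𝓝 a) :=
  hK.tendsto_subseq hx

/-- Sequential compactness of the set of admissible controls. -/
theorem exists_admissible_control_subseq [Fact (1 ≤ p)] [Fact (1 ≤ q)] [p.HolderConjugate q]
    (hp2 : 2 ≤ p) (hp : p ≠ ∞) (hD : volume D ≠ ∞) {α β : ℝ} {ξ₁ ξ₂ : LpOn ∞ D}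
    {Q : Fin N → Set (WDual p D)} (hQ : ∀ i, IsCompact (Q i)) {U : ℕ → Control D}
    (hU : ∀ k, U k ∈ Ub p α β ξ₁ ξ₂ ∩ Usol p α β Q) :
    ∃ V ∈ Ub p α β ξ₁ ξ₂ ∩ Usol p α β Q, ∃ k : ℕ → ℕ, StrictMono k ∧
      (∀ i j, ConvergesAgainst (volume.restrict D) q (fun n => U (k n) i j) (V i j)) ∧
      ∀ i, ∃ (ℓ : ℕ → WDual p D) (ℓ₀ : WDual p D), Tendsto ℓ atTop (𝓝 ℓ₀) ∧
        (∀ n, IsDivergence (fun a => U (k n) a i) (ℓ n)) ∧ IsDivergence (fun a => V a i) ℓ₀ := by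
  have : IsFiniteMeasure (volume.restrict D) := isFiniteMeasure_restrict.2 hD
  have hdiv : ∀ k i, ∃ ℓ ∈ Q i, IsDivergence (fun a => U k a i) ℓ := fun k => (hU k).2.2
  choose ℓ hℓQ hℓ using hdiv
  obtain ⟨k₁, hk₁, h₁⟩ := exists_strictMono_forall_mem (Finset.univ : Finset (Fin N × Fin N))
    (fun a k => ∃ v : LpOn ∞ D, ConvergesAgainst (volume.restrict D) q
      (fun n => U (k n) a.1 a.2) v)
    (fun a k m ⟨v, hv⟩ hm => ⟨v, fun w hw => (hv w hw).comp hm.tendsto_atTop⟩)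
    (fun a k _ => by
      obtain ⟨v, m, hm, hv⟩ := exists_convergesAgainst_subseq (p := p) (q := q) hp2 hp
        (u := fun n => U (k n) a.1 a.2) (β := β) fun n => (hU (k n)).1.1.growth a.1 a.2
      exact ⟨m, hm, v, hv⟩)
  obtain ⟨k₂, hk₂, h₂⟩ := exists_strictMono_forall_mem (Finset.univ : Finset (Fin N))
    (fun i k => ∃ ℓ₀ ∈ Q i, Tendsto (fun n => ℓ (k₁ (k n)) i) atTop (𝓝 ℓ₀))
    (fun a k m ⟨v, hvQ, hv⟩ hm => ⟨v, hvQ, hv.comp hm.tendsto_atTop⟩)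
    (fun i k _ => by
      obtain ⟨v, hv, m, hm, hlim⟩ := exists_tendsto_subseq_of_isCompact (hQ i)
        (x := fun n => ℓ (k₁ (k n)) i)
        fun n => hℓQ _ i
      exact ⟨m, hm, v, hv, hlim⟩)
  choose V hV using fun i j => h₁ (i, j) (Finset.mem_univ _)
  choose ℓ₀ hℓ₀Q hℓ₀ using fun i => h₂ i (Finset.mem_univ _)
  have hconv : ∀ i j, ConvergesAgainst (volume.restrict D) q (fun n => U (k₁ (k₂ n)) i j) (V i j) :=
    fun i j w hw => (hV i j w hw).comp hk₂.tendsto_atTop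
  have hVdiv : ∀ i, IsDivergence (fun a => V a i) (ℓ₀ i) := fun i =>
    isDivergence_of_convergesAgainst (q := q) hp2 hD (fun a => hconv a i) (fun n => hℓ _ i) (hℓ₀ i)
  have hVb : (V : Control D) ∈ Ub p α β ξ₁ ξ₂ :=
    mem_Ub_of_convergesAgainst (q := q) hp2 hp hD (fun n => (hU (k₁ (k₂ n))).1) hconv
  exact ⟨V, ⟨hVb, hVb.1, fun i => ⟨ℓ₀ i, hℓ₀Q i, hVdiv i⟩⟩, fun n => k₁ (k₂ n), hk₁.comp hk₂, hconv,
    fun i => ⟨fun n => ℓ (k₁ (k₂ n)) i, ℓ₀ i, hℓ₀ i, fun n => hℓ _ i, hVdiv i⟩⟩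

end Controls

/-! ### Compensated compactness -/

section DivCurl

variable {N : ℕ} {p q : ℝ≥0∞} {Ω D : Set (Space N)}

theorem IsTestFunction.eq_zero {φ : Space N → ℝ} (hφ : IsTestFunction Ω φ) {x : Space N}
    (hx : x ∉ Ω) : φ x = 0 :=
  image_eq_zero_of_notMem_tsupport fun h => hx (hφ.support h)

/-- The fundamental lemma of the calculus of variations. -/
theorem Lp_eq_of_forall_integral_eq [Fact (1 ≤ p)] (hΩ : IsOpen Ω) {a b : LpOn p Ω}
    (h : ∀ φ : Space N → ℝ, IsTestFunction Ω φ → ∫ x in Ω, a x * φ x = ∫ x in Ω, b x * φ x) :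
    a = b := by
  have hL : ∀ c : LpOn p Ω, LocallyIntegrable c (volume.restrict Ω) := fun c =>
    (Lp.memLp c).locallyIntegrable Fact.out
  have key := hΩ.ae_eq_zero_of_integral_contDiff_smul_eq_zero (μ := volume)
    (f := fun x => a x - b x)
    (locallyIntegrableOn_of_locallyIntegrable_restrict ((hL a).sub (hL b)))
    fun φ h1 h2 h3 => by
      have hφ : IsTestFunction Ω φ := ⟨h1, h2, h3⟩
      rw [← setIntegral_eq_integral_of_forall_compl_eq_zero (s := Ω)
        fun x hx => by simp [hφ.eq_zero hx]]
      have hi : ∀ c : LpOn p Ω, Integrable (fun x => c x * φ x) (volume.restrict Ω) := fun c =>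
        ((hL c).integrable_smul_left_of_hasCompactSupport h1.continuous h2).congr
          (Eventually.of_forall fun x => by simp [mul_comm])
      have h' := sub_eq_zero.2 (h φ hφ)
      rw [← integral_sub (hi a) (hi b)] at h'
      exact (integral_congr_ae (Eventually.of_forall fun x => by simp; ring)).trans h'
  refine Lp.ext ?_
  filter_upwards [(ae_restrict_iff' hΩ.measurableSet).2 key] with x hx
  exact sub_eq_zero.1 hx

theorem restrictLp_coeFn {r : ℝ≥0∞} (hΩD : Ω ⊆ D) (g : LpOn r D) :
    (restrictLp hΩD g : Space N → ℝ) =ᵐ[volume.restrict Ω] g :=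
  MemLp.coeFn_toLp _

variable [Fact (1 ≤ p)]

/-- The map `y ↦ (u, ∇y)` on `Ω`, for a bounded vector field `u`. -/
noncomputable def gradAlong (hΩD : Ω ⊆ D) (u : Fin N → LpOn ∞ D) : W0 p Ω →L[ℝ] LpOn p Ω :=
  ∑ i, (mulLp (restrictLp hΩD (u i))).comp (jetOn Ω Ω (some i))

theorem gradAlong_coeFn (hΩD : Ω ⊆ D) (u : Fin N → LpOn ∞ D) (y : W0 p Ω) :
    (gradAlong hΩD u y : Space N → ℝ) =ᵐ[volume.restrict Ω]
      fun x => ∑ i, u i x * stateGrad y i x := by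
  have h1 : ∀ i, (mulLp (restrictLp hΩD (u i)) (jetOn Ω Ω (some i) y) : Space N → ℝ)
      =ᵐ[volume.restrict Ω] fun x => u i x * stateGrad y i x := fun i => by
    filter_upwards [mulLp_coeFn (restrictLp hΩD (u i)) (jetOn Ω Ω (some i) y),
      restrictLp_coeFn hΩD (u i), jetOn_coeFn Ω (some i) y] with x h1 h2 h3
    rw [h1, h2, h3, jetL_some]
  have h2 : gradAlong hΩD u y = ∑ i, mulLp (restrictLp hΩD (u i)) (jetOn Ω Ω (some i) y) := by
    simp [gradAlong]
  rw [h2]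
  filter_upwards [Lp.coeFn_finsetSum Finset.univ
    (fun i => mulLp (restrictLp hΩD (u i)) (jetOn Ω Ω (some i) y)), ae_all_iff.2 h1] with x h3 h4
  rw [h3]
  simp [h4]

theorem exists_norm_gradAlong_le (hΩD : Ω ⊆ D) {β : ℝ} (hβ : 0 ≤ β) :
    ∃ K, ∀ (u : Fin N → LpOn ∞ D) (y : W0 p Ω),
      (∀ i, ∀ᵐ x ∂(volume.restrict D), |u i x| ≤ β) → ‖gradAlong hΩD u y‖ ≤ K * ‖y‖ := by
  refine ⟨∑ i, β * ‖(jetOn Ω Ω (some i) : W0 p Ω →L[ℝ] LpOn p Ω)‖, fun u y hu => ?_⟩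
  rw [gradAlong, sum_apply, Finset.sum_mul]
  refine norm_sum_le_of_le _ fun i _ => ?_
  rw [mul_assoc]
  refine le_trans ?_ (mul_le_mul_of_nonneg_left (ContinuousLinearMap.le_opNorm _ y) hβ)
  refine Lp.norm_le_mul_norm_of_ae_le_mul ?_
  filter_upwards [mulLp_coeFn (restrictLp hΩD (u i)) (jetOn Ω Ω (some i) y),
    restrictLp_coeFn hΩD (u i), ae_restrict_of_ae_restrict_of_subset hΩD (hu i)] with x h1 h2 h3
  rw [ContinuousLinearMap.comp_apply, h1, norm_mul, h2]
  exact mul_le_mul_of_nonneg_right h3 (norm_nonneg _)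


theorem memLp_partialDeriv_mul_stateFun [p.HolderConjugate q] (hp2 : 2 ≤ p) (hD : volume D ≠ ∞)
    {S : Set (Space N)} {φ : Space N → ℝ} (hφ : IsTestFunction S φ) (y : W0 p Ω) (i : Fin N) :
    MemLp (fun x => partialDeriv i φ x * stateFun y x) q (volume.restrict D) := by
  have : IsFiniteMeasure (volume.restrict D) := isFiniteMeasure_restrict.2 hD
  refine MemLp.mono_exponent (q := p) ?_ (conjExponent_le hp2)
  have h : MemLp (stateFun y) p volume := Lp.memLp (jetL Ω none y)
  exact (h.mul (p := ∞) (hφ.memLp_partialDeriv i ∞)).restrict D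

/-- Integration by parts for the product of a vector field with a gradient. -/
theorem integral_gradAlong_mul [p.HolderConjugate q] (hp2 : 2 ≤ p)
    (hDm : MeasurableSet D) (hD : volume D ≠ ∞) (hΩD : Ω ⊆ D) {u : Fin N → LpOn ∞ D} {ℓ : WDual p D}
    (hu : IsDivergence u ℓ) {φ : Space N → ℝ} (hφ : IsTestFunction Ω φ) (y : W0 p Ω) :
    ∫ x in Ω, gradAlong hΩD u y x * φ x = -ℓ (mulTest hφ hΩD y) -
      ∑ i, ∫ x in D, u i x * (partialDeriv i φ x * stateFun y x) := by
  have : IsFiniteMeasure (volume.restrict D) := isFiniteMeasure_restrict.2 hD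
  have hui : ∀ i, MemLp (u i) p (volume.restrict D) := fun i =>
    (Lp.memLp (u i)).mono_exponent le_top
  have hi1 : ∀ i, Integrable (fun x => u i x * (partialDeriv i φ x * stateFun y x))
      (volume.restrict D) := fun i =>
    (hui i).integrable_mul (memLp_partialDeriv_mul_stateFun (q := q) hp2 hD hφ y i)
  have hi2 : ∀ i, Integrable (fun x => u i x * (φ x * stateGrad y i x)) (volume.restrict D) := by
    intro i
    have h : MemLp (stateGrad y i) p volume := Lp.memLp (jetL Ω (some i) y)
    exact (hui i).integrable_mul (q := q)
      (((h.mul (p := ∞) (hφ.memLp ∞)).restrict D).mono_exponent (conjExponent_le hp2))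
  have e1 : ∫ x in Ω, gradAlong hΩD u y x * φ x =
      ∫ x in D, ∑ i, u i x * (φ x * stateGrad y i x) := by
    rw [setIntegral_eq_of_subset_of_forall_sdiff_eq_zero hDm hΩD
      (fun x hx => by simp [hφ.eq_zero hx.2])]
    refine integral_congr_ae ?_
    filter_upwards [gradAlong_coeFn hΩD u y] with x hx
    rw [hx, Finset.sum_mul]
    exact Finset.sum_congr rfl fun i _ => by ring
  -- The divergence is evaluated at `φ y`, whose gradient is `φ ∇y + y ∇φ`.
  rw [hu, neg_neg, e1, ← integral_finsetSum _ fun i _ => hi1 i, eq_sub_iff_add_eq,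
    ← integral_add (integrable_finsetSum _ fun i _ => hi2 i)
      (integrable_finsetSum _ fun i _ => hi1 i)]
  refine integral_congr_ae ?_
  filter_upwards [ae_all_iff.2 fun i => ae_restrict_of_ae (s := D) (stateGrad_mulTest hφ hΩD y i)]
    with x hx
  rw [← Finset.sum_add_distrib]
  exact Finset.sum_congr rfl fun i _ => by rw [hx i]; ring

/-- The commutator term of the div-curl lemma. The factor `y k` converges strongly in `L^1` by
Rellich and `u k` is bounded in `L^∞`, so weak convergence of `u k` is enough. -/
theorem tendsto_integral_mul_partialDeriv [Fact (1 ≤ q)] [p.HolderConjugate q] (hp2 : 2 ≤ p)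
    (hΩ : MeasurableSet Ω) (hΩb : Bornology.IsBounded Ω) (hD : volume D ≠ ∞)
    {u : ℕ → LpOn ∞ D} {v : LpOn ∞ D} {β : ℝ}
    (hub : ∀ k, ∀ᵐ x ∂(volume.restrict D), |u k x| ≤ β)
    (hu : ConvergesAgainst (volume.restrict D) q (fun k => u k) v)
    {S : Set (Space N)} {φ : Space N → ℝ} (hφ : IsTestFunction S φ) (i : Fin N)
    {y : ℕ → W0 p Ω} {y₀ : W0 p Ω} (hy : WeaklyConverges y y₀) :
    Tendsto (fun k => ∫ x in D, u k x * (partialDeriv i φ x * stateFun (y k) x)) atTop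
      (𝓝 (∫ x in D, v x * (partialDeriv i φ x * stateFun y₀ x))) := by
  have : IsFiniteMeasure (volume.restrict D) := isFiniteMeasure_restrict.2 hD
  have hintg : ∀ k (z : W0 p Ω), Integrable (fun x => u k x * (partialDeriv i φ x * stateFun z x))
      (volume.restrict D) := fun k z =>
    ((Lp.memLp (u k)).mono_exponent (p := p) le_top).integrable_mul
      (memLp_partialDeriv_mul_stateFun (q := q) hp2 hD hφ z i)
  obtain ⟨M, hM⟩ := (hφ.continuous_partialDeriv i).bounded_above_of_compact_support
    (hφ.compact.fderiv_apply (𝕜 := ℝ) (EuclideanSpace.single i 1))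
  have hzero : Tendsto (fun k => ∫ x in D, u k x * (partialDeriv i φ x * stateFun (y k) x) -
      u k x * (partialDeriv i φ x * stateFun y₀ x)) atTop (𝓝 0) := by
    rw [tendsto_zero_iff_enorm_tendsto_zero]
    have hlim : Tendsto (fun k => ENNReal.ofReal (β * M) *
        ∫⁻ x, ‖stateFun (y k) x - stateFun y₀ x‖ₑ) atTop (𝓝 0) := by
      simpa using ENNReal.Tendsto.const_mul
        (tendsto_lintegral_of_weaklyConverges (q := q) hΩ hΩb hy) (Or.inr ENNReal.ofReal_ne_top)
    refine tendsto_of_tendsto_of_tendsto_of_le_of_le tendsto_const_nhds hlim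
      (fun _ => zero_le) fun k => ?_
    refine (enorm_integral_le_lintegral_enorm _).trans ?_
    refine le_trans ?_ (mul_le_mul_right (setLIntegral_le_lintegral D _) _)
    rw [← lintegral_const_mul' _ _ ENNReal.ofReal_ne_top]
    refine lintegral_mono_ae ?_
    filter_upwards [hub k] with x hx
    rw [show u k x * (partialDeriv i φ x * stateFun (y k) x) -
      u k x * (partialDeriv i φ x * stateFun y₀ x) =
      (u k x * partialDeriv i φ x) * (stateFun (y k) x - stateFun y₀ x) by ring, enorm_mul]
    refine mul_le_mul_left ?_ _
    rw [← ofReal_norm]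
    refine ENNReal.ofReal_le_ofReal ?_
    rw [norm_mul]
    exact mul_le_mul hx (hM x) (norm_nonneg _) ((abs_nonneg _).trans hx)
  have h := hzero.add (hu _ (memLp_partialDeriv_mul_stateFun (q := q) hp2 hD hφ y₀ i))
  rw [zero_add] at h
  refine h.congr fun k => ?_
  rw [integral_sub (hintg k _) (hintg k _), sub_add_cancel]

/-- The div-curl lemma. -/
theorem weaklyConverges_gradAlong [Fact (1 ≤ q)] [p.HolderConjugate q] (hp2 : 2 ≤ p) (hp : p ≠ ∞)
    (hΩ : IsOpen Ω) (hDo : IsOpen D) (hDb : Bornology.IsBounded D) (hΩD : Ω ⊆ D)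
    {u : ℕ → Fin N → LpOn ∞ D} {v : Fin N → LpOn ∞ D} {β : ℝ} (hβ : 0 ≤ β)
    (hub : ∀ k i, ∀ᵐ x ∂(volume.restrict D), |u k i x| ≤ β)
    (hu : ∀ i, ConvergesAgainst (volume.restrict D) q (fun k => u k i) (v i))
    {ℓ : ℕ → WDual p D} {ℓ₀ : WDual p D} (hℓ : Tendsto ℓ atTop (𝓝 ℓ₀))
    (hdiv : ∀ k, IsDivergence (u k) (ℓ k)) (hdiv₀ : IsDivergence v ℓ₀)
    {y : ℕ → W0 p Ω} {y₀ : W0 p Ω} (hy : WeaklyConverges y y₀) :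
    WeaklyConverges (fun k => gradAlong hΩD (u k) (y k)) (gradAlong hΩD v y₀) := by
  have hD : volume D ≠ ∞ := hDb.measure_lt_top.ne
  -- After integration by parts, the divergence term pairs a strongly convergent functional with a
  -- weakly convergent argument, and the other terms contain no gradient of `y k`.
  have htest : ∀ φ : Space N → ℝ, IsTestFunction Ω φ →
      Tendsto (fun k => ∫ x in Ω, gradAlong hΩD (u k) (y k) x * φ x) atTop
        (𝓝 (∫ x in Ω, gradAlong hΩD v y₀ x * φ x)) := by
    intro φ hφ
    rw [integral_gradAlong_mul (q := q) hp2 hDo.measurableSet hD hΩD hdiv₀ hφ y₀]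
    refine Tendsto.congr (fun k => (integral_gradAlong_mul (q := q) hp2
      hDo.measurableSet hD hΩD (hdiv k) hφ (y k)).symm) ?_
    exact (tendsto_apply_of_weaklyConverges hℓ (hy.map (mulTest hφ hΩD))).neg.sub
      (tendsto_finsetSum _ fun i _ => tendsto_integral_mul_partialDeriv hp2 hΩ.measurableSet
        (hDb.subset hΩD) hD (fun k => hub k i) (hu i) hφ i hy)
  obtain ⟨K, hK⟩ := exists_norm_gradAlong_le (p := p) (Ω := Ω) hΩD hβ
  obtain ⟨C, -, hC⟩ := hy.exists_norm_le
  have := secondCountableTopology_Lp (volume.restrict Ω) (conjExponent_ne_top (p := p) (q := q) hp2)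
  have hbound : ∀ k, ‖gradAlong hΩD (u k) (y k)‖ ≤ |K| * C := fun k =>
    (hK _ _ (hub k)).trans (mul_le_mul (le_abs_self K) (hC k) (norm_nonneg _) (abs_nonneg K))
  -- The products are bounded in `L^p`, so weak limits of subsequences exist; test functions
  -- identify each of them.
  refine weaklyConverges_of_subseq fun k hk => ?_
  obtain ⟨a, m, hm, ha⟩ := exists_weaklyConverges_subseq_Lp (q := q) hp2 hp
    (z := fun n => gradAlong hΩD (u (k n)) (y (k n))) fun n => hbound (k n)
  refine ⟨m, hm, ?_⟩
  suffices a = gradAlong hΩD v y₀ by rwa [← this]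
  refine Lp_eq_of_forall_integral_eq hΩ fun φ hφ => ?_
  have hφq : MemLp φ q (volume.restrict Ω) := (hφ.memLp q).restrict Ω
  have hpair : ∀ c : LpOn p Ω, toDualLp (volume.restrict Ω) p q hφq.toLp c =
      ∫ x in Ω, c x * φ x := fun c => by
    rw [toDualLp_apply]
    refine integral_congr_ae ?_
    filter_upwards [hφq.coeFn_toLp] with x hx
    rw [hx, mul_comm]
  have h1 := ha (toDualLp (volume.restrict Ω) p q hφq.toLp)
  simp only [hpair] at h1
  exact tendsto_nhds_unique h1 ((htest φ hφ).comp (hk.comp hm).tendsto_atTop)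

end DivCurl

/-! ### The elliptic equation -/

section Elliptic

variable {p q : ℝ≥0∞}

/-- The map `f ↦ |f|^{p-2} f` from `L^p` to `L^q`. -/
noncomputable def powLp {α : Type*} [MeasurableSpace α] {μ : Measure α} (q : ℝ≥0∞)
    [p.HolderConjugate q] (hp2 : 2 ≤ p) (hp : p ≠ ∞) (f : Lp ℝ p μ) : Lp ℝ q μ :=
  (MemLp.signedPow (q := q) hp2 hp (Lp.memLp f)).toLp

theorem powLp_coeFn {α : Type*} [MeasurableSpace α] {μ : Measure α} (hp2 : 2 ≤ p) (hp : p ≠ ∞)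
    [p.HolderConjugate q] (f : Lp ℝ p μ) :
    (powLp q hp2 hp f : α → ℝ) =ᵐ[μ] fun x => signedPow p (f x) :=
  MemLp.coeFn_toLp _

variable [Fact (1 ≤ p)] [Fact (1 ≤ q)] [p.HolderConjugate q]

theorem continuous_toDualLp_powLp {α : Type*} [MeasurableSpace α] {μ : Measure α} (hp2 : 2 ≤ p)
    (hp : p ≠ ∞) (f v w : Lp ℝ p μ) :
    Continuous fun t : ℝ => toDualLp μ p q (powLp q hp2 hp (f + t • v)) w := by
  refine (continuous_integral_signedPow (q := q) hp2 hp (Lp.memLp f) (Lp.memLp v)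
    (Lp.memLp w)).congr fun t => ?_
  rw [toDualLp_apply]
  refine integral_congr_ae ?_
  filter_upwards [powLp_coeFn (q := q) hp2 hp (f + t • v), Lp.coeFn_add f (t • v),
    Lp.coeFn_smul t v] with x h1 h2 h3
  rw [h1, h2, Pi.add_apply, h3, Pi.smul_apply, smul_eq_mul]

variable {N : ℕ} {Ω D : Set (Space N)}

/-- Grouping the form by columns `j` leaves scalar products of a column of `U` with a gradient,
exactly the products that the div-curl lemma covers. -/
theorem integrable_sum_mul_gradAlong (hΩD : Ω ⊆ D) (U : Control D) (w : Fin N → LpOn q Ω)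
    (v : W0 p Ω) : Integrable (fun x => ∑ i, ∑ j, U i j x * w j x * stateGrad v i x)
      (volume.restrict Ω) ∧
    ∑ j, toDualLp (volume.restrict Ω) p q (w j) (gradAlong hΩD (fun i => U i j) v) =
      ∫ x in Ω, ∑ i, ∑ j, U i j x * w j x * stateGrad v i x := by
  have hi : ∀ j, Integrable (fun x => w j x * gradAlong hΩD (fun i => U i j) v x)
      (volume.restrict Ω) := fun j =>
    MemLp.integrable_mul (p := q) (q := p) (Lp.memLp (w j)) (Lp.memLp _)
  have hae : (fun x => ∑ j, w j x * gradAlong hΩD (fun i => U i j) v x) =ᵐ[volume.restrict Ω]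
      fun x => ∑ i, ∑ j, U i j x * w j x * stateGrad v i x := by
    filter_upwards [ae_all_iff.2 fun j => gradAlong_coeFn hΩD (fun i => U i j) v] with x hx
    rw [Finset.sum_comm]
    refine Finset.sum_congr rfl fun j _ => ?_
    rw [hx j, Finset.mul_sum]
    exact Finset.sum_congr rfl fun i _ => by ring
  refine ⟨(integrable_finsetSum _ fun j _ => hi j).congr hae, ?_⟩
  rw [← integral_congr_ae hae, integral_finsetSum _ fun j _ => hi j]
  exact Finset.sum_congr rfl fun j _ => toDualLp_apply _ _

/-- The operator `y ↦ -div(U [(∇y)^{p-2}] ∇y) + |y|^{p-2} y` from `W_0^{1,p}(Ω)` to its dual. -/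
noncomputable def ellipticOp (q : ℝ≥0∞) [Fact (1 ≤ q)] [p.HolderConjugate q] (hp2 : 2 ≤ p)
    (hp : p ≠ ∞) (hΩD : Ω ⊆ D) (U : Control D) (y : W0 p Ω) : WDual p Ω :=
  ∑ j, (toDualLp (volume.restrict Ω) p q (powLp q hp2 hp (jetOn Ω Ω (some j) y))).comp
      (gradAlong hΩD fun i => U i j) +
    (toDualLp (volume.restrict Ω) p q (powLp q hp2 hp (jetOn Ω Ω none y))).comp (jetOn Ω Ω none)

theorem ellipticOp_apply (hp2 : 2 ≤ p) (hp : p ≠ ∞) (hΩD : Ω ⊆ D) (U : Control D) (y v : W0 p Ω) :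
    ellipticOp q hp2 hp hΩD U y v =
      ∑ j, toDualLp (volume.restrict Ω) p q (powLp q hp2 hp (jetOn Ω Ω (some j) y))
        (gradAlong hΩD (fun i => U i j) v) +
      toDualLp (volume.restrict Ω) p q (powLp q hp2 hp (jetOn Ω Ω none y)) (jetOn Ω Ω none v) := by
  simp [ellipticOp]

theorem powLp_jetOn_coeFn {q : ℝ≥0∞} [p.HolderConjugate q] (hp2 : 2 ≤ p) (hp : p ≠ ∞)
    (y : W0 p Ω) (o : Option (Fin N)) :
    (powLp q hp2 hp (jetOn Ω Ω o y) : Space N → ℝ) =ᵐ[volume.restrict Ω]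
      fun x => signedPow p (jetL Ω o y x) := by
  filter_upwards [powLp_coeFn (q := q) hp2 hp (jetOn Ω Ω o y), jetOn_coeFn Ω o y] with x h1 h2
  rw [h1, h2]

theorem isWeakSolution_iff (hp2 : 2 ≤ p) (hp : p ≠ ∞) (hΩD : Ω ⊆ D) (f : WDual p D) (U : Control D)
    (y : W0 p Ω) : IsWeakSolution hΩD f U y ↔
      ∀ v, ellipticOp q hp2 hp hΩD U y v = f (Submodule.inclusion (W0_mono p hΩD) v) := by
  refine forall_congr' fun v => ?_
  rw [ellipticOp_apply, (integrable_sum_mul_gradAlong hΩD U _ v).2, toDualLp_apply]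
  have e1 : ∫ x in Ω, ∑ i, ∑ j, U i j x * powLp q hp2 hp (jetOn Ω Ω (some j) y) x * stateGrad v i x =
      ∫ x in Ω, ∑ i, ∑ j, U i j x * signedPow p (stateGrad y j x) * stateGrad v i x := by
    refine integral_congr_ae ?_
    filter_upwards [ae_all_iff.2 fun j => powLp_jetOn_coeFn (q := q) hp2 hp y (some j)] with x hx
    simp only [hx, jetL_some]
  have e2 : ∫ x in Ω, powLp q hp2 hp (jetOn Ω Ω none y) x * jetOn Ω Ω none v x =
      ∫ x in Ω, signedPow p (stateFun y x) * stateFun v x := by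
    refine integral_congr_ae ?_
    filter_upwards [powLp_jetOn_coeFn (q := q) hp2 hp y none, jetOn_coeFn Ω none v] with x h1 h2
    rw [h1, h2, jetL_none, jetL_none]
  rw [e1, e2]

variable {α β : ℝ} {U : Control D}

theorem ellipticOp_monotone (hp2 : 2 ≤ p) (hp : p ≠ ∞) (hΩD : Ω ⊆ D) (hU : MemM p α β U)
    (y z : W0 p Ω) :
    0 ≤ (ellipticOp q hp2 hp hΩD U y - ellipticOp q hp2 hp hΩD U z) (y - z) := by
  rw [sub_apply, ellipticOp_apply, ellipticOp_apply, add_sub_add_comm, ← Finset.sum_sub_distrib]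
  simp only [← sub_apply, ← map_sub]
  rw [(integrable_sum_mul_gradAlong hΩD U _ _).2, toDualLp_apply]
  refine add_nonneg (integral_nonneg_of_ae ?_) (integral_nonneg_of_ae ?_)
  · have h1 : ∀ j, (powLp q hp2 hp (jetOn Ω Ω (some j) y) - powLp q hp2 hp (jetOn Ω Ω (some j) z) :
        LpOn q Ω) =ᵐ[volume.restrict Ω]
        fun x => signedPow p (stateGrad y j x) - signedPow p (stateGrad z j x) := fun j =>
      (Lp.coeFn_sub _ _).trans ((powLp_jetOn_coeFn hp2 hp y (some j)).sub
        (powLp_jetOn_coeFn hp2 hp z (some j)))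
    have h2 : ∀ i, stateGrad (y - z) i =ᵐ[volume.restrict Ω]
        fun x => stateGrad y i x - stateGrad z i x := fun i =>
      ae_restrict_of_ae (Lp.coeFn_sub (jetL Ω (some i) y) (jetL Ω (some i) z))
    filter_upwards [ae_all_iff.2 h1, ae_all_iff.2 h2,
      ae_restrict_of_ae_restrict_of_subset hΩD hU.monotone] with x h3 h4 h5
    simp only [h3, h4]
    exact h5 (fun i => stateGrad y i x) fun i => stateGrad z i x
  · filter_upwards [Lp.coeFn_sub (powLp q hp2 hp (jetOn Ω Ω none y))
      (powLp q hp2 hp (jetOn Ω Ω none z)), powLp_coeFn (q := q) hp2 hp (jetOn Ω Ω none y),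
      powLp_coeFn (q := q) hp2 hp (jetOn Ω Ω none z),
      Lp.coeFn_sub (jetOn Ω Ω none y) (jetOn Ω Ω none z)] with x h1 h2 h3 h4
    rw [map_sub, h1, h4]
    simp only [Pi.sub_apply, h2, h3, Pi.zero_apply]
    exact signedPow_monotone hp2 hp _ _

/-- The gradient part is coercive with constant `α`, the zero-order part with constant `1`. -/
theorem le_ellipticOp_apply_self (hp2 : 2 ≤ p) (hp : p ≠ ∞) (hΩ : MeasurableSet Ω) (hΩD : Ω ⊆ D)
    (hU : MemM p α β U) (y : W0 p Ω) :
    min α 1 * ‖y‖ ^ p.toReal ≤ ellipticOp q hp2 hp hΩD U y y := by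
  have hp0 : p ≠ 0 := (zero_lt_one.trans_le (Fact.out : 1 ≤ p)).ne'
  obtain ⟨hi, he⟩ := integrable_sum_mul_gradAlong hΩD U
    (fun j => powLp q hp2 hp (jetOn Ω Ω (some j) y)) y
  have hintg : ∀ k, Integrable (fun x => |jetOn Ω Ω (some k) y x| ^ p.toReal) (volume.restrict Ω) :=
    fun k => MemLp.integrable_abs_rpow hp0 hp (Lp.memLp _)
  rw [ellipticOp_apply, he, norm_rpow_W0 hp hΩ, Fintype.sum_option, mul_add, add_comm (min α 1 * _)]
  refine add_le_add ?_ ?_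
  · calc min α 1 * ∑ k, ‖jetOn Ω Ω (some k) y‖ ^ p.toReal
        ≤ α * ∑ k, ‖jetOn Ω Ω (some k) y‖ ^ p.toReal :=
          mul_le_mul_of_nonneg_right (min_le_left _ _) (Finset.sum_nonneg fun k _ => by positivity)
      _ = ∫ x in Ω, α * ∑ k, |jetOn Ω Ω (some k) y x| ^ p.toReal := by
          rw [integral_const_mul, integral_finsetSum _ fun k _ => hintg k]
          simp only [norm_rpow_eq_integral hp]
      _ ≤ _ := by
          refine integral_mono_ae ((integrable_finsetSum _ fun k _ => hintg k).const_mul α) hi ?_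
          filter_upwards [ae_all_iff.2 fun j => powLp_jetOn_coeFn (q := q) hp2 hp y (some j),
            ae_all_iff.2 fun j => jetOn_coeFn Ω (some j) y,
            ae_restrict_of_ae_restrict_of_subset hΩD hU.coercive] with x h1 h2 h3
          simp only [h1, h2]
          exact h3 fun i => stateGrad y i x
  · calc min α 1 * ‖jetOn Ω Ω none y‖ ^ p.toReal ≤ ‖jetOn Ω Ω none y‖ ^ p.toReal :=
          mul_le_of_le_one_left (by positivity) (min_le_right _ _)
      _ = _ := by
          rw [norm_rpow_eq_integral hp, toDualLp_apply]
          refine integral_congr_ae ?_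
          filter_upwards [powLp_coeFn (q := q) hp2 hp (jetOn Ω Ω none y)] with x h1
          rw [h1, signedPow_mul_self hp2 hp]

theorem continuous_ellipticOp (hp2 : 2 ≤ p) (hp : p ≠ ∞) (hΩD : Ω ⊆ D) (U : Control D)
    (y v w : W0 p Ω) :
    Continuous fun t : ℝ => ellipticOp q hp2 hp hΩD U (y + t • v) w := by
  simp only [ellipticOp_apply, map_add, map_smul]
  exact (continuous_finsetSum _ fun j _ => continuous_toDualLp_powLp hp2 hp _ _ _).add
    (continuous_toDualLp_powLp hp2 hp _ _ _)

/-- Extension by zero as a continuous linear map. -/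
noncomputable def inclusionW0 (hΩD : Ω ⊆ D) : W0 p Ω →L[ℝ] W0 p D :=
  ⟨Submodule.inclusion (W0_mono p hΩD), continuous_inclusion (W0_mono p hΩD)⟩

/-- If `‖y‖` is large then the elliptic operator dominates a given functional. -/
theorem lt_ellipticOp_apply_self (hp2 : 2 ≤ p) (hp : p ≠ ∞) (hΩ : MeasurableSet Ω) (hΩD : Ω ⊆ D)
    (hα : 0 < α) (hU : MemM p α β U) (f : WDual p Ω) {y : W0 p Ω}
    (hy : max 1 (‖f‖ / min α 1) < ‖y‖) : f y < ellipticOp q hp2 hp hΩD U y y := by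
  have hm : 0 < min α 1 := lt_min hα one_pos
  have h2 := two_le_toReal hp2 hp
  obtain ⟨hy1, hy2⟩ := max_lt_iff.1 hy
  rw [div_lt_iff₀ hm] at hy2
  refine lt_of_lt_of_le ?_ (le_ellipticOp_apply_self hp2 hp hΩ hΩD hU y)
  -- For norms above `1` the power `p ≥ 2` dominates the square, which beats the linear functional.
  have h3 : ‖y‖ ^ (2 : ℝ) ≤ ‖y‖ ^ p.toReal := Real.rpow_le_rpow_of_exponent_le hy1.le h2
  rw [Real.rpow_two] at h3
  calc f y ≤ ‖f‖ * ‖y‖ := (le_abs_self _).trans (f.le_opNorm y)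
    _ < ‖y‖ * min α 1 * ‖y‖ := by gcongr
    _ = min α 1 * ‖y‖ ^ 2 := by ring
    _ ≤ _ := by gcongr

/-- Weak solutions exist. -/
theorem exists_isWeakSolution (q : ℝ≥0∞) [Fact (1 ≤ q)] [p.HolderConjugate q] (hp2 : 2 ≤ p)
    (hp : p ≠ ∞) (hΩ : MeasurableSet Ω) (hΩD : Ω ⊆ D)
    (hα : 0 < α) (hU : MemM p α β U) (f : WDual p D) : ∃ y : W0 p Ω, IsWeakSolution hΩD f U y := by
  have := separableSpace_W0 (p := p) (Ω := Ω) hp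
  let f' : WDual p Ω := f.comp (inclusionW0 hΩD)
  obtain ⟨y, hy⟩ := exists_apply_eq_of_monotone
    (fun y C hy => exists_weaklyConverges_subseq_W0 (q := q) (Ω := Ω) hp2 hp y C hy)
    (Φ := fun y => ellipticOp q hp2 hp hΩD U y - f')
    (fun y z => by simpa using ellipticOp_monotone (q := q) hp2 hp hΩD hU y z)
    (fun y v => ⟨1, one_pos, ((continuous_ellipticOp hp2 hp hΩD U y v v).sub
      continuous_const).continuousOn⟩)
    (lam := max 1 (‖f'‖ / min α 1)) (lt_max_of_lt_left one_pos)
    (fun z hz => sub_nonneg.2 (lt_ellipticOp_apply_self hp2 hp hΩ hΩD hα hU f' hz).le)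
  refine ⟨y, (isWeakSolution_iff (q := q) hp2 hp hΩD f U y).2 fun v => ?_⟩
  rw [sub_eq_zero.1 hy]
  rfl

/-- Weak solutions are bounded, uniformly in the control. -/
theorem norm_le_of_isWeakSolution (q : ℝ≥0∞) [Fact (1 ≤ q)] [p.HolderConjugate q] (hp2 : 2 ≤ p)
    (hp : p ≠ ∞) (hΩ : MeasurableSet Ω) (hΩD : Ω ⊆ D)
    (hα : 0 < α) (hU : MemM p α β U) (f : WDual p D) {y : W0 p Ω}
    (hy : IsWeakSolution hΩD f U y) :
    ‖y‖ ≤ max 1 (‖f.comp (inclusionW0 hΩD)‖ / min α 1) := by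
  by_contra! h
  have := lt_ellipticOp_apply_self (q := q) hp2 hp hΩ hΩD hα hU (f.comp (inclusionW0 hΩD)) h
  rw [(isWeakSolution_iff (q := q) hp2 hp hΩD f U y).1 hy y] at this
  exact lt_irrefl _ this

/-- Limits of weak solutions are weak solutions for the limit control. -/
theorem isWeakSolution_of_weaklyConverges (hp2 : 2 ≤ p) (hp : p ≠ ∞)
    (hΩ : IsOpen Ω) (hDo : IsOpen D) (hDb : Bornology.IsBounded D) (hΩD : Ω ⊆ D)
    {U : ℕ → Control D} {V : Control D} (hβ : 0 ≤ β) (hU : ∀ k, MemM p α β (U k))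
    (hconv : ∀ i j, ConvergesAgainst (volume.restrict D) q (fun n => U n i j) (V i j))
    (hdiv : ∀ i, ∃ (ℓ : ℕ → WDual p D) (ℓ₀ : WDual p D), Tendsto ℓ atTop (𝓝 ℓ₀) ∧
        (∀ n, IsDivergence (fun a => U n a i) (ℓ n)) ∧ IsDivergence (fun a => V a i) ℓ₀)
    (f : WDual p D) {y : ℕ → W0 p Ω} {y₀ : W0 p Ω} (hsol : ∀ k, IsWeakSolution hΩD f (U k) (y k))
    (hy : WeaklyConverges y y₀) : IsWeakSolution hΩD f V y₀ := by
  let f' : WDual p Ω := f.comp (inclusionW0 hΩD)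
  -- Monotonicity moves the nonlinearity onto the fixed `v`. What remains is bilinear in `U k` and
  -- `y k - v`, and the div-curl lemma gives its limit.
  have hvar : ∀ v : W0 p Ω, 0 ≤ (f' - ellipticOp q hp2 hp hΩD V v) (y₀ - v) := by
    intro v
    have hyv : WeaklyConverges (fun k => y k - v) (y₀ - v) := fun ℓ => by
      simpa using (hy ℓ).sub_const (ℓ v)
    have hlim : Tendsto (fun k => (f' - ellipticOp q hp2 hp hΩD (U k) v) (y k - v)) atTop
        (𝓝 ((f' - ellipticOp q hp2 hp hΩD V v) (y₀ - v))) := by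
      simp only [sub_apply, ellipticOp_apply]
      refine (hyv f').sub (Tendsto.add (tendsto_finsetSum _ fun j _ => ?_)
        (hyv.map (jetOn Ω Ω none) _))
      obtain ⟨ℓ, ℓ₀, h1, h2, h3⟩ := hdiv j
      exact weaklyConverges_gradAlong (q := q) hp2 hp hΩ hDo hDb hΩD hβ
        (u := fun k i => U k i j) (v := fun i => V i j) (fun k i => (hU k).growth i j)
        (fun i => hconv i j) h1 h2 h3 hyv _
    refine ge_of_tendsto' hlim fun k => ?_
    have h := ellipticOp_monotone (q := q) hp2 hp hΩD (hU k) (y k) v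
    rw [sub_apply, (isWeakSolution_iff (q := q) hp2 hp hΩD f (U k) (y k)).1 (hsol k)] at h
    exact h
  -- The variational inequality at `y₀ + t • v`, divided by `t`, as `t` decreases to zero.
  have hle : ∀ v, f' v ≤ ellipticOp q hp2 hp hΩD V y₀ v := by
    intro v
    have hc := (continuous_ellipticOp (q := q) hp2 hp hΩD V y₀ v v).tendsto 0
    rw [zero_smul, add_zero] at hc
    refine ge_of_tendsto (hc.mono_left (nhdsWithin_le_nhds (s := Ioi 0))) ?_
    filter_upwards [self_mem_nhdsWithin] with t ht
    have h := hvar (y₀ + t • v)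
    rw [sub_add_cancel_left, map_neg, map_smul, sub_apply, smul_eq_mul] at h
    have ht' : (0 : ℝ) < t := ht
    nlinarith
  refine (isWeakSolution_iff (q := q) hp2 hp hΩD f V y₀).2 fun v => le_antisymm ?_ (hle v)
  have h := hle (-v)
  rw [map_neg, map_neg] at h
  exact neg_le_neg_iff.1 h

end Elliptic

/-! ### Monotone linear graphs -/

section MonotoneGraph

variable {X E : Type*} [NormedAddCommGroup X] [NormedSpace ℝ X] [NormedAddCommGroup E]
  [NormedSpace ℝ E] {A : E →L[ℝ] StrongDual ℝ X} {B : E →L[ℝ] X}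

/-- The graph of a positive linear operator is maximal monotone. -/
theorem eq_neg_of_forall_nonneg (hA : Function.Surjective A) (hB : ∀ w, 0 ≤ A w (B w))
    {w : E} {z : X} (h : ∀ ω, 0 ≤ A (ω - w) (B ω + z)) : z = -B w := by
  rw [eq_neg_iff_add_eq_zero]
  refine SeparatingDual.eq_zero_of_forall_dual_eq_zero (R := ℝ) fun ℓ => ?_
  obtain ⟨η, rfl⟩ := hA ℓ
  have hb := hB η
  generalize ha : A η (z + B w) = a
  generalize hb' : A η (B η) = b at hb
  -- The hypothesis along the line `w + t • η`. Taking `t = -(a / (b + 1))` turns the right side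
  -- into `-(a / (b + 1)) ^ 2`, so `a = 0`.
  have key : ∀ t : ℝ, 0 ≤ t * (a + t * b) := fun t => by
    have h1 := h (w + t • η)
    have e : B (w + t • η) + z = (z + B w) + t • B η := by
      rw [map_add, map_smul]
      abel
    rwa [add_sub_cancel_left, e, map_smul, smul_apply, map_add, map_smul, ha, hb', smul_eq_mul,
      smul_eq_mul] at h1
  have h1 := key (-(a / (b + 1)))
  have e : -(a / (b + 1)) * (a + -(a / (b + 1)) * b) = -(a / (b + 1)) ^ 2 := by
    field_simp
    ring
  rw [e, neg_nonneg] at h1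
  have h2 : a / (b + 1) = 0 := pow_eq_zero_iff two_ne_zero |>.1 (le_antisymm h1 (sq_nonneg _))
  exact (div_eq_zero_iff.1 h2).resolve_right (by linarith)

/-- Weak limits of solutions of the equations `z = -B (G k z)`. -/
theorem eq_neg_of_weaklyConverges [CompleteSpace X] [TopologicalSpace.SeparableSpace X]
    (hA : Function.Surjective A) (hB : ∀ w, 0 ≤ A w (B w))
    {s : Seminorm ℝ X} (hs : IsCompactSeminorm s) {c : ℝ → ℝ → ℝ} (hc : IsModulus c)
    {G : ℕ → X → E} {G₀ : X → E} (hG : ∀ k, HasSBV s c fun z => A (G k z))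
    (hrad : IsRadiallyContinuous fun z => A (G₀ z))
    (hconv : ∀ v, Tendsto (fun k => G k v) atTop (𝓝 (G₀ v)))
    {z : ℕ → X} {z₀ : X} (hz : WeaklyConverges z z₀) (hsol : ∀ k, z k = -B (G k (z k))) :
    z₀ = -B (G₀ z₀) := by
  have hAconv : ∀ v, Tendsto (fun k => A (G k v)) atTop (𝓝 (A (G₀ v))) := fun v =>
    (A.continuous.tendsto _).comp (hconv v)
  obtain ⟨C, -, hzC⟩ := hz.exists_norm_le
  -- Along solutions `A (G k (z k)) (z k)` is nonpositive, because it equals minus the pairing of `G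
  -- k (z k)` with its image under `B`.
  obtain ⟨K, hK⟩ := exists_norm_le_of_hasSBV hs hc hG
    (fun v => by
      obtain ⟨M, hM⟩ := (Metric.isBounded_range_of_tendsto _ (hAconv v)).exists_norm_le
      exact ⟨M, fun k => hM _ ⟨k, rfl⟩⟩) hzC 0 (a := fun _ => 1) (fun _ => le_rfl)
    (fun k => by
      have h1 := hB (G k (z k))
      have h2 : A (G k (z k)) (z k - 0) = -A (G k (z k)) (B (G k (z k))) := by
        rw [sub_zero, ← map_neg, ← hsol]
      rw [h2]
      linarith)
  obtain ⟨φ, k, hk, hφ⟩ := exists_tendsto_apply_subseq hK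
  obtain ⟨w, rfl⟩ := hA φ
  have hzk := hz.comp_strictMono hk
  -- Positivity of `B` at `ω - G (k n) (z (k n))`: an upper bound for the product of the two weakly
  -- convergent quantities whose right side has a limit.
  have hmono : ∀ ω n, A (G (k n) (z (k n))) (z (k n)) ≤
      A ω (B ω + z (k n)) - A (G (k n) (z (k n))) (B ω) := fun ω n => by
    have h1 := hB (ω - G (k n) (z (k n)))
    rw [map_sub B, sub_eq_add_neg (B ω), ← hsol (k n), map_sub, sub_apply,
      map_add (A (G (k n) (z (k n))))] at h1
    linarith
  have hlim : ∀ ω, Tendsto (fun n => A ω (B ω + z (k n)) - A (G (k n) (z (k n))) (B ω)) atTop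
      (𝓝 (A ω (B ω + z₀) - A w (B ω))) := fun ω => by
    simp only [map_add]
    exact ((hzk _).const_add _).sub (hφ _)
  -- Comparing this upper bound with the lower bound from semi-bounded variation shows that the
  -- limit pair satisfies the criterion for the maximal monotone graph.
  have hzw : z₀ = -B w := by
    refine eq_neg_of_forall_nonneg hA hB fun ω => le_of_forall_pos_le_add fun ε hε => ?_
    have h1 := ge_of_tendsto (hlim ω) ((eventually_le_apply_of_hasSBV hs hc (fun n => hG (k n)) hzk
      ((hAconv z₀).comp hk.tendsto_atTop) (hφ z₀) hε).mono fun n hn => hn.trans (hmono ω n))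
    rw [map_sub, sub_apply, map_add (A w)]
    linarith
  -- The upper bound with `ω = w` tends to `A w z₀`, which is the condition needed in Minty's
  -- argument.
  have hw : A w = A (G₀ z₀) := by
    refine eq_of_hasSBV hs hc (fun n => hG (k n)) hrad
      (fun v => (hAconv v).comp hk.tendsto_atTop) hzk hφ fun ε hε => ?_
    have h1 := hlim w
    rw [map_add, add_sub_cancel_left] at h1
    filter_upwards [h1.eventually (gt_mem_nhds (lt_add_of_pos_right _ hε))] with n hn
    exact (hmono w n).trans hn.le
  -- Injectivity of `A` is not assumed, so `w` is replaced by `G₀ z₀` inside the graph criterion,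
  -- which sees only their images under `A`.
  refine eq_neg_of_forall_nonneg hA hB fun ω => ?_
  have h2 := hB (ω - w)
  rwa [map_sub B, sub_eq_add_neg (B ω), ← hzw, map_sub, hw, ← map_sub] at h2

end MonotoneGraph

/-! ### The Hammerstein equation -/

section Hammerstein

variable {N : ℕ} {p q : ℝ≥0∞} [Fact (1 ≤ p)] [Fact (1 ≤ q)] [p.HolderConjugate q]
  {Ω D : Set (Space N)}

theorem toDualLp_eq_pairing (w : LpOn q Ω) (z : LpOn p Ω) :
    toDualLp (volume.restrict Ω) p q w z = pairing w z :=
  toDualLp_apply w z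

theorem solvesHammerstein_iff (hΩ : IsOpen Ω) (hΩD : Ω ⊆ D) (B : LpOn q Ω →L[ℝ] LpOn p Ω)
    (F : W0 p Ω → LpOn p Ω → LpOn q Ω) (g : LpOn p D) (y : W0 p Ω) (z : LpOn p Ω) :
    SolvesHammerstein B F g y z ↔ z + B (F y z) = restrictLp hΩD g := by
  have hadd : ∀ φ : Space N → ℝ, IsTestFunction Ω φ → ∫ x in Ω, (z + B (F y z) : LpOn p Ω) x * φ x =
      (∫ x in Ω, z x * φ x) + ∫ x in Ω, B (F y z) x * φ x := by
    intro φ hφ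
    have hi : ∀ c : LpOn p Ω, Integrable (fun x => c x * φ x) (volume.restrict Ω) := fun c =>
      (Lp.memLp c).integrable_mul ((hφ.memLp q).restrict Ω)
    rw [← integral_add (hi _) (hi _)]
    refine integral_congr_ae ?_
    filter_upwards [Lp.coeFn_add z (B (F y z))] with x hx
    rw [hx, Pi.add_apply, add_mul]
  have hg : ∀ φ : Space N → ℝ, ∫ x in Ω, restrictLp hΩD g x * φ x = ∫ x in Ω, g x * φ x := by
    intro φ
    refine integral_congr_ae ?_
    filter_upwards [restrictLp_coeFn hΩD g] with x hx
    rw [hx]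
  constructor
  · intro h
    refine Lp_eq_of_forall_integral_eq hΩ fun φ hφ => ?_
    rw [hadd φ hφ, hg, h φ hφ]
  · intro h φ hφ
    rw [← hadd φ hφ, ← hg, h]

variable {F : W0 p Ω → LpOn p Ω → LpOn q Ω}

/-- The bound holds for every index `y'`, so one fixed index supplies a common modulus for all
states in `Y₀`. The shift by `h` cancels in differences. -/
theorem HasUSBV.exists_hasSBV (hF : HasUSBV F) {Y₀ : Set (W0 p Ω)} (hY : Bornology.IsBounded Y₀)
    (hne : Y₀.Nonempty) (h : LpOn q Ω) :
    ∃ (s : Seminorm ℝ (LpOn p Ω)) (c : ℝ → ℝ → ℝ), IsCompactSeminorm s ∧ IsModulus c ∧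
      ∀ y ∈ Y₀, HasSBV s c fun z => toDualLp (volume.restrict Ω) p q (F y z - h) := by
  obtain ⟨s, C, hs, hC, hle⟩ := hF Y₀ hY
  obtain ⟨y₀, hy₀⟩ := hne
  refine ⟨s, C y₀, hs, fun R hR => ⟨?_, (hC y₀ hy₀).2 R hR⟩, fun y hy R hR z₁ z₂ h1 h2 => ?_⟩
  · exact (hC y₀ hy₀).1.comp (f := fun t : ℝ => (R, t)) (by fun_prop) fun t ht => ⟨hR.le, ht⟩
  · refine (hle R hR z₁ z₂ h1 h2 y hy y₀ hy₀).trans_eq ?_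
    rw [← map_sub, sub_sub_sub_cancel_right, toDualLp_eq_pairing]

theorem isRadiallyContinuous_sub {G : LpOn p Ω → LpOn q Ω} (hG : RadiallyContinuous G)
    (h : LpOn q Ω) :
    IsRadiallyContinuous fun z => toDualLp (volume.restrict Ω) p q (G z - h) := by
  intro z₁ z₂
  obtain ⟨ε, hε, hc⟩ := hG z₁ z₂
  refine ⟨ε, hε, ?_⟩
  simp only [map_sub, sub_apply, toDualLp_eq_pairing]
  exact hc.sub continuousOn_const

theorem separableSpace_LpOn {r : ℝ≥0∞} [Fact (1 ≤ r)] (hr : r ≠ ∞) (Ω : Set (Space N)) :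
    TopologicalSpace.SeparableSpace (LpOn r Ω) := by
  have := secondCountableTopology_Lp (volume.restrict Ω) hr
  infer_instance

/-- Existence of solutions of Hammerstein equations. -/
theorem exists_add_apply_eq (hp2 : 2 ≤ p) (hp : p ≠ ∞) (B : LpOn q Ω →L[ℝ] LpOn p Ω)
    (hB : ∀ w, 0 ≤ pairing w (B w)) (hF : HasUSBV F) (y : W0 p Ω)
    (hrad : RadiallyContinuous (F y)) (h : LpOn q Ω) {lam : ℝ} (hlam : 0 < lam)
    (hcoer : ∀ z : LpOn p Ω, lam < ‖z‖ → 0 ≤ pairing (F y z - h) z) :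
    ∃ z, z + B (F y z) = B h := by
  have hq := conjExponent_ne_top (p := p) (q := q) hp2
  have := secondCountableTopology_Lp (volume.restrict Ω) hq
  have := separableSpace_LpOn hp Ω
  have hB' : ∀ w, 0 ≤ toDualLp (volume.restrict Ω) p q w (B w) := fun w => by
    rw [toDualLp_eq_pairing]
    exact hB w
  obtain ⟨s, c, hs, hc, hsbv⟩ := hF.exists_hasSBV (Y₀ := {y}) Bornology.isBounded_singleton
    (singleton_nonempty y) h
  obtain ⟨z, hz⟩ := exists_forall_apply_nonneg
    (fun z C hz => exists_weaklyConverges_subseq_Lp (q := q) hp2 hp hz) hs hc (hsbv y rfl)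
    (isRadiallyContinuous_sub hrad h) hlam
    (fun z hz => by rw [toDualLp_eq_pairing]; exact hcoer z hz) B
    (toDualLp (volume.restrict Ω) p q) hB'
    (fun z φ => by
      -- If `w` represents `φ`, then `ω = -w` makes the first factor vanish; this is where Riesz
      -- representation gives maximality.
      obtain ⟨w, rfl⟩ := toDualLp_surjective (q := q) hp2 hp φ
      exact ⟨-w, by simp⟩)
  refine ⟨z, ?_⟩
  have := eq_neg_of_forall_nonneg (toDualLp_surjective hp2 hp) hB' (w := F y z - h) (z := z) fun ω => by
    have h1 := hz (-ω)
    rw [← map_add, map_neg, ← neg_add', neg_add_eq_sub, ← neg_sub, map_neg, map_neg] at h1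
    simpa using h1
  rw [map_sub, neg_sub] at this
  rw [eq_sub_iff_add_eq.1 this]

/-- Weak limits of solutions of Hammerstein equations are solutions. -/
theorem add_apply_eq_of_weaklyConverges (hp2 : 2 ≤ p) (hp : p ≠ ∞) (B : LpOn q Ω →L[ℝ] LpOn p Ω)
    (hB : ∀ w, 0 ≤ pairing w (B w)) (hF : HasUSBV F) (hrad : ∀ y, RadiallyContinuous (F y))
    (hcomp : CompactInState F) (h : LpOn q Ω) {y : ℕ → W0 p Ω} {y₀ : W0 p Ω}
    {z : ℕ → LpOn p Ω} {z₀ : LpOn p Ω} (hy : WeaklyConverges y y₀) (hz : WeaklyConverges z z₀)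
    (hsol : ∀ k, z k + B (F (y k) (z k)) = B h) : z₀ + B (F y₀ z₀) = B h := by
  have := separableSpace_LpOn hp Ω
  obtain ⟨C, hC, hyC⟩ := hy.exists_norm_le
  obtain ⟨s, c, hs, hc, hsbv⟩ := hF.exists_hasSBV (Y₀ := range y)
    (isBounded_iff_forall_norm_le.2 ⟨C, by rintro _ ⟨k, rfl⟩; exact hyC k⟩) (range_nonempty y) h
  have key : z₀ = -B (F y₀ z₀ - h) :=
    eq_neg_of_weaklyConverges (toDualLp_surjective hp2 hp)
      (fun w => (toDualLp_eq_pairing w (B w)).symm ▸ hB w) hs hc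
      (G := fun k v => F (y k) v - h) (G₀ := fun v => F y₀ v - h) (fun k => hsbv _ ⟨k, rfl⟩)
      (isRadiallyContinuous_sub (hrad y₀) h) (fun v => (hcomp v y y₀ hy).sub_const h) hz
      fun k => by rw [map_sub, neg_sub, eq_sub_iff_add_eq, hsol]
  rwa [map_sub, neg_sub, eq_sub_iff_add_eq] at key

theorem cost_eq_norm_rpow (hp : p ≠ ∞) (hΩD : Ω ⊆ D) (zd : LpOn p D)
    (t : Control D × W0 p Ω × LpOn p Ω) :
    cost zd t = ‖t.2.2 - restrictLp hΩD zd‖ ^ p.toReal := by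
  rw [norm_rpow_eq_integral hp, cost]
  refine integral_congr_ae ?_
  filter_upwards [Lp.coeFn_sub t.2.2 (restrictLp hΩD zd), restrictLp_coeFn hΩD zd] with x h1 h2
  rw [h1, Pi.sub_apply, h2]

end Hammerstein

end HammersteinOCP

/-! ### Existence of an optimal triplet -/

open HammersteinOCP in
theorem mainTheorem1
    -- the exponents: `2 ≤ p < ∞` and `1/p + 1/q = 1`
    {N : ℕ} (hN : 1 ≤ N) {p q : ℝ≥0∞} [Fact (1 ≤ p)] [Fact (1 ≤ q)] [p.HolderConjugate q]
    (hp2 : 2 ≤ p) (hp : p ≠ ∞)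
    -- bounded open sets `Ω ⊂⊂ D` (`hΩD` only names a consequence of `hcl`)
    {Ω D : Set (Space N)} (hΩo : IsOpen Ω) (hDo : IsOpen D) (hDb : Bornology.IsBounded D)
    (hcl : closure Ω ⊆ D) (hΩD : Ω ⊆ D)
    -- the data of the set of admissible controls
    {α β : ℝ} (hα : 0 < α) (hαβ : α ≤ β)
    (ξ₁ ξ₂ : LpOn ∞ D) (hξ : ∀ᵐ x ∂(volume.restrict D), 0 ≤ ξ₁ x ∧ ξ₁ x ≤ ξ₂ x)
    (Q : Fin N → Set (WDual p D))
    (hQ : ∀ i, (Q i).Nonempty ∧ IsCompact (Q i) ∧ Convex ℝ (Q i))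
    (hUad : (Ub p α β ξ₁ ξ₂ ∩ Usol p α β Q).Nonempty)
    -- the distributions `f`, `g`, `z_d`
    (f : WDual p D) (g zd : LpOn p D)
    -- `B` is linear, continuous and positive, with a right inverse `Br` on a set `T` containing `g`
    (B : LpOn q Ω →L[ℝ] LpOn p Ω) (hB : ∀ w, 0 ≤ pairing w (B w))
    (T : Set (LpOn p Ω)) (Br : LpOn p Ω → LpOn q Ω) (hBr : T.RightInvOn Br B)
    (hgT : restrictLp hΩD g ∈ T)
    -- the conditions on `F`
    (F : W0 p Ω → LpOn p Ω → LpOn q Ω)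
    (hF_usbv : HasUSBV F)
    (hF_rad : ∀ y, RadiallyContinuous (F y))
    (hF_coer : ∀ Y₀ : Set (W0 p Ω), Bornology.IsBounded Y₀ → ∃ lam > (0 : ℝ), ∀ y ∈ Y₀,
      ∀ z : LpOn p Ω, lam < ‖z‖ → 0 ≤ pairing (F y z - Br (restrictLp hΩD g)) z)
    (hF_comp : CompactInState F) :
    ∃ t ∈ admissible hΩD (Ub p α β ξ₁ ξ₂ ∩ Usol p α β Q) B F f g,
      IsMinOn (cost zd) (admissible hΩD (Ub p α β ξ₁ ξ₂ ∩ Usol p α β Q) B F f g) t := by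
  have hβ : 0 ≤ β := hα.le.trans hαβ
  have hD : volume D ≠ ∞ := hDb.measure_lt_top.ne
  have hΩm := hΩo.measurableSet
  have := secondCountableTopology_Lp (volume.restrict Ω) (conjExponent_ne_top (p := p) (q := q) hp2)
  -- Writing the right side as `B h` turns the Hammerstein equation into `z = -B (F y z - h)`.
  have hBh : B (Br (restrictLp hΩD g)) = restrictLp hΩD g := hBr hgT
  let Ξ := admissible hΩD (Ub p α β ξ₁ ξ₂ ∩ Usol p α β Q) B F f g
  have hne : Ξ.Nonempty := by
    obtain ⟨U, hU⟩ := hUad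
    obtain ⟨y, hy⟩ := exists_isWeakSolution q hp2 hp hΩm hΩD hα hU.1.1 f
    obtain ⟨lam, hlam, hcoer⟩ := hF_coer {y} Bornology.isBounded_singleton
    obtain ⟨z, hz⟩ := exists_add_apply_eq hp2 hp B hB hF_usbv y (hF_rad y) _ hlam (hcoer y rfl)
    exact ⟨(U, y, z), hU, hy, (solvesHammerstein_iff hΩo hΩD B F g y z).2 (hz.trans hBh)⟩
  -- The cost is the `p`-th power of this distance, so both have the same minimizers, and the
  -- distance is weakly lower semicontinuous.
  let d : Control D × W0 p Ω × LpOn p Ω → ℝ := fun t => ‖t.2.2 - restrictLp hΩD zd‖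
  obtain ⟨r, hr_anti, hr, hr_mem⟩ := exists_seq_tendsto_sInf (hne.image d)
    ⟨0, by rintro _ ⟨t, -, rfl⟩; exact norm_nonneg _⟩
  choose t ht htr using hr_mem
  obtain ⟨V, hV, k₁, hk₁, hVconv, hVdiv⟩ := exists_admissible_control_subseq (q := q) hp2 hp hD
    (fun i => (hQ i).2.1) fun n => (ht n).1
  obtain ⟨y₀, k₂, hk₂, hy₀⟩ := exists_weaklyConverges_subseq_W0 (q := q) hp2 hp
    (fun n => (t (k₁ n)).2.1) _ fun n =>
      norm_le_of_isWeakSolution q hp2 hp hΩm hΩD hα (ht (k₁ n)).1.1.1 f (ht (k₁ n)).2.1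
  -- The distances to `zd` decrease from `r 0`, which bounds the `z` components.
  obtain ⟨z₀, k₃, hk₃, hz₀⟩ := exists_weaklyConverges_subseq_Lp (q := q) hp2 hp
    (z := fun n => (t (k₁ (k₂ n))).2.2) (C := r 0 + ‖restrictLp hΩD zd‖) fun n =>
      (norm_le_norm_sub_add _ (restrictLp hΩD zd)).trans
        (add_le_add_left ((htr _).le.trans (hr_anti (Nat.zero_le _))) _)
  have hy : WeaklyConverges (fun n => (t (k₁ (k₂ (k₃ n)))).2.1) y₀ := hy₀.comp_strictMono hk₃
  have hk : StrictMono fun n => k₂ (k₃ n) := hk₂.comp hk₃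
  refine ⟨(V, y₀, z₀), ⟨hV, ?_, ?_⟩, fun t' ht' => ?_⟩
  · refine isWeakSolution_of_weaklyConverges (q := q) hp2 hp hΩo hDo hDb hΩD hβ
      (U := fun n => (t (k₁ (k₂ (k₃ n)))).1) (fun n => (ht _).1.1.1)
      (fun i j w hw => (hVconv i j w hw).comp hk.tendsto_atTop) (fun i => ?_) f
      (fun n => (ht _).2.1) hy
    obtain ⟨ℓ, ℓ₀, h1, h2, h3⟩ := hVdiv i
    exact ⟨fun n => ℓ (k₂ (k₃ n)), ℓ₀, h1.comp hk.tendsto_atTop, fun n => h2 _, h3⟩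
  · refine (solvesHammerstein_iff hΩo hΩD B F g y₀ z₀).2 ?_
    rw [← hBh]
    refine add_apply_eq_of_weaklyConverges hp2 hp B hB hF_usbv hF_rad hF_comp _ hy hz₀ fun n => ?_
    rw [hBh]
    exact (solvesHammerstein_iff hΩo hΩD B F g _ _).1 (ht _).2.2
  · have h1 : WeaklyConverges (fun n => (t (k₁ (k₂ (k₃ n)))).2.2 - restrictLp hΩD zd)
        (z₀ - restrictLp hΩD zd) := fun ℓ => by
      simpa using (hz₀ ℓ).sub_const (ℓ (restrictLp hΩD zd))
    have h2 : ‖z₀ - restrictLp hΩD zd‖ ≤ sInf (d '' Ξ) :=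
      h1.norm_le_of_tendsto (fun n => (htr _).le) (hr.comp (hk₁.comp hk).tendsto_atTop)
    have h3 : sInf (d '' Ξ) ≤ d t' :=
      csInf_le ⟨0, by rintro _ ⟨t, -, rfl⟩; exact norm_nonneg _⟩ ⟨t', ht', rfl⟩
    show cost zd (V, y₀, z₀) ≤ cost zd t'
    rw [cost_eq_norm_rpow hp hΩD, cost_eq_norm_rpow hp hΩD]
    exact Real.rpow_le_rpow (norm_nonneg _) (h2.trans h3) ENNReal.toReal_nonneg
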